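/- Let $0<\alpha<1$, $L,T>0$, $\sigma>0$, $\gamma\ge 1$, and let $M,\widetilde C_\gamma,\widetilde c_\gamma>0$, $C_f>0$, $\rho>1$ be constants. Put $\mathcal I^{(\alpha)}\varphi(t)=\frac1{\Gamma(\alpha)}\int_0^t(t-\zeta)^{\alpha-1}\varphi(\zeta)\,d\zeta$, and let $u$ solve $$u_t+uu_x-\mathcal I^{(\alpha)}u_{xx}=f\ \text{ in }(0,L)\times(0,T],\qquad u(0,t)=u(L,t)=0\ (0<t\le T),\qquad u(\cdot,0)=u_0,$$ where $u(x,\cdot)$ is continuous on $[0,T]$ for every $x\in[0,L]$. For an integer $J\ge1$ let $h=L/J$, $x_j=jh$ and $\|w\|=\big(h\sum_{j=1}^{J-1}w_j^2\big)^{1/2}$; for a function $w$ of $x$, $\|w\|$ means the norm of $(w(x_j))_j$. A prime denotes $\partial_t$. Assume that $u(\cdot,t)\in C^4([0,L])$ for $0<t\le T$ with $\partial_x^4u$ bounded on $[0,L]\times(0,T]$, that $c_0:=\sup_{[0,L]\times(0,T]}\max\{|u|,|u_x|\}<\infty$, that $u_{xx}(x,\cdot)$ and $f(x,\cdot)$ are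 twice differentiable on $(0,T]$ for $0<x<L$, and that for all $0<t\le T$ and all $J\ge 1$ $$t\|u_{xx}'(\cdot,t)\|+t^2\|u_{xx}''(\cdot,t)\|\le M t^{\sigma-1},\qquad t\|f'(\cdot,t)\|+t^2\|f''(\cdot,t)\|\le M t^{\sigma-1}.$$ Then there is a constant $C$, independent of $J$, $N$, $k$ and of the temporal mesh, such that the following holds for all $J,N\ge1$, all $k>0$ and every temporal mesh $0=t_0<t_1<\dots<t_N\le T$, with $k_n=t_n-t_{n-1}$, that satisfies * $k_n\le\widetilde C_\gamma k\min\{1,t_n^{1-1/\gamma}\}$ for $1\le n\le N$; * $t_1\ge\widetilde c_\gamma k^\gamma$, and $t_n\le\widetilde C_\gamma t_{n-1}$ for $2\le n\le N$; * $0\le k_{n+1}-k_n\le\widetilde C_\gamma k^2\,t_n^{1-2/\gamma}$ for $2\le n\le N-1$; * $c_0k_N\le1$, and, if $\gamma=2/\sigma$, also $t_N\ge\rho\,t_1$. Let $f^{n-1/2}=(f_j^{n-1/2})_{1\le j\le J-1}$, $1\le n\le N$, be grid functions with $$\Big\|k_1f^{1/2}-\int_{t_0}^{t_1}f\,dt\Big\|\le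 C_f\int_{t_0}^{t_1}t\|f'(\cdot,t)\|\,dt,\qquad \Big\|k_nf^{n-1/2}-\int_{t_{n-1}}^{t_n}f\,dt\Big\|\le C_fk_n^2\int_{t_{n-1}}^{t_n}\|f''(\cdot,t)\|\,dt\quad(2\le n\le N).$$ Write $W^{n-1/2}=\frac12(W^n+W^{n-1})$, $\nabla W_j=\frac13(W_{j-1}+W_j+W_{j+1})$, $\Delta_xW_j=\frac{W_{j+1}-W_{j-1}}{2h}$, $\delta_x^2W_j=\frac{W_{j+1}-2W_j+W_{j-1}}{h^2}$, and $I^{(\alpha)}W^{n-1/2}=\frac1{k_n}\int_{t_{n-1}}^{t_n}\mathcal I^{(\alpha)}\overline W(t)\,dt$, where $\overline W=W^1$ on $(t_0,t_1)$ and $\overline W=W^{m-1/2}$ on $(t_{m-1},t_m)$ for $m\ge2$. Let $(U_j^n)$ be any solution of the scheme $$\frac{U_j^1-U_j^0}{k_1}+\nabla U_j^1\,\Delta_xU_j^1=I^{(\alpha)}\delta_x^2U_j^{1/2}+f_j^{1/2},$$ $$\frac{U_j^n-U_j^{n-1}}{k_n}+\nabla U_j^{n-1/2}\,\Delta_xU_j^{n-1/2}=I^{(\alpha)}\delta_x^2U_j^{n-1/2}+f_j^{n-1/2}\quad(2\le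 n\le N)$$ for $1\le j\le J-1$, with $U_j^0=u_0(x_j)$ for $1\le j\le J-1$ and $U_0^n=U_J^n=0$ for $1\le n\le N$. Then $$\max_{1\le n\le N}\|U^n-u(\cdot,t_n)\|\le C\,(h^2+\mathcal K_L),\qquad \mathcal K_L=\begin{cases}k^{\gamma\sigma},&1\le\gamma<2/\sigma,\\ k^2\log(t_N/t_1),&\gamma=2/\sigma,\\ k^2,&\gamma>2/\sigma.\end{cases}$$ -/

import Mathlib

open Set

noncomputable section

/-- The Riemann–Liouville fractional integral `∫₀ᵗ β(t - ζ) φ(ζ) dζ` with the Abel kernel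
`β(t) = t^(α-1) / Γ(α)`. -/
def fracInt (α : ℝ) (φ : ℝ → ℝ) (t : ℝ) : ℝ :=
  ∫ ζ in (0 : ℝ)..t, (t - ζ) ^ (α - 1) / Real.Gamma α * φ ζ

/-- The `i`-th partial derivative in `x` on `[0, L]` (one-sided at the end points). -/
def dxPart (L : ℝ) (i : ℕ) (u : ℝ → ℝ → ℝ) (x t : ℝ) : ℝ :=
  iteratedDerivWithin i (fun y => u y t) (Icc 0 L) x

/-- The partial derivative in `t` on `(0, T]` (one-sided at `T`). -/
def dtPart (T : ℝ) (v : ℝ → ℝ → ℝ) (x t : ℝ) : ℝ :=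
  derivWithin (fun s => v x s) (Ioc 0 T) t

/-- `u` solves `u_t + u u_x - I^(α) u_xx = f` on `(0, L) × (0, T]`, with homogeneous Dirichlet
boundary values and initial value `u₀`. -/
structure IsExactSolution (α L T : ℝ) (f : ℝ → ℝ → ℝ) (u₀ : ℝ → ℝ) (u : ℝ → ℝ → ℝ) : Prop where
  continuous_time : ∀ x ∈ Icc 0 L, ContinuousOn (u x) (Icc 0 T)
  differentiable_time : ∀ x ∈ Ioo 0 L, DifferentiableOn ℝ (u x) (Ioc 0 T)
  equation : ∀ x ∈ Ioo 0 L, ∀ t ∈ Ioc 0 T,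
    dtPart T u x t + u x t * dxPart L 1 u x t - fracInt α (fun s => dxPart L 2 u x s) t = f x t
  boundary_left : ∀ t ∈ Ioc 0 T, u 0 t = 0
  boundary_right : ∀ t ∈ Ioc 0 T, u L t = 0
  init_value : ∀ x ∈ Icc 0 L, u x 0 = u₀ x

/-- `u(·, t)` is of class `C⁴` on `[0, L]`, with fourth derivative bounded uniformly in time. -/
def IsC4InSpace (L T : ℝ) (u : ℝ → ℝ → ℝ) : Prop :=
  (∀ t ∈ Ioc 0 T, ContDiffOn ℝ 4 (fun x => u x t) (Icc 0 L)) ∧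
    ∃ B : ℝ, ∀ x ∈ Icc 0 L, ∀ t ∈ Ioc 0 T, |dxPart L 4 u x t| ≤ B

/-- The spatial node `x_j = j h`, with `h = L / J`. -/
def node (L : ℝ) (J j : ℕ) : ℝ := j * (L / J)

/-- The discrete `L²` norm `(h ∑_{s=1}^{J-1} w_s²)^{1/2}`, `h = L / J`, of a grid function. -/
def gridNorm (L : ℝ) (J : ℕ) (w : ℕ → ℝ) : ℝ :=
  √(L / J * ∑ s ∈ Finset.Ico 1 J, w s ^ 2)

/-- The discrete norm of (the restriction to the grid of) the function `v(·, t)`. -/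
def sliceNorm (L : ℝ) (J : ℕ) (v : ℝ → ℝ → ℝ) (t : ℝ) : ℝ :=
  gridNorm L J (fun j => v (node L J j) t)

/-- `v` is twice differentiable in `t > 0`, and `t ‖v'‖ + t² ‖v''‖ ≤ M t^(σ-1)` on every spatial
grid, with `M` independent of the grid. -/
structure HasTimeRegularity (L T σ M : ℝ) (v : ℝ → ℝ → ℝ) : Prop where
  differentiable : ∀ x ∈ Ioo 0 L, DifferentiableOn ℝ (v x) (Ioc 0 T)
  differentiable_deriv : ∀ x ∈ Ioo 0 L, DifferentiableOn ℝ (dtPart T v x) (Ioc 0 T)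
  bound : ∀ J : ℕ, 1 ≤ J → ∀ t ∈ Ioc 0 T,
    t * sliceNorm L J (dtPart T v) t + t ^ 2 * sliceNorm L J (dtPart T (dtPart T v)) t
      ≤ M * t ^ (σ - 1)

/-- The time step `k_n = t_n - t_{n-1}` (for `n ≥ 1`). -/
def tstep (t : ℕ → ℝ) (n : ℕ) : ℝ := t n - t (n - 1)

/-- The assumptions on the temporal mesh `0 = t_0 < t_1 < ⋯ < t_N ≤ T`. The last bound is implied by
the one with `min 1 (t n ^ (1 - 2 / γ))` in place of `t n ^ (1 - 2 / γ)`. It is equivalent to that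
one, up to the constant, when `γ ≥ 2`, and it holds for `t_n = (n k)^γ` when `1 < γ < 2` too. -/
structure IsGradedMesh (T γ Cγ cγ k : ℝ) (N : ℕ) (t : ℕ → ℝ) : Prop where
  zero : t 0 = 0
  lt : ∀ n, 1 ≤ n → n ≤ N → t (n - 1) < t n
  le_end : t N ≤ T
  step_le : ∀ n, 1 ≤ n → n ≤ N → tstep t n ≤ Cγ * k * min 1 (t n ^ (1 - 1 / γ))
  first_ge : cγ * k ^ γ ≤ t 1
  ratio_le : ∀ n, 2 ≤ n → n ≤ N → t n ≤ Cγ * t (n - 1)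
  step_mono : ∀ n, 2 ≤ n → n + 1 ≤ N → 0 ≤ tstep t (n + 1) - tstep t n
  step_diff_le : ∀ n, 2 ≤ n → n + 1 ≤ N →
    tstep t (n + 1) - tstep t n ≤ Cγ * k ^ 2 * t n ^ (1 - 2 / γ)

/-- `W^{n-1/2} = (W^n + W^{n-1}) / 2` (for `n ≥ 1`). -/
def half (W : ℕ → ℝ) (n : ℕ) : ℝ := (W n + W (n - 1)) / 2

/-- The piecewise constant approximation on `(t_0, t_n)`: it equals `W^1` on `(t_0, t_1)` and
`W^{m-1/2}` on `(t_{m-1}, t_m)` for `2 ≤ m ≤ n`. -/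
def pieceConst (t : ℕ → ℝ) (n : ℕ) (W : ℕ → ℝ) (ζ : ℝ) : ℝ :=
  ∑ m ∈ Finset.Icc 1 n,
    (Ioo (t (m - 1)) (t m)).indicator (fun _ => if m = 1 then W 1 else half W m) ζ

/-- The product-integration rule: the mean over `(t_{n-1}, t_n)` of the fractional integral of the
piecewise constant approximation. -/
def discFracInt (α : ℝ) (t : ℕ → ℝ) (W : ℕ → ℝ) (n : ℕ) : ℝ :=
  1 / tstep t n * ∫ s in (t (n - 1))..(t n), fracInt α (pieceConst t n W) s

/-- Centred difference `(W_{j+1} - W_{j-1}) / (2h)` (for `j ≥ 1`). -/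
def centDiff (h : ℝ) (W : ℕ → ℝ) (j : ℕ) : ℝ := (W (j + 1) - W (j - 1)) / (2 * h)

/-- Second difference `(W_{j+1} - 2 W_j + W_{j-1}) / h²` (for `j ≥ 1`). -/
def secDiff (h : ℝ) (W : ℕ → ℝ) (j : ℕ) : ℝ := (W (j + 1) - 2 * W j + W (j - 1)) / h ^ 2

/-- Three-point mean `(W_{j-1} + W_j + W_{j+1}) / 3` (for `j ≥ 1`). -/
def mean3 (W : ℕ → ℝ) (j : ℕ) : ℝ := (W (j - 1) + W j + W (j + 1)) / 3

/-- `U n j` solves the fully discrete scheme with source values `g n j`, standing for the value of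
`f^{n-1/2}` at `x_j`. -/
structure IsDiscreteSolution (α L : ℝ) (J N : ℕ) (t : ℕ → ℝ) (u₀ : ℝ → ℝ) (g U : ℕ → ℕ → ℝ) :
    Prop where
  first_step : ∀ j, 1 ≤ j → j < J →
    (U 1 j - U 0 j) / tstep t 1 + mean3 (U 1) j * centDiff (L / J) (U 1) j
      = discFracInt α t (fun m => secDiff (L / J) (U m) j) 1 + g 1 j
  next_steps : ∀ n, 2 ≤ n → n ≤ N → ∀ j, 1 ≤ j → j < J →
    (U n j - U (n - 1) j) / tstep t n
        + mean3 (fun i => half (fun m => U m i) n) j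
          * centDiff (L / J) (fun i => half (fun m => U m i) n) j
      = discFracInt α t (fun m => secDiff (L / J) (U m) j) n + g n j
  init_value : ∀ j, 1 ≤ j → j < J → U 0 j = u₀ (node L J j)
  boundary_left : ∀ n, 1 ≤ n → n ≤ N → U n 0 = 0
  boundary_right : ∀ n, 1 ≤ n → n ≤ N → U n J = 0

/-- The source values `g n j` (for `f^{n-1/2}` at `x_j`) approximate the mean of `f` over
`(t_{n-1}, t_n)` with the required accuracy, the norms being the discrete ones. -/
structure IsSourceApprox (L T Cf : ℝ) (f : ℝ → ℝ → ℝ) (J N : ℕ) (t : ℕ → ℝ) (g : ℕ → ℕ → ℝ) :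
    Prop where
  first_step :
    gridNorm L J (fun j => g 1 j * tstep t 1 - ∫ s in (t 0)..(t 1), f (node L J j) s)
      ≤ Cf * ∫ s in (t 0)..(t 1), s * sliceNorm L J (dtPart T f) s
  next_steps : ∀ n, 2 ≤ n → n ≤ N →
    gridNorm L J (fun j => g n j * tstep t n - ∫ s in (t (n - 1))..(t n), f (node L J j) s)
      ≤ Cf * tstep t n ^ 2 *
        ∫ s in (t (n - 1))..(t n), sliceNorm L J (dtPart T (dtPart T f)) s

/-- The temporal error bound `K_L`. -/
def errK (σ γ k t₁ tN : ℝ) : ℝ :=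
  if γ < 2 / σ then k ^ (γ * σ)
  else if γ = 2 / σ then k ^ 2 * Real.log (tN / t₁)
  else k ^ 2

end

/-! The proof is consistency plus stability. The grid values of `u` satisfy the scheme up to
residuals whose norms sum to O(h² + K_L) (`exists_sum_schemeRes_le`), and the error of the scheme is
bounded by that sum (`IsErrorEq.gridNorm_le`).

Stability. The error equation is tested with the cell value of the error. The three-point mean makes
the discrete convection term conservative: its pairing with itself telescopes to zero, and comparing
with `u` costs only (c₀/2)‖e‖² (`abs_gip_conv_sub_le`). The memory term is dissipative
(`sum_cellDiff_tpow_nonneg`): the twice integrated Abel kernel is a positive superposition of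
exponential remainders, and for one exponential the quadratic form dominates the energy of a scalar
recursion. A discrete Gronwall argument then uses c₀ k_n ≤ 1 for n ≥ 2. The first step need not be
shorter than the later ones, so c₀ t₁ > 1 can occur; then a bound of order one for the first error
suffices, because 1 ≤ (c₀ t₁)^σ and t₁^σ = O(K_L).

Consistency in time. The hypotheses control only discrete norms of the time derivatives of v = u_xx.
Pairing with a unit grid function turns vector estimates into scalar mean value arguments with
constants independent of J (`gridNorm_le_of_dual`, `HasTimeRegularity.pairing`). On a cell, the mean
of the two end values minus v is an interpolation error of second order plus a slope times a
sawtooth. The interpolation errors are summed with the column sums of the weights. The sawtooths are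
only of first order in size, so their cancellation has to be used: their accumulated weights are
trapezoidal errors `trapErr` of the kernel, and one sums by parts along the diagonals n - m = const.
On a uniform mesh the weights are constant along diagonals; here their variation is controlled by
the slow growth of the steps (`sum_abs_trapErr_sub_le`). This yields second order
(`sum_gridNorm_saw_le`, `exists_sum_ruleErr_le`).

In the convection term, u is compared at different times through u_xx by a discrete Poincaré
inequality. The part linear in the deviation from the cell mean integrates to a trapezoidal error.
The quadratic part would be too singular with the bound t^(σ-2) on the derivative; a Landau
inequality, using that u_xx is bounded, replaces it by t^((σ-3)/2), whose square is t^(σ-3)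
(`exists_landau_bound`, `exists_gridNorm_convRes_le`).

All temporal errors reduce to t₁^σ, k² t₂^(σ-2/γ) and k² Σ k_m t_m^(σ-2/γ-1), the last being a
Riemann sum; the sign of σ - 2/γ gives the three cases of K_L (`exists_sum_step_le_errK`).

Consistency in space is Taylor expansion; the bounds on the second and third derivatives follow from
those on the first and fourth (`C4Chain.bounds`). -/

/-! ### The discrete inner product -/

/-- The discrete `L²` inner product. -/
noncomputable def gip (L : ℝ) (J : ℕ) (a b : ℕ → ℝ) : ℝ :=
  L / J * ∑ s ∈ Finset.Ico 1 J, a s * b s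

lemma gridNorm_nonneg (L : ℝ) (J : ℕ) (w : ℕ → ℝ) : 0 ≤ gridNorm L J w := Real.sqrt_nonneg _

lemma gridNorm_congr {L : ℝ} {J : ℕ} {a b : ℕ → ℝ} (h : ∀ j, 1 ≤ j → j < J → a j = b j) :
    gridNorm L J a = gridNorm L J b := by
  unfold gridNorm
  congr 2
  refine Finset.sum_congr rfl fun s hs => ?_
  rw [Finset.mem_Ico] at hs
  rw [h s hs.1 hs.2]

lemma gip_congr {L : ℝ} {J : ℕ} {a b c d : ℕ → ℝ} (h : ∀ j, 1 ≤ j → j < J → a j = b j)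
    (h' : ∀ j, 1 ≤ j → j < J → c j = d j) : gip L J a c = gip L J b d := by
  unfold gip
  congr 1
  refine Finset.sum_congr rfl fun s hs => ?_
  rw [Finset.mem_Ico] at hs
  rw [h s hs.1 hs.2, h' s hs.1 hs.2]

lemma gip_self {L : ℝ} (hL : 0 < L) (J : ℕ) (w : ℕ → ℝ) : gip L J w w = gridNorm L J w ^ 2 := by
  unfold gip gridNorm
  rw [Real.sq_sqrt (by positivity)]
  simp [sq]

lemma gip_comm (L : ℝ) (J : ℕ) (a b : ℕ → ℝ) : gip L J a b = gip L J b a := by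
  simp [gip, mul_comm]

lemma gip_add_left (L : ℝ) (J : ℕ) (a b c : ℕ → ℝ) :
    gip L J (a + b) c = gip L J a c + gip L J b c := by
  simp only [gip, Pi.add_apply, add_mul, Finset.sum_add_distrib, mul_add]

lemma gip_add_right (L : ℝ) (J : ℕ) (a b c : ℕ → ℝ) :
    gip L J a (b + c) = gip L J a b + gip L J a c := by
  rw [gip_comm, gip_add_left, gip_comm L J b, gip_comm L J c]

lemma gip_smul_left (L : ℝ) (J : ℕ) (r : ℝ) (a c : ℕ → ℝ) :
    gip L J (r • a) c = r * gip L J a c := by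
  simp only [gip, Pi.smul_apply, smul_eq_mul, mul_assoc, ← Finset.mul_sum]
  ring

lemma gip_smul_right (L : ℝ) (J : ℕ) (r : ℝ) (a c : ℕ → ℝ) :
    gip L J a (r • c) = r * gip L J a c := by
  rw [gip_comm, gip_smul_left, gip_comm]

lemma gip_sub_left (L : ℝ) (J : ℕ) (a b c : ℕ → ℝ) :
    gip L J (a - b) c = gip L J a c - gip L J b c := by
  simp only [gip, Pi.sub_apply, sub_mul, Finset.sum_sub_distrib, mul_sub]

lemma gip_sub_right (L : ℝ) (J : ℕ) (a b c : ℕ → ℝ) :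
    gip L J a (b - c) = gip L J a b - gip L J a c := by
  rw [gip_comm, gip_sub_left, gip_comm L J b, gip_comm L J c]

lemma gip_sum_right {ι : Type*} (L : ℝ) (J : ℕ) (a : ℕ → ℝ) (s : Finset ι) (w : ι → ℕ → ℝ) :
    gip L J a (∑ i ∈ s, w i) = ∑ i ∈ s, gip L J a (w i) := by
  classical
  induction s using Finset.induction_on with
  | empty => simp [gip]
  | insert i s hi ih => rw [Finset.sum_insert hi, Finset.sum_insert hi, gip_add_right, ih]

lemma abs_gip_le {L : ℝ} (hL : 0 < L) (J : ℕ) (a b : ℕ → ℝ) :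
    |gip L J a b| ≤ gridNorm L J a * gridNorm L J b := by
  refine abs_le_of_sq_le_sq ?_ (mul_nonneg (gridNorm_nonneg _ _ _) (gridNorm_nonneg _ _ _))
  rw [mul_pow, ← gip_self hL, ← gip_self hL]
  unfold gip
  have := Finset.sum_mul_sq_le_sq_mul_sq (Finset.Ico 1 J) a b
  have h2 : (0 : ℝ) ≤ (L / J) ^ 2 := by positivity
  calc _ = (L / J) ^ 2 * (∑ s ∈ Finset.Ico 1 J, a s * b s) ^ 2 := by ring
    _ ≤ (L / J) ^ 2 * _ := mul_le_mul_of_nonneg_left this h2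
    _ = _ := by simp only [sq]; ring

lemma gip_le {L : ℝ} (hL : 0 < L) (J : ℕ) (a b : ℕ → ℝ) :
    gip L J a b ≤ gridNorm L J a * gridNorm L J b :=
  (le_abs_self _).trans (abs_gip_le hL J a b)

lemma gridNorm_smul (L : ℝ) (J : ℕ) (r : ℝ) (w : ℕ → ℝ) :
    gridNorm L J (r • w) = |r| * gridNorm L J w := by
  unfold gridNorm
  rw [← Real.sqrt_sq_eq_abs, ← Real.sqrt_mul (sq_nonneg r)]
  congr 1
  simp only [Pi.smul_apply, smul_eq_mul, mul_pow, ← Finset.mul_sum]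
  ring

lemma gridNorm_neg (L : ℝ) (J : ℕ) (w : ℕ → ℝ) : gridNorm L J (-w) = gridNorm L J w := by
  simp [gridNorm]

lemma gridNorm_zero (L : ℝ) (J : ℕ) : gridNorm L J 0 = 0 := by
  simp [gridNorm]

lemma gridNorm_add_le {L : ℝ} (hL : 0 < L) (J : ℕ) (a b : ℕ → ℝ) :
    gridNorm L J (a + b) ≤ gridNorm L J a + gridNorm L J b := by
  refine le_of_sq_le_sq ?_ (add_nonneg (gridNorm_nonneg _ _ _) (gridNorm_nonneg _ _ _))
  have h := gip_le hL J a b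
  rw [← gip_self hL, gip_add_left, gip_add_right, gip_add_right, gip_self hL, gip_self hL,
    gip_comm L J b a]
  nlinarith

lemma gridNorm_sub_le {L : ℝ} (hL : 0 < L) (J : ℕ) (a b : ℕ → ℝ) :
    gridNorm L J (a - b) ≤ gridNorm L J a + gridNorm L J b := by
  rw [sub_eq_add_neg, ← gridNorm_neg L J b]
  exact gridNorm_add_le hL J a (-b)

lemma gridNorm_sum_le {ι : Type*} {L : ℝ} (hL : 0 < L) (J : ℕ) (s : Finset ι) (w : ι → ℕ → ℝ) :
    gridNorm L J (∑ i ∈ s, w i) ≤ ∑ i ∈ s, gridNorm L J (w i) := by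
  classical
  induction s using Finset.induction_on with
  | empty => simp [gridNorm]
  | insert i s hi ih =>
    rw [Finset.sum_insert hi, Finset.sum_insert hi]
    exact (gridNorm_add_le hL J _ _).trans (by linarith)

lemma gridNorm_le_of_abs_le {L : ℝ} (hL : 0 < L) {J : ℕ} {w : ℕ → ℝ} {K : ℝ} (hK : 0 ≤ K)
    (h : ∀ j, 1 ≤ j → j < J → |w j| ≤ K) : gridNorm L J w ≤ K * √L := by
  unfold gridNorm
  rw [← Real.sqrt_sq hK, ← Real.sqrt_mul (sq_nonneg K)]
  apply Real.sqrt_le_sqrt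
  have h1 : ∑ s ∈ Finset.Ico 1 J, w s ^ 2 ≤ ∑ s ∈ Finset.Ico 1 J, K ^ 2 := by
    refine Finset.sum_le_sum fun s hs => ?_
    rw [Finset.mem_Ico] at hs
    exact sq_le_sq' (by linarith [neg_le_of_abs_le (h s hs.1 hs.2)])
      (le_of_abs_le (h s hs.1 hs.2))
  rw [Finset.sum_const, Nat.card_Ico, nsmul_eq_mul] at h1
  rcases Nat.eq_zero_or_pos J with rfl | hJ
  · simp; positivity
  have hJ' : (0 : ℝ) < J := by exact_mod_cast hJ
  have h2 : ((J - 1 : ℕ) : ℝ) ≤ J := by exact_mod_cast Nat.sub_le J 1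
  calc L / J * ∑ s ∈ Finset.Ico 1 J, w s ^ 2 ≤ L / J * (J * K ^ 2) := by
        refine mul_le_mul_of_nonneg_left (h1.trans ?_) (by positivity)
        exact mul_le_mul_of_nonneg_right h2 (sq_nonneg K)
    _ = K ^ 2 * L := by field_simp

/-- Reduces estimates of grid vectors to scalar ones. The mean value theorem applies to each
pairing, with an intermediate point that may depend on ψ. -/
lemma gridNorm_le_of_dual {L : ℝ} (hL : 0 < L) {J : ℕ} {w : ℕ → ℝ} {K : ℝ} (hK : 0 ≤ K)
    (h : ∀ ψ, gridNorm L J ψ = 1 → gip L J ψ w ≤ K) : gridNorm L J w ≤ K := by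
  rcases (gridNorm_nonneg L J w).eq_or_lt with h0 | h0
  · rw [← h0]; exact hK
  have := h ((gridNorm L J w)⁻¹ • w) (by
    rw [gridNorm_smul, abs_of_pos (inv_pos.2 h0), inv_mul_cancel₀ h0.ne'])
  rw [gip_smul_left, gip_self hL] at this
  calc gridNorm L J w = (gridNorm L J w)⁻¹ * gridNorm L J w ^ 2 := by field_simp
    _ ≤ K := this

/-! ### Discrete summation by parts and the convection term -/

lemma sum_Ico_shift (J : ℕ) (hJ : 1 ≤ J) (F : ℕ → ℝ) :
    ∑ j ∈ Finset.Ico 1 J, F (j - 1) = F 0 - F (J - 1) + ∑ j ∈ Finset.Ico 1 J, F j := by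
  induction J, hJ using Nat.le_induction with
  | base => simp
  | succ J hJ ih =>
    rw [Finset.sum_Ico_succ_top hJ, Finset.sum_Ico_succ_top hJ, ih]
    simp only [Nat.add_sub_cancel]
    ring

/-- Pairing of the second difference with a grid function that vanishes on the boundary. -/
lemma gip_secDiff {L : ℝ} {J : ℕ} (hJ : 1 ≤ J) (a b : ℕ → ℝ)
    (hb0 : b 0 = 0) (hbJ : b J = 0) :
    gip L J (secDiff (L / J) a) b
      = -(L / J * ∑ j ∈ Finset.range J, ((a (j + 1) - a j) / (L / J)) *
          ((b (j + 1) - b j) / (L / J))) := by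
  unfold gip
  rw [← mul_neg]
  congr 1
  set h := L / J
  let F : ℕ → ℝ := fun j => (a (j + 1) - a j) / h ^ 2 * b (j + 1)
  have h1 := sum_Ico_shift J hJ F
  have h2 : ∀ j ∈ Finset.Ico 1 J, F (j - 1) = (a j - a (j - 1)) / h ^ 2 * b j := by
    intro j hj
    rw [Finset.mem_Ico] at hj
    simp only [F]
    rw [Nat.sub_add_cancel hj.1]
  rw [Finset.sum_congr rfl h2] at h1
  have h3 : F (J - 1) = 0 := by simp only [F]; rw [Nat.sub_add_cancel hJ, hbJ, mul_zero]
  have h4 : ∑ j ∈ Finset.range J, ((a (j + 1) - a j) / h) * ((b (j + 1) - b j) / h)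
      = F 0 + ∑ j ∈ Finset.Ico 1 J, (a (j + 1) - a j) / h ^ 2 * (b (j + 1) - b j) := by
    rw [Finset.range_eq_Ico, Finset.sum_eq_sum_Ico_succ_bot hJ]
    simp only [F, hb0]
    congr 1
    · ring
    · refine Finset.sum_congr rfl fun j _ => by ring
  rw [h4]
  rw [h3, sub_zero] at h1
  have h5 : ∑ j ∈ Finset.Ico 1 J, secDiff h a j * b j
      = ∑ j ∈ Finset.Ico 1 J, (a (j + 1) - a j) / h ^ 2 * b j
        - ∑ j ∈ Finset.Ico 1 J, (a j - a (j - 1)) / h ^ 2 * b j := by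
    rw [← Finset.sum_sub_distrib]
    refine Finset.sum_congr rfl fun j _ => ?_
    unfold secDiff; ring
  rw [h5, h1]
  have h6 : ∑ j ∈ Finset.Ico 1 J, (a (j + 1) - a j) / h ^ 2 * (b (j + 1) - b j)
      = ∑ j ∈ Finset.Ico 1 J, F j - ∑ j ∈ Finset.Ico 1 J, (a (j + 1) - a j) / h ^ 2 * b j := by
    rw [← Finset.sum_sub_distrib]
    refine Finset.sum_congr rfl fun j _ => ?_
    simp only [F]; ring
  rw [h6]; ring

/-- The discrete convection term. -/
noncomputable def conv (h : ℝ) (a b : ℕ → ℝ) (j : ℕ) : ℝ := mean3 a j * centDiff h b j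

/-- The telescoping identity behind the skew-symmetry of the discrete convection term. -/
lemma sum_conv_pair {h : ℝ} (hh : h ≠ 0) {J : ℕ} (hJ : 1 ≤ J) (u e : ℕ → ℝ)
    (he0 : e 0 = 0) (heJ : e J = 0) :
    ∑ j ∈ Finset.Ico 1 J, (conv h u e j + conv h e u j) * e j
      = ∑ j ∈ Finset.Ico 1 J, (centDiff h u j / 3 * e j ^ 2
          + (u (j + 1) - u j) / h / 6 * (e j * e (j + 1))) := by
  -- The flux of the telescoping part. It contains e_j e_(j+1), hence vanishes for j = 0 and j = J -
  -- 1.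
  let F : ℕ → ℝ := fun j =>
    (mean3 u (j + 1) / (2 * h) - centDiff h u (j + 1) / 3) * (e j * e (j + 1))
  have h1 := sum_Ico_shift J hJ F
  have h0 : F 0 = 0 := by simp [F, he0]
  have h3 : F (J - 1) = 0 := by simp only [F]; rw [Nat.sub_add_cancel hJ, heJ]; ring
  rw [h0, h3, sub_zero, zero_add] at h1
  have h2 : ∀ j ∈ Finset.Ico 1 J, (conv h u e j + conv h e u j) * e j
      = (centDiff h u j / 3 * e j ^ 2 + (u (j + 1) - u j) / h / 6 * (e j * e (j + 1)))
        + (F j - F (j - 1)) := by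
    intro j hj
    rw [Finset.mem_Ico] at hj
    obtain ⟨i, rfl⟩ : ∃ i, j = i + 1 := ⟨j - 1, by omega⟩
    simp only [F, conv, mean3, centDiff, Nat.add_sub_cancel]
    field_simp
    ring
  rw [Finset.sum_congr rfl h2, Finset.sum_add_distrib, Finset.sum_sub_distrib, h1, sub_self,
    add_zero]

/-- The three-point mean is exactly the one for which the summand is a difference of fluxes e_j
e_(j+1) (e_j + e_(j+1)) / (6h). -/
lemma sum_conv_self {h : ℝ} (hh : h ≠ 0) {J : ℕ} (hJ : 1 ≤ J) (e : ℕ → ℝ)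
    (he0 : e 0 = 0) (heJ : e J = 0) :
    ∑ j ∈ Finset.Ico 1 J, conv h e e j * e j = 0 := by
  let F : ℕ → ℝ := fun j => (e j * e (j + 1)) * (e j + e (j + 1)) / (6 * h)
  have h1 := sum_Ico_shift J hJ F
  have h0 : F 0 = 0 := by simp [F, he0]
  have h3 : F (J - 1) = 0 := by simp only [F]; rw [Nat.sub_add_cancel hJ, heJ]; ring
  rw [h0, h3, sub_zero, zero_add] at h1
  have h2 : ∀ j ∈ Finset.Ico 1 J, conv h e e j * e j = F j - F (j - 1) := by
    intro j hj
    rw [Finset.mem_Ico] at hj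
    obtain ⟨i, rfl⟩ : ∃ i, j = i + 1 := ⟨j - 1, by omega⟩
    simp only [F, conv, mean3, centDiff, Nat.add_sub_cancel]
    field_simp
    ring
  rw [Finset.sum_congr rfl h2, Finset.sum_sub_distrib, h1, sub_self]

lemma gip_conv_self {L : ℝ} (hL : 0 < L) {J : ℕ} (hJ : 1 ≤ J) (e : ℕ → ℝ)
    (he0 : e 0 = 0) (heJ : e J = 0) : gip L J (conv (L / J) e e) e = 0 := by
  have hJ' : (0 : ℝ) < J := by exact_mod_cast hJ
  unfold gip
  rw [sum_conv_self (by positivity) hJ e he0 heJ, mul_zero]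

/-- The difference of the convection terms at `u + e` and `u`, tested with `e`. -/
lemma abs_gip_conv_sub_le {L c : ℝ} (hL : 0 < L) (hc : 0 ≤ c) {J : ℕ} (hJ : 1 ≤ J)
    (u e : ℕ → ℝ) (he0 : e 0 = 0) (heJ : e J = 0)
    (hu : ∀ j, j < J → |(u (j + 1) - u j) / (L / J)| ≤ c) :
    |gip L J (conv (L / J) (u + e) (u + e) - conv (L / J) u u) e|
      ≤ c / 2 * gridNorm L J e ^ 2 := by
  have hJ' : (0 : ℝ) < J := by exact_mod_cast hJ
  have hh : (L / J : ℝ) ≠ 0 := by positivity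
  set h : ℝ := L / J with hdef
  -- The part quadratic in e pairs to zero, so no bound on e itself is needed.
  have hexp : conv h (u + e) (u + e) - conv h u u
      = (conv h u e + conv h e u) + conv h e e := by
    funext j
    simp only [conv, mean3, centDiff, Pi.add_apply, Pi.sub_apply]
    ring
  rw [hexp, gip_add_left, hdef, gip_conv_self hL hJ e he0 heJ, add_zero, ← hdef]
  have h1 : gip L J (conv h u e + conv h e u) e
      = h * ∑ j ∈ Finset.Ico 1 J, (centDiff h u j / 3 * e j ^ 2
          + (u (j + 1) - u j) / h / 6 * (e j * e (j + 1))) := by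
    unfold gip
    rw [← sum_conv_pair hh hJ u e he0 heJ]
    rfl
  rw [h1, abs_mul, abs_of_pos (by positivity : 0 < h), ← gip_self hL]
  unfold gip
  rw [← hdef, mul_left_comm]
  refine mul_le_mul_of_nonneg_left ?_ (by positivity)
  -- After summation the weights add up to c/3 + 2 · c/12 = c/2.
  have h2 : ∀ j ∈ Finset.Ico 1 J, |centDiff h u j / 3 * e j ^ 2
          + (u (j + 1) - u j) / h / 6 * (e j * e (j + 1))|
        ≤ c / 3 * e j ^ 2 + c / 12 * (e j ^ 2 + e (j + 1) ^ 2) := by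
    intro j hj
    rw [Finset.mem_Ico] at hj
    have ha := hu j hj.2
    have hb := hu (j - 1) (by omega)
    rw [Nat.sub_add_cancel hj.1] at hb
    have hcd : |centDiff h u j| ≤ c := by
      have : centDiff h u j = ((u (j + 1) - u j) / h + (u j - u (j - 1)) / h) / 2 := by
        unfold centDiff; field_simp; ring
      rw [this, abs_div, abs_of_pos (by norm_num : (0:ℝ) < 2)]
      have := abs_add_le ((u (j + 1) - u j) / h) ((u j - u (j - 1)) / h)
      linarith
    have hp : |e j * e (j + 1)| ≤ (e j ^ 2 + e (j + 1) ^ 2) / 2 := by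
      rw [abs_le]
      constructor <;> nlinarith [sq_nonneg (e j + e (j + 1)), sq_nonneg (e j - e (j + 1))]
    refine (abs_add_le _ _).trans (add_le_add ?_ ?_)
    · rw [abs_mul, abs_div, abs_of_pos (by norm_num : (0:ℝ) < 3), abs_of_nonneg (sq_nonneg (e j))]
      gcongr
    · rw [abs_mul, abs_div, abs_of_pos (by norm_num : (0:ℝ) < 6)]
      calc |(u (j + 1) - u j) / h| / 6 * |e j * e (j + 1)|
          ≤ c / 6 * ((e j ^ 2 + e (j + 1) ^ 2) / 2) := by gcongr
        _ = _ := by ring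
  refine (Finset.abs_sum_le_sum_abs _ _).trans ((Finset.sum_le_sum h2).trans ?_)
  rw [Finset.sum_add_distrib, ← Finset.mul_sum, ← Finset.mul_sum, Finset.sum_add_distrib]
  have h3 : ∑ j ∈ Finset.Ico 1 J, e (j + 1) ^ 2 ≤ ∑ j ∈ Finset.Ico 1 J, e j ^ 2 := by
    have h4 := sum_Ico_shift J hJ (fun j => e (j + 1) ^ 2)
    simp only [Nat.sub_add_cancel hJ, heJ] at h4
    have h5 : ∑ j ∈ Finset.Ico 1 J, e (j - 1 + 1) ^ 2 = ∑ j ∈ Finset.Ico 1 J, e j ^ 2 := by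
      refine Finset.sum_congr rfl fun j hj => ?_
      rw [Finset.mem_Ico] at hj
      rw [Nat.sub_add_cancel hj.1]
    rw [h5] at h4
    nlinarith [sq_nonneg (e (0 + 1))]
  have h6 : ∑ j ∈ Finset.Ico 1 J, e j * e j = ∑ j ∈ Finset.Ico 1 J, e j ^ 2 := by simp [sq]
  rw [h6]
  nlinarith

/-- The discrete Poincaré inequality, for the difference quotients. -/
lemma abs_diff_le_secDiff {L : ℝ} (hL : 0 < L) {J : ℕ} (hJ : 1 ≤ J) (w : ℕ → ℝ)
    (h0 : w 0 = 0) (hwJ : w J = 0) (i : ℕ) (hi : i < J) :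
    |(w (i + 1) - w i) / (L / J)| ≤ √L * gridNorm L J (secDiff (L / J) w) := by
  have hJ' : (0 : ℝ) < J := by exact_mod_cast hJ
  have hh : (0 : ℝ) < L / J := by positivity
  set h : ℝ := L / J with hdef
  set D : ℕ → ℝ := fun j => (w (j + 1) - w j) / h with hD
  set S : ℝ := ∑ s ∈ Finset.Ico 1 J, h * |secDiff h w s| with hS
  have hstep : ∀ a b, a ≤ b → b < J → |D b - D a| ≤ S := by
    intro a b hab hb
    have h1 : D b - D a = ∑ s ∈ Finset.Ico (a + 1) (b + 1), h * secDiff h w s := by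
      clear hb
      induction b, hab using Nat.le_induction with
      | base => simp
      | succ b hab ih =>
        rw [Finset.sum_Ico_succ_top (by omega), ← ih]
        simp only [hD, secDiff, Nat.add_sub_cancel]
        field_simp
        ring
    rw [h1]
    refine (Finset.abs_sum_le_sum_abs _ _).trans ?_
    rw [hS]
    have h2 : Finset.Ico (a + 1) (b + 1) ⊆ Finset.Ico 1 J := by
      intro s hs
      rw [Finset.mem_Ico] at *
      omega
    calc ∑ s ∈ Finset.Ico (a + 1) (b + 1), |h * secDiff h w s|
        = ∑ s ∈ Finset.Ico (a + 1) (b + 1), h * |secDiff h w s| := by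
          refine Finset.sum_congr rfl fun s _ => ?_
          rw [abs_mul, abs_of_pos hh]
      _ ≤ _ := Finset.sum_le_sum_of_subset_of_nonneg h2 fun s _ _ => by positivity
  have hstep' : ∀ a, a < J → |D i - D a| ≤ S := by
    intro a ha
    rcases le_total a i with h | h
    · exact hstep a i h hi
    · rw [abs_sub_comm]; exact hstep i a h ha
  -- Since w vanishes at both ends, its difference quotients have mean zero; thus D_i is the mean of
  -- the D_i - D_a, each bounded by the total variation S.
  have hsum : ∑ a ∈ Finset.range J, D a = 0 := by
    simp only [hD, ← Finset.sum_div]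
    rw [Finset.sum_range_sub, hwJ, h0]; simp
  have hDi : (J : ℝ) * D i = ∑ a ∈ Finset.range J, (D i - D a) := by
    rw [Finset.sum_sub_distrib, hsum]; simp
  have hle : (J : ℝ) * |D i| ≤ J * S := by
    rw [← abs_of_pos hJ', ← abs_mul, abs_of_pos hJ', hDi]
    refine (Finset.abs_sum_le_sum_abs _ _).trans ?_
    refine (Finset.sum_le_sum fun a ha => hstep' a (Finset.mem_range.1 ha)).trans ?_
    simp
  have hS2 : S ≤ √L * gridNorm L J (secDiff h w) := by
    have h1 : S = gip L J (fun _ => 1) (fun s => |secDiff h w s|) := by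
      rw [hS]; unfold gip; rw [Finset.mul_sum]; simp [hdef]
    have h2 : gridNorm L J (fun s => |secDiff h w s|) = gridNorm L J (secDiff h w) := by
      simp [gridNorm]
    have h3 : gridNorm L J (fun _ => (1 : ℝ)) ≤ 1 * √L :=
      gridNorm_le_of_abs_le hL zero_le_one (by simp)
    rw [h1]
    refine (gip_le hL J _ _).trans ?_
    rw [h2]
    exact mul_le_mul_of_nonneg_right (by linarith) (gridNorm_nonneg _ _ _)
  exact (le_of_mul_le_mul_left hle hJ').trans hS2

lemma abs_le_secDiff {L : ℝ} (hL : 0 < L) {J : ℕ} (hJ : 1 ≤ J) (w : ℕ → ℝ)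
    (h0 : w 0 = 0) (hwJ : w J = 0) (i : ℕ) (hi : i ≤ J) :
    |w i| ≤ L * (√L * gridNorm L J (secDiff (L / J) w)) := by
  have hJ' : (0 : ℝ) < J := by exact_mod_cast hJ
  have hh : (0 : ℝ) < L / J := by positivity
  set K := √L * gridNorm L J (secDiff (L / J) w) with hK
  have hK0 : 0 ≤ K := mul_nonneg (Real.sqrt_nonneg _) (gridNorm_nonneg _ _ _)
  have h1 : ∀ i, i ≤ J → |w i| ≤ i * (L / J) * K := by
    intro i
    induction i with
    | zero => intro _; simp [h0]
    | succ i ih =>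
      intro hi
      have h2 := abs_diff_le_secDiff hL hJ w h0 hwJ i (by omega)
      rw [abs_div, abs_of_pos hh, div_le_iff₀ hh] at h2
      have h3 := ih (by omega)
      have h4 := abs_add_le (w (i + 1) - w i) (w i)
      rw [sub_add_cancel] at h4
      push_cast
      nlinarith
  refine (h1 i hi).trans (mul_le_mul_of_nonneg_right ?_ hK0)
  have : (i : ℝ) ≤ J := by exact_mod_cast hi
  calc (i : ℝ) * (L / J) ≤ J * (L / J) := by gcongr
    _ = L := by field_simp

/-! ### Truncated powers and the fractional integral -/

/-- The normalised truncated power `x₊^p / Γ(p + 1)`. -/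
noncomputable def tpow (p x : ℝ) : ℝ := max x 0 ^ p / Real.Gamma (p + 1)

lemma tpow_of_nonpos {p x : ℝ} (hp : 0 < p) (hx : x ≤ 0) : tpow p x = 0 := by
  simp [tpow, max_eq_right hx, Real.zero_rpow hp.ne']

lemma tpow_of_nonneg {p x : ℝ} (hx : 0 ≤ x) : tpow p x = x ^ p / Real.Gamma (p + 1) := by
  rw [tpow, max_eq_left hx]

lemma tpow_nonneg {p : ℝ} (hp : 0 < p) (x : ℝ) : 0 ≤ tpow p x :=
  div_nonneg (Real.rpow_nonneg (le_max_right _ _) _) (Real.Gamma_pos_of_pos (by linarith)).le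

lemma tpow_mono {p : ℝ} (hp : 0 < p) : Monotone (tpow p) := by
  intro x y hxy
  have : 0 < Real.Gamma (p + 1) := Real.Gamma_pos_of_pos (by linarith)
  unfold tpow
  gcongr

lemma continuous_tpow {p : ℝ} (hp : 0 < p) : Continuous (tpow p) := by
  unfold tpow
  exact ((continuous_id.max continuous_const).rpow_const fun x => Or.inr hp.le).div_const _

/-- The two branches are differentiated on closed half lines; at 0 the one-sided derivatives agree
because p > 0. -/
lemma hasDerivAt_tpow {p : ℝ} (hp : 0 < p) (x : ℝ) : HasDerivAt (tpow (p + 1)) (tpow p x) x := by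
  have hG : Real.Gamma (p + 1 + 1) = (p + 1) * Real.Gamma (p + 1) :=
    Real.Gamma_add_one (by linarith)
  have hG0 : 0 < Real.Gamma (p + 1) := Real.Gamma_pos_of_pos (by linarith)
  have hR : 0 ≤ x → HasDerivWithinAt (tpow (p + 1)) (tpow p x) (Ici 0) x := by
    intro hx
    have h1 : HasDerivAt (fun y : ℝ => y ^ (p + 1) / Real.Gamma (p + 1 + 1))
        ((p + 1) * x ^ (p + 1 - 1) / Real.Gamma (p + 1 + 1)) x :=
      (Real.hasDerivAt_rpow_const (Or.inr (by linarith))).div_const _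
    have h2 : (p + 1) * x ^ (p + 1 - 1) / Real.Gamma (p + 1 + 1) = tpow p x := by
      rw [tpow_of_nonneg hx, hG, add_sub_cancel_right]
      field_simp
    rw [h2] at h1
    exact h1.hasDerivWithinAt.congr (fun y hy => tpow_of_nonneg hy) (tpow_of_nonneg hx)
  have hLft : x ≤ 0 → HasDerivWithinAt (tpow (p + 1)) (tpow p x) (Iic 0) x := by
    intro hx
    rw [tpow_of_nonpos hp hx]
    exact (hasDerivWithinAt_const x (Iic 0) (0 : ℝ)).congr
      (fun y hy => tpow_of_nonpos (by linarith) hy) (tpow_of_nonpos (by linarith) hx)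
  rcases lt_trichotomy x 0 with h | h | h
  · exact (hLft h.le).hasDerivAt (Iic_mem_nhds h)
  · have := (hLft h.le).union (hR h.ge)
    rw [Iic_union_Ici, hasDerivWithinAt_univ] at this
    exact this
  · exact (hR h.le).hasDerivAt (Ici_mem_nhds h)

lemma integral_tpow_sub {p : ℝ} (hp : 0 < p) (a b c : ℝ) :
    ∫ s in a..b, tpow p (s - c) = tpow (p + 1) (b - c) - tpow (p + 1) (a - c) := by
  refine intervalIntegral.integral_eq_sub_of_hasDerivAt (f := fun s => tpow (p + 1) (s - c))
    (fun s _ => ?_) ?_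
  · have := (hasDerivAt_tpow hp (s - c)).comp_sub_const s c
    exact this
  · exact ((continuous_tpow hp).comp (continuous_id.sub continuous_const)).intervalIntegrable _ _

/-- Bounded and a.e. strongly measurable on `(0, T]`. -/
def BddMeas (T : ℝ) (φ : ℝ → ℝ) : Prop :=
  (∃ K : ℝ, ∀ t ∈ Ioc 0 T, |φ t| ≤ K) ∧
    MeasureTheory.AEStronglyMeasurable φ (MeasureTheory.volume.restrict (Ioc 0 T))

namespace BddMeas

variable {T : ℝ} {φ ψ : ℝ → ℝ}

lemma add (h : BddMeas T φ) (h' : BddMeas T ψ) : BddMeas T (fun s => φ s + ψ s) := by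
  obtain ⟨⟨K, hK⟩, m⟩ := h
  obtain ⟨⟨K', hK'⟩, m'⟩ := h'
  exact ⟨⟨K + K', fun t ht => (abs_add_le _ _).trans (add_le_add (hK t ht) (hK' t ht))⟩, m.add m'⟩

lemma const_mul (h : BddMeas T φ) (c : ℝ) : BddMeas T (fun s => c * φ s) := by
  obtain ⟨⟨K, hK⟩, m⟩ := h
  refine ⟨⟨|c| * K, fun t ht => ?_⟩, m.const_mul c⟩
  rw [abs_mul]
  exact mul_le_mul_of_nonneg_left (hK t ht) (abs_nonneg c)

lemma mul (h : BddMeas T φ) (h' : BddMeas T ψ) : BddMeas T (fun s => φ s * ψ s) := by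
  obtain ⟨⟨K, hK⟩, m⟩ := h
  obtain ⟨⟨K', hK'⟩, m'⟩ := h'
  refine ⟨⟨K * K', fun t ht => ?_⟩, m.mul m'⟩
  rw [abs_mul]
  exact mul_le_mul (hK t ht) (hK' t ht) (abs_nonneg _) ((abs_nonneg _).trans (hK t ht))

lemma sum {ι : Type*} (s : Finset ι) {w : ι → ℝ → ℝ} (h : ∀ i ∈ s, BddMeas T (w i)) :
    BddMeas T (fun r => ∑ i ∈ s, w i r) := by
  classical
  induction s using Finset.induction_on with
  | empty =>
    simp only [Finset.sum_empty]
    exact ⟨⟨0, by simp⟩, MeasureTheory.aestronglyMeasurable_const⟩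
  | insert i s hi ih =>
    simp only [Finset.sum_insert hi]
    exact (h i (Finset.mem_insert_self i s)).add
      (ih fun j hj => h j (Finset.mem_insert_of_mem hj))

lemma of_continuousOn (h : ContinuousOn φ (Ioc 0 T)) {K : ℝ} (hK : ∀ t ∈ Ioc 0 T, |φ t| ≤ K) :
    BddMeas T φ :=
  ⟨⟨K, hK⟩, h.aestronglyMeasurable measurableSet_Ioc⟩

lemma of_continuous (h : Continuous φ) : BddMeas T φ := by
  obtain ⟨K, hK⟩ := isCompact_Icc.exists_bound_of_continuousOn (s := Icc 0 T) h.continuousOn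
  exact of_continuousOn h.continuousOn (K := K)
    fun t ht => by simpa using hK t (Ioc_subset_Icc_self ht)

lemma indicator (h : BddMeas T φ) {s : Set ℝ} (hs : MeasurableSet s) :
    BddMeas T (s.indicator φ) := by
  obtain ⟨⟨K, hK⟩, m⟩ := h
  refine ⟨⟨K, fun t ht => ?_⟩, m.indicator hs⟩
  by_cases hts : t ∈ s
  · rw [indicator_of_mem hts]; exact hK t ht
  · rw [indicator_of_notMem hts, abs_zero]; exact (abs_nonneg _).trans (hK t ht)

lemma intervalIntegrable (h : BddMeas T φ) {a b : ℝ} (ha : 0 ≤ a) (hab : a ≤ b) (hb : b ≤ T) :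
    IntervalIntegrable φ MeasureTheory.volume a b := by
  obtain ⟨⟨K, hK⟩, m⟩ := h
  rw [intervalIntegrable_iff_integrableOn_Ioc_of_le hab]
  have hsub : Ioc a b ⊆ Ioc 0 T := Ioc_subset_Ioc ha hb
  refine MeasureTheory.Integrable.of_bound
    (m.mono_measure (MeasureTheory.Measure.restrict_mono hsub le_rfl)) K ?_
  refine (MeasureTheory.ae_restrict_iff' measurableSet_Ioc).2 (Filter.Eventually.of_forall ?_)
  intro x hx
  exact hK x (hsub hx)

end BddMeas

/-! ### Linearity and monotonicity of the fractional integral. -/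

lemma intervalIntegrable_kernel {α : ℝ} (hα : 0 < α) (t : ℝ) :
    IntervalIntegrable (fun ζ => (t - ζ) ^ (α - 1) / Real.Gamma α) MeasureTheory.volume 0 t := by
  have h1 : IntervalIntegrable (fun x : ℝ => x ^ (α - 1)) MeasureTheory.volume 0 t :=
    intervalIntegral.intervalIntegrable_rpow' (by linarith)
  have h2 := (h1.comp_sub_left t).symm
  simp only [sub_zero, sub_self] at h2
  exact h2.div_const _

lemma intervalIntegrable_fracInt_integrand {α T : ℝ} (hα : 0 < α) {φ : ℝ → ℝ} (h : BddMeas T φ)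
    {t : ℝ} (ht : t ∈ Icc 0 T) :
    IntervalIntegrable (fun ζ => (t - ζ) ^ (α - 1) / Real.Gamma α * φ ζ)
      MeasureTheory.volume 0 t := by
  obtain ⟨⟨K, hK⟩, m⟩ := h
  have h1 := intervalIntegrable_kernel hα t
  rw [intervalIntegrable_iff_integrableOn_Ioc_of_le ht.1] at h1 ⊢
  have hsub : Ioc 0 t ⊆ Ioc 0 T := Ioc_subset_Ioc_right ht.2
  refine MeasureTheory.Integrable.mul_bdd (c := K) h1
    (m.mono_measure (MeasureTheory.Measure.restrict_mono hsub le_rfl)) ?_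
  refine (MeasureTheory.ae_restrict_iff' measurableSet_Ioc).2 (Filter.Eventually.of_forall ?_)
  intro x hx
  exact hK x (hsub hx)

lemma fracInt_add {α T : ℝ} (hα : 0 < α) {φ ψ : ℝ → ℝ} (h : BddMeas T φ) (h' : BddMeas T ψ)
    {t : ℝ} (ht : t ∈ Icc 0 T) :
    fracInt α (fun s => φ s + ψ s) t = fracInt α φ t + fracInt α ψ t := by
  unfold fracInt
  rw [← intervalIntegral.integral_add (intervalIntegrable_fracInt_integrand hα h ht)
    (intervalIntegrable_fracInt_integrand hα h' ht)]
  simp only [mul_add]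

lemma fracInt_const_mul (α : ℝ) (φ : ℝ → ℝ) (c t : ℝ) :
    fracInt α (fun s => c * φ s) t = c * fracInt α φ t := by
  unfold fracInt
  rw [← intervalIntegral.integral_const_mul]
  congr 1
  funext ζ
  ring

lemma fracInt_sum {α T : ℝ} (hα : 0 < α) {ι : Type*} (s : Finset ι) {w : ι → ℝ → ℝ}
    (h : ∀ i ∈ s, BddMeas T (w i)) {t : ℝ} (ht : t ∈ Icc 0 T) :
    fracInt α (fun r => ∑ i ∈ s, w i r) t = ∑ i ∈ s, fracInt α (w i) t := by
  classical
  induction s using Finset.induction_on with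
  | empty => simp [fracInt]
  | insert i s hi ih =>
    simp only [Finset.sum_insert hi]
    rw [fracInt_add hα (h i (Finset.mem_insert_self i s))
      (BddMeas.sum s fun j hj => h j (Finset.mem_insert_of_mem hj)) ht,
      ih fun j hj => h j (Finset.mem_insert_of_mem hj)]

lemma fracInt_congr {α : ℝ} {φ ψ : ℝ → ℝ} {t : ℝ} (ht : 0 ≤ t)
    (h : ∀ᵐ s, s ∈ Ioc 0 t → φ s = ψ s) : fracInt α φ t = fracInt α ψ t := by
  unfold fracInt
  refine intervalIntegral.integral_congr_ae ?_
  filter_upwards [h] with s hs hst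
  rw [uIoc_of_le ht] at hst
  rw [hs hst]

lemma fracInt_mono {α T : ℝ} (hα : 0 < α) {φ ψ : ℝ → ℝ} (h : BddMeas T φ) (h' : BddMeas T ψ)
    {t : ℝ} (ht : t ∈ Icc 0 T) (hle : ∀ᵐ s, s ∈ Ioc 0 t → φ s ≤ ψ s) :
    fracInt α φ t ≤ fracInt α ψ t := by
  unfold fracInt
  refine intervalIntegral.integral_mono_ae_restrict ht.1
    (intervalIntegrable_fracInt_integrand hα h ht)
    (intervalIntegrable_fracInt_integrand hα h' ht) ?_
  rw [← MeasureTheory.restrict_Ioc_eq_restrict_Icc]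
  refine (MeasureTheory.ae_restrict_iff' measurableSet_Ioc).2 ?_
  filter_upwards [hle] with s hs hst
  have hG : 0 < Real.Gamma α := Real.Gamma_pos_of_pos hα
  exact mul_le_mul_of_nonneg_left (hs hst)
    (div_nonneg (Real.rpow_nonneg (by linarith [hst.2]) _) hG.le)

/-! ### Fractional integrals of steps, ramps, boxes and sawtooths. -/

lemma fracInt_indicator_Ioi {α a t : ℝ} (ha : 0 ≤ a) (ht : 0 ≤ t)
    (g : ℝ → ℝ) :
    fracInt α ((Ioi a).indicator g) t
      = if a ≤ t then ∫ ζ in a..t, (t - ζ) ^ (α - 1) / Real.Gamma α * g ζ else 0 := by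
  unfold fracInt
  have h1 : (fun ζ => (t - ζ) ^ (α - 1) / Real.Gamma α * (Ioi a).indicator g ζ)
      = (Ioi a).indicator (fun ζ => (t - ζ) ^ (α - 1) / Real.Gamma α * g ζ) := by
    funext ζ
    by_cases h : ζ ∈ Ioi a
    · simp only [indicator_of_mem h]
    · simp only [indicator_of_notMem h, mul_zero]
  rw [h1, intervalIntegral.integral_of_le ht, MeasureTheory.setIntegral_indicator measurableSet_Ioi,
    Ioc_inter_Ioi, max_eq_right ha]
  split_ifs with hat
  · rw [intervalIntegral.integral_of_le hat]
  · rw [Ioc_eq_empty (by linarith)]; simp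

lemma fracInt_step {α : ℝ} (hα : 0 < α) {a t : ℝ} (ha : 0 ≤ a) (ht : 0 ≤ t) :
    fracInt α ((Ioi a).indicator fun _ => 1) t = tpow α (t - a) := by
  rw [fracInt_indicator_Ioi ha ht]
  split_ifs with hat
  · simp only [mul_one]
    rw [intervalIntegral.integral_comp_sub_left (fun x => x ^ (α - 1) / Real.Gamma α),
      intervalIntegral.integral_div, integral_rpow (Or.inl (by linarith)),
      tpow_of_nonneg (by linarith), sub_self, sub_add_cancel, Real.zero_rpow hα.ne',
      Real.Gamma_add_one hα.ne']
    field_simp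
    ring
  · rw [tpow_of_nonpos hα (by linarith)]

lemma fracInt_ramp {α : ℝ} (hα : 0 < α) {a t : ℝ} (ha : 0 ≤ a) (ht : 0 ≤ t) :
    fracInt α ((Ioi a).indicator fun s => s - a) t = tpow (α + 1) (t - a) := by
  rw [fracInt_indicator_Ioi ha ht]
  have hG : 0 < Real.Gamma α := Real.Gamma_pos_of_pos hα
  split_ifs with hat
  · have h1 : ∫ ζ in a..t, (t - ζ) ^ (α - 1) / Real.Gamma α * (ζ - a)
        = ∫ ζ in a..t, (fun x => x ^ (α - 1) / Real.Gamma α * ((t - a) - x)) (t - ζ) := by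
      congr 1
      funext ζ
      ring_nf
    rw [h1, intervalIntegral.integral_comp_sub_left
      (fun x => x ^ (α - 1) / Real.Gamma α * ((t - a) - x))]
    have h2 : ∫ x in (t - t)..(t - a), x ^ (α - 1) / Real.Gamma α * ((t - a) - x)
        = ∫ x in (t - t)..(t - a), ((t - a) / Real.Gamma α * x ^ (α - 1)
            - 1 / Real.Gamma α * x ^ α) := by
      refine intervalIntegral.integral_congr_ae ?_
      refine Filter.Eventually.of_forall fun x hx => ?_
      rw [sub_self, uIoc_of_le (by linarith)] at hx
      have : x ^ α = x ^ (α - 1) * x := by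
        rw [← Real.rpow_add_one hx.1.ne', sub_add_cancel]
      rw [this]
      ring
    have hz : 0 ≤ t - a := by linarith
    rw [h2, intervalIntegral.integral_sub
      ((intervalIntegral.intervalIntegrable_rpow' (by linarith)).const_mul _)
      ((intervalIntegral.intervalIntegrable_rpow' (by linarith)).const_mul _),
      intervalIntegral.integral_const_mul, intervalIntegral.integral_const_mul,
      integral_rpow (Or.inl (by linarith)), integral_rpow (Or.inl (by linarith)),
      tpow_of_nonneg hz, sub_self, sub_add_cancel, Real.zero_rpow hα.ne',
      Real.zero_rpow (by linarith), Real.Gamma_add_one (s := α + 1) (by linarith),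
      Real.Gamma_add_one hα.ne', Real.rpow_add_one' hz (by linarith)]
    field_simp
    ring
  · rw [tpow_of_nonpos (by linarith) (by linarith)]

lemma indicator_Ioo_ae {a b : ℝ} (hab : a ≤ b) (g : ℝ → ℝ) :
    ∀ᵐ s, (Ioo a b).indicator g s = (Ioi a).indicator g s - (Ioi b).indicator g s := by
  filter_upwards [MeasureTheory.Measure.ae_ne MeasureTheory.volume b] with s hs
  by_cases h1 : a < s
  · rcases lt_or_gt_of_ne hs with h2 | h2
    · rw [indicator_of_mem (show s ∈ Ioo a b from ⟨h1, h2⟩),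
        indicator_of_mem (show s ∈ Ioi a from h1), indicator_of_notMem (by simp [h2.le])]
      simp
    · rw [indicator_of_notMem (by simp [h2.le]),
        indicator_of_mem (show s ∈ Ioi a from h1), indicator_of_mem (show s ∈ Ioi b from h2)]
      simp
  · have h1' := not_lt.1 h1
    rw [indicator_of_notMem (by simp [h1]), indicator_of_notMem (by simp [h1']),
      indicator_of_notMem (by simp; linarith)]
    simp

lemma bddMeas_indicator (T : ℝ) {s : Set ℝ} (hs : MeasurableSet s) {g : ℝ → ℝ}
    (hg : Continuous g) : BddMeas T (s.indicator g) :=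
  (BddMeas.of_continuous hg).indicator hs

lemma fracInt_box {α : ℝ} (hα : 0 < α) {a b t : ℝ} (ha : 0 ≤ a) (hab : a ≤ b) (ht : 0 ≤ t) :
    fracInt α ((Ioo a b).indicator fun _ => 1) t = tpow α (t - a) - tpow α (t - b) := by
  have h1 : fracInt α ((Ioo a b).indicator fun _ => 1) t
      = fracInt α (fun s => (Ioi a).indicator (fun _ => 1) s
          + (-1) * (Ioi b).indicator (fun _ => 1) s) t := by
    refine fracInt_congr ht ?_
    filter_upwards [indicator_Ioo_ae hab fun _ => 1] with s hs _
    rw [hs]; ring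
  rw [h1, fracInt_add (T := t) hα (bddMeas_indicator t measurableSet_Ioi continuous_const)
    ((bddMeas_indicator t measurableSet_Ioi continuous_const).const_mul _) ⟨ht, le_rfl⟩,
    fracInt_const_mul, fracInt_step hα ha ht, fracInt_step hα (ha.trans hab) ht]
  ring

/-- The odd linear function about the midpoint of `(a, b)`, cut off outside `(a, b)`. -/
noncomputable def sawtooth (a b : ℝ) : ℝ → ℝ := (Ioo a b).indicator fun s => (a + b) / 2 - s

/-- A sawtooth consists of upward jumps (b - a)/2 at both end points, minus a ramp starting at a,
plus a ramp starting at b. -/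
lemma fracInt_sawtooth {α : ℝ} (hα : 0 < α) {a b t : ℝ} (ha : 0 ≤ a) (hab : a ≤ b)
    (ht : 0 ≤ t) :
    fracInt α (sawtooth a b) t = (b - a) / 2 * tpow α (t - a) + (b - a) / 2 * tpow α (t - b)
      - tpow (α + 1) (t - a) + tpow (α + 1) (t - b) := by
  have h1 : fracInt α (sawtooth a b) t
      = fracInt α (fun s => (((b - a) / 2 * (Ioi a).indicator (fun _ => 1) s
          + (b - a) / 2 * (Ioi b).indicator (fun _ => 1) s)
          + (-1) * (Ioi a).indicator (fun s => s - a) s) + (Ioi b).indicator (fun s => s - b) s)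
          t := by
    refine fracInt_congr ht ?_
    filter_upwards [indicator_Ioo_ae hab fun s => (a + b) / 2 - s] with s hs _
    rw [sawtooth, hs]
    by_cases h1 : a < s <;> by_cases h2 : b < s <;>
      simp only [indicator, mem_Ioi, h1, h2, if_true, if_false] <;> ring
  have m1 : ∀ c, BddMeas t ((Ioi c).indicator fun _ => (1 : ℝ)) := fun c =>
    bddMeas_indicator t measurableSet_Ioi continuous_const
  have m2 : ∀ c, BddMeas t ((Ioi c).indicator fun s => s - c) := fun c =>
    bddMeas_indicator t measurableSet_Ioi (continuous_id.sub continuous_const)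
  have htt : t ∈ Icc 0 t := ⟨ht, le_rfl⟩
  rw [h1, fracInt_add hα ((((m1 a).const_mul _).add ((m1 b).const_mul _)).add
      ((m2 a).const_mul _)) (m2 b) htt,
    fracInt_add hα (((m1 a).const_mul _).add ((m1 b).const_mul _)) ((m2 a).const_mul _) htt,
    fracInt_add hα ((m1 a).const_mul _) ((m1 b).const_mul _) htt, fracInt_const_mul,
    fracInt_const_mul, fracInt_const_mul, fracInt_step hα ha ht, fracInt_step hα (ha.trans hab) ht,
    fracInt_ramp hα ha ht, fracInt_ramp hα (ha.trans hab) ht]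
  ring

lemma integral_fracInt_box {α : ℝ} (hα : 0 < α) {a b x y : ℝ} (ha : 0 ≤ a) (hab : a ≤ b)
    (hx : 0 ≤ x) (hxy : x ≤ y) :
    ∫ s in x..y, fracInt α ((Ioo a b).indicator fun _ => 1) s
      = (tpow (α + 1) (y - a) - tpow (α + 1) (y - b))
        - (tpow (α + 1) (x - a) - tpow (α + 1) (x - b)) := by
  have h1 : ∫ s in x..y, fracInt α ((Ioo a b).indicator fun _ => 1) s
      = ∫ s in x..y, (tpow α (s - a) - tpow α (s - b)) := by
    refine intervalIntegral.integral_congr fun s hs => ?_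
    rw [uIcc_of_le hxy] at hs
    exact fracInt_box hα ha hab (hx.trans hs.1)
  have hi : ∀ c, IntervalIntegrable (fun s => tpow α (s - c)) MeasureTheory.volume x y := fun c =>
    ((continuous_tpow hα).comp (continuous_id.sub continuous_const)).intervalIntegrable _ _
  rw [h1, intervalIntegral.integral_sub (hi a) (hi b), integral_tpow_sub hα, integral_tpow_sub hα]
  ring

/-- The primitive of the fractional integral of a sawtooth. -/
noncomputable def sawPrim (α a b t : ℝ) : ℝ :=
  (b - a) / 2 * tpow (α + 1) (t - a) + (b - a) / 2 * tpow (α + 1) (t - b)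
    - tpow (α + 2) (t - a) + tpow (α + 2) (t - b)

lemma integral_fracInt_sawtooth {α : ℝ} (hα : 0 < α) {a b x y : ℝ} (ha : 0 ≤ a) (hab : a ≤ b)
    (hx : 0 ≤ x) (hxy : x ≤ y) :
    ∫ s in x..y, fracInt α (sawtooth a b) s = sawPrim α a b y - sawPrim α a b x := by
  have h1 : ∫ s in x..y, fracInt α (sawtooth a b) s
      = ∫ s in x..y, ((b - a) / 2 * tpow α (s - a) + (b - a) / 2 * tpow α (s - b)
      - tpow (α + 1) (s - a) + tpow (α + 1) (s - b)) := by
    refine intervalIntegral.integral_congr fun s hs => ?_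
    rw [uIcc_of_le hxy] at hs
    exact fracInt_sawtooth hα ha hab (hx.trans hs.1)
  have hi : ∀ p, 0 < p → ∀ c, IntervalIntegrable (fun s => tpow p (s - c))
      MeasureTheory.volume x y := fun p hp c =>
    ((continuous_tpow hp).comp (continuous_id.sub continuous_const)).intervalIntegrable _ _
  have i1 := (hi α hα a).const_mul ((b - a) / 2)
  have i2 := (hi α hα b).const_mul ((b - a) / 2)
  have i3 := hi (α + 1) (by linarith) a
  have i4 := hi (α + 1) (by linarith) b
  rw [h1, intervalIntegral.integral_add ((i1.add i2).sub i3) i4,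
    intervalIntegral.integral_sub (i1.add i2) i3, intervalIntegral.integral_add i1 i2,
    intervalIntegral.integral_const_mul, intervalIntegral.integral_const_mul,
    integral_tpow_sub hα, integral_tpow_sub hα, integral_tpow_sub (by linarith),
    integral_tpow_sub (by linarith)]
  have : α + 1 + 1 = α + 2 := by ring
  rw [this]
  unfold sawPrim
  ring

/-- The fractional integral of a bounded measurable function is bounded and measurable. -/
lemma bddMeas_fracInt {α T : ℝ} (hα : 0 < α) {φ : ℝ → ℝ} (h : BddMeas T φ) :
    BddMeas T (fracInt α φ) := by
  obtain ⟨⟨K, hK⟩, m⟩ := id h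
  have hG : 0 < Real.Gamma α := Real.Gamma_pos_of_pos hα
  refine ⟨⟨K * tpow α T, fun t ht => ?_⟩, ?_⟩
  · have ht' : t ∈ Icc 0 T := Ioc_subset_Icc_self ht
    have hK0 : 0 ≤ K := (abs_nonneg _).trans (hK t ht)
    have hc : BddMeas T (fun s => K * (Ioi (0 : ℝ)).indicator (fun _ => 1) s) :=
      (bddMeas_indicator T measurableSet_Ioi continuous_const).const_mul K
    have hval : fracInt α (fun s => K * (Ioi (0 : ℝ)).indicator (fun _ => 1) s) t
        ≤ K * tpow α T := by
      rw [fracInt_const_mul, fracInt_step hα le_rfl ht.1.le]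
      exact mul_le_mul_of_nonneg_left (tpow_mono hα (by linarith [ht.2])) hK0
    have h1 := fracInt_mono hα h hc ht' (Filter.Eventually.of_forall fun s hs => by
      rw [indicator_of_mem (show s ∈ Ioi 0 from hs.1), mul_one]
      exact (le_abs_self _).trans (hK s ⟨hs.1, hs.2.trans ht.2⟩))
    have h2 := fracInt_mono hα (h.const_mul (-1)) hc ht' (Filter.Eventually.of_forall fun s hs => by
      rw [indicator_of_mem (show s ∈ Ioi 0 from hs.1), mul_one]
      linarith [neg_abs_le (φ s), hK s ⟨hs.1, hs.2.trans ht.2⟩])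
    rw [fracInt_const_mul] at h2
    rw [abs_le]
    constructor <;> linarith
  · have m0 : MeasureTheory.AEStronglyMeasurable ((Ioc 0 T).indicator φ)
        MeasureTheory.volume := (aestronglyMeasurable_indicator_iff measurableSet_Ioc).2 m
    -- Truncating the kernel to the triangle 0 < ζ ≤ t makes the range of integration independent of
    -- t; integrating out one variable of a jointly measurable function preserves measurability.
    have m1 : Measurable (fun p : ℝ × ℝ => {q : ℝ × ℝ | 0 < q.2 ∧ q.2 ≤ q.1}.indicator
        (fun q : ℝ × ℝ => (q.1 - q.2) ^ (α - 1) / Real.Gamma α) p) := by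
      refine Measurable.indicator (by fun_prop) ?_
      exact (measurableSet_lt measurable_const measurable_snd).inter
        (measurableSet_le measurable_snd measurable_fst)
    have m2 : MeasureTheory.AEStronglyMeasurable (fun p : ℝ × ℝ =>
        {q : ℝ × ℝ | 0 < q.2 ∧ q.2 ≤ q.1}.indicator
        (fun q : ℝ × ℝ => (q.1 - q.2) ^ (α - 1) / Real.Gamma α) p * (Ioc 0 T).indicator φ p.2)
        ((MeasureTheory.volume.restrict (Ioc 0 T)).prod MeasureTheory.volume) :=
      m1.aestronglyMeasurable.mul (m0.comp_snd)
    have m3 := m2.integral_prod_right'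
    refine m3.congr ?_
    refine (MeasureTheory.ae_restrict_iff' measurableSet_Ioc).2
      (Filter.Eventually.of_forall fun t ht => ?_)
    simp only [fracInt]
    rw [intervalIntegral.integral_of_le ht.1.le, ← MeasureTheory.integral_indicator
      measurableSet_Ioc]
    congr 1
    funext ζ
    by_cases hζ : ζ ∈ Ioc 0 t
    · rw [indicator_of_mem hζ, indicator_of_mem (show (t, ζ) ∈ {q : ℝ × ℝ | 0 < q.2 ∧ q.2 ≤ q.1}
        from hζ), indicator_of_mem (show ζ ∈ Ioc 0 T from ⟨hζ.1, hζ.2.trans ht.2⟩)]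
    · rw [indicator_of_notMem hζ, indicator_of_notMem
        (show (t, ζ) ∉ {q : ℝ × ℝ | 0 < q.2 ∧ q.2 ≤ q.1} from hζ), zero_mul]

/-! ### Graded meshes -/

/-- The exponents met later have no fixed sign; |p| in the constant covers both signs at once. -/
lemma rpow_le_of_comparable {b s Λ : ℝ} (hb : 0 < b) (hΛ : 1 ≤ Λ) (h1 : b ≤ Λ * s)
    (h2 : s ≤ Λ * b) (p : ℝ) : s ^ p ≤ Λ ^ |p| * b ^ p := by
  have hΛ0 : 0 < Λ := by linarith
  have hs : 0 < s := by
    by_contra h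
    push Not at h
    nlinarith
  rcases le_total 0 p with hp | hp
  · rw [abs_of_nonneg hp, ← Real.mul_rpow hΛ0.le hb.le]
    exact Real.rpow_le_rpow hs.le h2 hp
  · rw [abs_of_nonpos hp]
    have h3 : b ^ (-p) ≤ Λ ^ (-p) * s ^ (-p) := by
      rw [← Real.mul_rpow hΛ0.le hs.le]
      exact Real.rpow_le_rpow hb.le h1 (by linarith)
    have h4 : b ^ p * b ^ (-p) = 1 := by rw [← Real.rpow_add hb]; simp
    have h5 : s ^ p * s ^ (-p) = 1 := by rw [← Real.rpow_add hs]; simp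
    have hbp : 0 < b ^ p := Real.rpow_pos_of_pos hb _
    have hsp : 0 < s ^ p := Real.rpow_pos_of_pos hs _
    calc s ^ p = s ^ p * (b ^ p * b ^ (-p)) := by rw [h4, mul_one]
      _ ≤ s ^ p * (b ^ p * (Λ ^ (-p) * s ^ (-p))) := by gcongr
      _ = (s ^ p * s ^ (-p)) * (Λ ^ (-p) * b ^ p) := by ring
      _ = _ := by rw [h5, one_mul]

namespace IsGradedMesh

variable {T γ Γ cγ k : ℝ} {N : ℕ} {t : ℕ → ℝ}

lemma strict_mono (hm : IsGradedMesh T γ Γ cγ k N t) {i j : ℕ} (hij : i < j) (hj : j ≤ N) :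
    t i < t j := by
  induction j, hij using Nat.le_induction with
  | base => simpa using hm.lt (i + 1) (by omega) hj
  | succ j hij ih =>
    exact (ih (by omega)).trans (by simpa using hm.lt (j + 1) (by omega) hj)

lemma mono (hm : IsGradedMesh T γ Γ cγ k N t) {i j : ℕ} (hij : i ≤ j) (hj : j ≤ N) :
    t i ≤ t j := by
  rcases hij.eq_or_lt with rfl | h
  · rfl
  · exact (hm.strict_mono h hj).le

lemma pos (hm : IsGradedMesh T γ Γ cγ k N t) {n : ℕ} (h1 : 1 ≤ n) (hn : n ≤ N) : 0 < t n := by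
  rw [← hm.zero]; exact hm.strict_mono h1 hn

lemma nonneg (hm : IsGradedMesh T γ Γ cγ k N t) {n : ℕ} (hn : n ≤ N) : 0 ≤ t n := by
  rw [← hm.zero]; exact hm.mono (Nat.zero_le n) hn

lemma le_T (hm : IsGradedMesh T γ Γ cγ k N t) {n : ℕ} (hn : n ≤ N) : t n ≤ T :=
  (hm.mono hn le_rfl).trans hm.le_end

lemma mem_Ioc (hm : IsGradedMesh T γ Γ cγ k N t) {n : ℕ} (h1 : 1 ≤ n) (hn : n ≤ N) :
    t n ∈ Ioc 0 T := ⟨hm.pos h1 hn, hm.le_T hn⟩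

lemma tstep_pos (hm : IsGradedMesh T γ Γ cγ k N t) {n : ℕ} (h1 : 1 ≤ n) (hn : n ≤ N) :
    0 < tstep t n := sub_pos.2 (hm.lt n h1 hn)

/-- The start at m = 2 matters: the mesh conditions do not require the first step to be at most the
second. -/
lemma tstep_mono (hm : IsGradedMesh T γ Γ cγ k N t) {m n : ℕ} (hm2 : 2 ≤ m) (hmn : m ≤ n)
    (hn : n ≤ N) : tstep t m ≤ tstep t n := by
  induction n, hmn using Nat.le_induction with
  | base => rfl
  | succ n hmn ih =>
    have := hm.step_mono n (by omega) hn
    linarith [ih (by omega)]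

lemma enlarge {Γ' : ℝ} (hm : IsGradedMesh T γ Γ cγ k N t) (hk : 0 < k) (h : Γ ≤ Γ') :
    IsGradedMesh T γ Γ' cγ k N t where
  zero := hm.zero
  lt := hm.lt
  le_end := hm.le_end
  step_le := fun n h1 hn => by
    refine (hm.step_le n h1 hn).trans ?_
    rw [mul_assoc, mul_assoc]
    exact mul_le_mul_of_nonneg_right h (mul_nonneg hk.le
      (le_min zero_le_one (Real.rpow_nonneg (hm.nonneg hn) _)))
  first_ge := hm.first_ge
  ratio_le := fun n h2 hn => (hm.ratio_le n h2 hn).trans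
    (mul_le_mul_of_nonneg_right h (hm.nonneg (by omega)))
  step_mono := hm.step_mono
  step_diff_le := fun n h2 hn => by
    refine (hm.step_diff_le n h2 hn).trans ?_
    rw [mul_assoc, mul_assoc]
    exact mul_le_mul_of_nonneg_right h (mul_nonneg (sq_nonneg k)
      (Real.rpow_nonneg (hm.nonneg (by omega)) _))

lemma tstep_le (hm : IsGradedMesh T γ Γ cγ k N t) (hΓ : 1 ≤ Γ) (hk : 0 < k) {n : ℕ} (h1 : 1 ≤ n)
    (hn : n ≤ N) : tstep t n ≤ Γ * k * t n ^ (1 - 1 / γ) :=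
  (hm.step_le n h1 hn).trans
    (mul_le_mul_of_nonneg_left (min_le_right _ _) (by positivity))

lemma tstep_sq_le (hm : IsGradedMesh T γ Γ cγ k N t) (hΓ : 1 ≤ Γ) (hk : 0 < k) {n : ℕ}
    (h1 : 1 ≤ n) (hn : n ≤ N) : tstep t n ^ 2 ≤ Γ ^ 2 * k ^ 2 * t n ^ (2 - 2 / γ) := by
  have h2 := pow_le_pow_left₀ (hm.tstep_pos h1 hn).le (hm.tstep_le hΓ hk h1 hn) 2
  refine h2.trans (le_of_eq ?_)
  have : t n ^ (2 - 2 / γ) = (t n ^ (1 - 1 / γ)) ^ 2 := by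
    rw [← Real.rpow_natCast, ← Real.rpow_mul (hm.pos h1 hn).le]
    congr 1
    push_cast
    ring
  rw [this]
  ring

lemma le_mul_prev (hm : IsGradedMesh T γ Γ cγ k N t) {n : ℕ} (h2 : 2 ≤ n)
    (hn : n ≤ N) {s : ℝ} (hΓ : 1 ≤ Γ) (hs : t (n - 1) ≤ s) : t n ≤ Γ * s :=
  (hm.ratio_le n h2 hn).trans (mul_le_mul_of_nonneg_left hs (by linarith))

lemma rpow_le (hm : IsGradedMesh T γ Γ cγ k N t) (hΓ : 1 ≤ Γ) {n : ℕ} (h2 : 2 ≤ n)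
    (hn : n ≤ N) {s : ℝ} (hs : s ∈ Icc (t (n - 1)) (t n)) (p : ℝ) :
    s ^ p ≤ Γ ^ |p| * t n ^ p := by
  have h0 := hm.pos (by omega : 1 ≤ n) hn
  exact rpow_le_of_comparable h0 hΓ (hm.le_mul_prev h2 hn hΓ hs.1)
    (hs.2.trans (by nlinarith)) p

/-- The first step is t₁ itself, so its step bound reads t₁ ≤ Γ k t₁^(1-1/γ), that is t₁^(1/γ) ≤ Γ
k. -/
lemma first_rpow_le (hm : IsGradedMesh T γ Γ cγ k N t) (hΓ : 1 ≤ Γ) (hk : 0 < k)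
    (hN : 1 ≤ N) : t 1 ^ (2 / γ) ≤ Γ ^ 2 * k ^ 2 := by
  have h0 := hm.pos le_rfl hN
  have h1 := hm.tstep_le hΓ hk le_rfl hN
  have h2 : tstep t 1 = t 1 := by simp [tstep, hm.zero]
  rw [h2] at h1
  have h3 : t 1 ^ (1 / γ) ≤ Γ * k := by
    have h4 : t 1 ^ (1 / γ) * t 1 ^ (1 - 1 / γ) = t 1 := by
      rw [← Real.rpow_add h0]; simp
    have h5 : 0 < t 1 ^ (1 - 1 / γ) := Real.rpow_pos_of_pos h0 _
    rw [← h4] at h1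
    nth_rewrite 2 [h4] at h1
    exact le_of_mul_le_mul_right h1 h5
  have h6 : t 1 ^ (2 / γ) = (t 1 ^ (1 / γ)) ^ 2 := by
    rw [← Real.rpow_natCast, ← Real.rpow_mul h0.le]
    congr 1
    push_cast
    ring
  rw [h6, ← mul_pow]
  exact pow_le_pow_left₀ (Real.rpow_nonneg h0.le _) h3 2

end IsGradedMesh

lemma errK_nonneg {σ γ k t₁ tN : ℝ} (hk : 0 ≤ k) (h1 : 0 < t₁) (h : t₁ ≤ tN) :
    0 ≤ errK σ γ k t₁ tN := by
  unfold errK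
  split_ifs
  · exact Real.rpow_nonneg hk _
  · exact mul_nonneg (sq_nonneg k) (Real.log_nonneg ((one_le_div h1).2 h))
  · positivity

/-- `k² t_n^(σ - 2/γ)` is bounded by the temporal error bound. -/
lemma exists_sq_mul_rpow_le_errK {T σ γ Γ cγ ρ : ℝ} (hT : 0 < T) (hσ : 0 < σ) (hγ : 1 ≤ γ)
    (hcγ : 0 < cγ) (hρ : 1 < ρ) :
    ∃ C : ℝ, 0 < C ∧ ∀ (N : ℕ) (k : ℝ) (t : ℕ → ℝ), 0 < k →
      IsGradedMesh T γ Γ cγ k N t → (γ = 2 / σ → ρ * t 1 ≤ t N) →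
      ∀ n, 1 ≤ n → n ≤ N → k ^ 2 * t n ^ (σ - 2 / γ) ≤ C * errK σ γ k (t 1) (t N) := by
  have hlog : 0 < Real.log ρ := Real.log_pos hρ
  have hγ0 : 0 < γ := by linarith
  refine ⟨cγ ^ (σ - 2 / γ) + 1 / Real.log ρ + T ^ (σ - 2 / γ), by positivity, ?_⟩
  intro N k t hk hm hend n h1 hn
  have ht := hm.pos h1 hn
  have ht1 := hm.pos le_rfl (h1.trans hn)
  have hle : t 1 ≤ t n := hm.mono h1 hn
  have hcp : 0 < cγ ^ (σ - 2 / γ) := Real.rpow_pos_of_pos hcγ _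
  have hTp : 0 < T ^ (σ - 2 / γ) := Real.rpow_pos_of_pos hT _
  have hlp : 0 < 1 / Real.log ρ := by positivity
  have hE := errK_nonneg (σ := σ) (γ := γ) hk.le ht1 (hm.mono (h1.trans hn) le_rfl)
  rw [add_mul, add_mul]
  have e1 := mul_nonneg hcp.le hE
  have e2 := mul_nonneg hlp.le hE
  have e3 := mul_nonneg hTp.le hE
  -- For a negative exponent the smallest node decides, and t₁ ≥ cγ k^γ; for exponent 0 the
  -- logarithm is at least log ρ; for a positive exponent t_n ≤ T.
  rcases lt_trichotomy (σ - 2 / γ) 0 with h | h | h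
  · have hc : γ < 2 / σ := by
      rw [lt_div_iff₀ hσ]
      have : σ < 2 / γ := by linarith
      rw [lt_div_iff₀ hγ0] at this
      linarith
    have h2 : t n ^ (σ - 2 / γ) ≤ (cγ * k ^ γ) ^ (σ - 2 / γ) :=
      Real.rpow_le_rpow_of_nonpos (by positivity) (hm.first_ge.trans hle) h.le
    have h3 : k ^ 2 * (k ^ γ) ^ (σ - 2 / γ) = k ^ (γ * σ) := by
      rw [← Real.rpow_natCast k 2, ← Real.rpow_mul hk.le, ← Real.rpow_add hk]
      congr 1
      push_cast
      field_simp
      ring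
    have hb : k ^ 2 * t n ^ (σ - 2 / γ) ≤ cγ ^ (σ - 2 / γ) * k ^ (γ * σ) := by
      calc k ^ 2 * t n ^ (σ - 2 / γ) ≤ k ^ 2 * (cγ * k ^ γ) ^ (σ - 2 / γ) := by gcongr
        _ = cγ ^ (σ - 2 / γ) * (k ^ 2 * (k ^ γ) ^ (σ - 2 / γ)) := by
          rw [Real.mul_rpow hcγ.le (Real.rpow_nonneg hk.le _)]; ring
        _ = _ := by rw [h3]
    have : errK σ γ k (t 1) (t N) = k ^ (γ * σ) := by unfold errK; rw [if_pos hc]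
    rw [this] at e1 e2 e3 ⊢
    linarith
  · have hc : γ = 2 / σ := by
      have : σ = 2 / γ := by linarith
      rw [this]; field_simp
    have h2 : errK σ γ k (t 1) (t N) = k ^ 2 * Real.log (t N / t 1) := by
      unfold errK
      rw [if_neg (by linarith), if_pos hc]
    have h3 : Real.log ρ ≤ Real.log (t N / t 1) :=
      Real.log_le_log (by linarith) ((le_div_iff₀ ht1).2 (hend hc))
    have hb : k ^ 2 * t n ^ (σ - 2 / γ) ≤ 1 / Real.log ρ * errK σ γ k (t 1) (t N) := by
      rw [h, Real.rpow_zero, mul_one, h2, div_mul_eq_mul_div, one_mul, le_div_iff₀ hlog]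
      exact mul_le_mul_of_nonneg_left h3 (sq_nonneg k)
    linarith
  · have hc : 2 / σ < γ := by
      rw [div_lt_iff₀ hσ]
      have : 2 / γ < σ := by linarith
      rw [div_lt_iff₀ hγ0] at this
      linarith
    have h2 : errK σ γ k (t 1) (t N) = k ^ 2 := by
      unfold errK
      rw [if_neg (by linarith), if_neg (by linarith)]
    have hb : k ^ 2 * t n ^ (σ - 2 / γ) ≤ T ^ (σ - 2 / γ) * errK σ γ k (t 1) (t N) := by
      rw [h2, mul_comm]
      exact mul_le_mul_of_nonneg_right (Real.rpow_le_rpow ht.le (hm.le_T hn) h.le) (sq_nonneg k)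
    linarith

/-- Split t₁^σ = t₁^(2/γ) t₁^(σ-2/γ); the first factor is O(k²). This pays for every error of the
first cell. -/
lemma exists_first_rpow_le_errK {T σ γ Γ cγ ρ : ℝ} (hT : 0 < T) (hσ : 0 < σ) (hγ : 1 ≤ γ)
    (hΓ : 1 ≤ Γ) (hcγ : 0 < cγ) (hρ : 1 < ρ) :
    ∃ C : ℝ, 0 < C ∧ ∀ (N : ℕ) (k : ℝ) (t : ℕ → ℝ), 0 < k → 1 ≤ N →
      IsGradedMesh T γ Γ cγ k N t → (γ = 2 / σ → ρ * t 1 ≤ t N) →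
      t 1 ^ σ ≤ C * errK σ γ k (t 1) (t N) := by
  obtain ⟨C, hC, h⟩ := exists_sq_mul_rpow_le_errK (Γ := Γ) hT hσ hγ hcγ hρ
  refine ⟨Γ ^ 2 * C, by positivity, fun N k t hk hN hm hend => ?_⟩
  have h0 := hm.pos le_rfl hN
  have h1 := h N k t hk hm hend 1 le_rfl hN
  have h2 := hm.first_rpow_le hΓ hk hN
  have h3 : t 1 ^ σ = t 1 ^ (2 / γ) * t 1 ^ (σ - 2 / γ) := by
    rw [← Real.rpow_add h0]; congr 1; ring
  have h4 : 0 < t 1 ^ (σ - 2 / γ) := Real.rpow_pos_of_pos h0 _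
  calc t 1 ^ σ ≤ Γ ^ 2 * k ^ 2 * t 1 ^ (σ - 2 / γ) := by rw [h3]; gcongr
    _ = Γ ^ 2 * (k ^ 2 * t 1 ^ (σ - 2 / γ)) := by ring
    _ ≤ Γ ^ 2 * (C * errK σ γ k (t 1) (t N)) := by gcongr
    _ = _ := by ring

lemma sum_Icc_two_telescope (N : ℕ) (hN : 1 ≤ N) (F : ℕ → ℝ) :
    ∑ m ∈ Finset.Icc 2 N, (F m - F (m - 1)) = F N - F 1 := by
  induction N, hN using Nat.le_induction with
  | base => simp
  | succ N hN ih =>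
    rw [Finset.sum_Icc_succ_top (by omega), ih]
    simp

/-- The weighted sum of the steps that governs the truncation errors. -/
lemma exists_sum_step_le_errK {T σ γ Γ cγ ρ : ℝ} (hT : 0 < T) (hσ : 0 < σ) (hγ : 1 ≤ γ)
    (hΓ : 1 ≤ Γ) (hcγ : 0 < cγ) (hρ : 1 < ρ) :
    ∃ C : ℝ, 0 < C ∧ ∀ (N : ℕ) (k : ℝ) (t : ℕ → ℝ), 0 < k → 1 ≤ N →
      IsGradedMesh T γ Γ cγ k N t → (γ = 2 / σ → ρ * t 1 ≤ t N) →
      k ^ 2 * ∑ m ∈ Finset.Icc 2 N, tstep t m * t m ^ (σ - 2 / γ - 1)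
        ≤ C * errK σ γ k (t 1) (t N) := by
  obtain ⟨C, hC, h⟩ := exists_sq_mul_rpow_le_errK (Γ := Γ) hT hσ hγ hcγ hρ
  set p := σ - 2 / γ with hp
  have hγ0 : 0 < γ := by linarith
  rcases eq_or_ne p 0 with h0 | h0
  · refine ⟨1, one_pos, fun N k t hk hN hm hend => ?_⟩
    have hc : γ = 2 / σ := by
      have : σ = 2 / γ := by linarith
      rw [this]; field_simp
    have h2 : errK σ γ k (t 1) (t N) = k ^ 2 * Real.log (t N / t 1) := by
      unfold errK
      rw [if_neg (by linarith), if_pos hc]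
    rw [h2, one_mul]
    refine mul_le_mul_of_nonneg_left ?_ (sq_nonneg k)
    rw [Real.log_div (hm.pos hN le_rfl).ne' (hm.pos le_rfl hN).ne',
      ← sum_Icc_two_telescope N hN (fun m => Real.log (t m))]
    refine Finset.sum_le_sum fun m hmem => ?_
    rw [Finset.mem_Icc] at hmem
    have a1 := hm.pos (by omega : 1 ≤ m) hmem.2
    have a2 := hm.pos (by omega : 1 ≤ m - 1) (by omega)
    -- The summand k_m / t_m = 1 - t_(m-1)/t_m is at most log t_m - log t_(m-1), which telescopes.
    have := Real.log_le_sub_one_of_pos (div_pos a2 a1)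
    rw [Real.log_div a2.ne' a1.ne'] at this
    have h3 : tstep t m * t m ^ (p - 1) = 1 - t (m - 1) / t m := by
      rw [h0, zero_sub, Real.rpow_neg_one, tstep]
      field_simp
    rw [h3]
    linarith
  · refine ⟨Γ ^ |1 - p| * C / |p|, by positivity, fun N k t hk hN hm hend => ?_⟩
    -- Each summand is compared with the integral of s^(p-1) over its cell, the factor coming from
    -- the bounded ratio of neighbouring nodes.
    have hloc : ∀ m ∈ Finset.Icc 2 N, tstep t m * t m ^ (p - 1)
        ≤ Γ ^ |1 - p| * (t m ^ p / p - t (m - 1) ^ p / p) := by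
      intro m hmem
      rw [Finset.mem_Icc] at hmem
      have a1 := hm.pos (by omega : 1 ≤ m) hmem.2
      have a2 := hm.pos (by omega : 1 ≤ m - 1) (by omega)
      have hlt := hm.lt m (by omega) hmem.2
      obtain ⟨ξ, hξ, hd⟩ := exists_hasDerivAt_eq_slope (fun s => s ^ p) (fun s => p * s ^ (p - 1))
        hlt (ContinuousOn.rpow_const continuousOn_id fun s hs => Or.inl (by
          have : 0 < s := a2.trans_le hs.1
          exact this.ne')) (fun s hs => Real.hasDerivAt_rpow_const (Or.inl (a2.trans hs.1).ne'))
      have hξ0 : 0 < ξ := a2.trans hξ.1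
      have hd' : t m ^ p / p - t (m - 1) ^ p / p = tstep t m * ξ ^ (p - 1) := by
        have hne : t m - t (m - 1) ≠ 0 := by linarith
        rw [eq_div_iff hne] at hd
        rw [← sub_div, div_eq_iff h0, ← hd, tstep]
        ring
      rw [hd', mul_left_comm]
      refine mul_le_mul_of_nonneg_left ?_ (hm.tstep_pos (by omega) hmem.2).le
      rw [show |1 - p| = |p - 1| from abs_sub_comm _ _]
      exact rpow_le_of_comparable hξ0 hΓ (hξ.2.le.trans (by nlinarith))
        (hm.le_mul_prev hmem.1 hmem.2 hΓ hξ.1.le) _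
    have hs := Finset.sum_le_sum hloc
    rw [← Finset.mul_sum, sum_Icc_two_telescope N hN (fun m => t m ^ p / p)] at hs
    have hfin : k ^ 2 * (t N ^ p / p - t 1 ^ p / p) ≤ C / |p| * errK σ γ k (t 1) (t N) := by
      have hN1 := h N k t hk hm hend N hN le_rfl
      have h11 := h N k t hk hm hend 1 le_rfl hN
      have b1 : 0 ≤ t N ^ p := Real.rpow_nonneg (hm.nonneg le_rfl) _
      have b2 : 0 ≤ t 1 ^ p := Real.rpow_nonneg (hm.nonneg hN) _
      rw [div_mul_eq_mul_div, le_div_iff₀ (abs_pos.2 h0)]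
      -- The telescoped sum is dominated by its value at t₁ if p < 0 and at t_N if p > 0.
      rcases lt_or_gt_of_ne h0 with hneg | hpos
      · rw [abs_of_neg hneg]
        have : k ^ 2 * (t N ^ p / p - t 1 ^ p / p) * -p = k ^ 2 * t 1 ^ p - k ^ 2 * t N ^ p := by
          field_simp; ring
        rw [this]
        nlinarith [mul_nonneg (sq_nonneg k) b1]
      · rw [abs_of_pos hpos]
        have : k ^ 2 * (t N ^ p / p - t 1 ^ p / p) * p = k ^ 2 * t N ^ p - k ^ 2 * t 1 ^ p := by
          field_simp
        rw [this]
        nlinarith [mul_nonneg (sq_nonneg k) b2]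
    calc _ ≤ k ^ 2 * (Γ ^ |1 - p| * (t N ^ p / p - t 1 ^ p / p)) := by gcongr
      _ = Γ ^ |1 - p| * (k ^ 2 * (t N ^ p / p - t 1 ^ p / p)) := by ring
      _ ≤ Γ ^ |1 - p| * (C / |p| * errK σ γ k (t 1) (t N)) := by gcongr
      _ = _ := by ring

/-! ### The trapezoidal error of the kernel -/

/-- The error of the trapezoidal rule on `(x, x + κ)` for the twice integrated Abel kernel, in
Peano form. -/
noncomputable def trapErr (α x κ : ℝ) : ℝ :=
  ∫ τ in (0 : ℝ)..κ, (x + τ) ^ (α - 1) / Real.Gamma α * (τ * (κ - τ) / 2)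

lemma intervalIntegrable_shift_kernel {α : ℝ} (hα : 0 < α) (x a b : ℝ) {g : ℝ → ℝ}
    (hg : Continuous g) :
    IntervalIntegrable (fun τ => (x + τ) ^ (α - 1) / Real.Gamma α * g τ)
      MeasureTheory.volume a b := by
  have h1 : IntervalIntegrable (fun y : ℝ => y ^ (α - 1)) MeasureTheory.volume (x + a) (x + b) :=
    intervalIntegral.intervalIntegrable_rpow' (by linarith)
  have h2 := h1.comp_add_left x
  simp only [add_sub_cancel_left] at h2
  exact (h2.div_const _).mul_continuousOn hg.continuousOn

lemma integral_shift_kernel {α : ℝ} (hα : 0 < α) {x a b : ℝ} (hx : 0 ≤ x + a) (hab : a ≤ b) :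
    ∫ τ in a..b, (x + τ) ^ (α - 1) / Real.Gamma α = tpow α (x + b) - tpow α (x + a) := by
  have hG : 0 < Real.Gamma α := Real.Gamma_pos_of_pos hα
  rw [intervalIntegral.integral_comp_add_left (fun y => y ^ (α - 1) / Real.Gamma α),
    intervalIntegral.integral_div, integral_rpow (Or.inl (by linarith)), sub_add_cancel,
    tpow_of_nonneg hx, tpow_of_nonneg (by linarith), Real.Gamma_add_one hα.ne']
  field_simp

section

variable {α x y κ κ' : ℝ}

lemma kernel_nonneg (hα : 0 < α) {z : ℝ} (hz : 0 ≤ z) : 0 ≤ z ^ (α - 1) / Real.Gamma α :=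
  div_nonneg (Real.rpow_nonneg hz _) (Real.Gamma_pos_of_pos hα).le

lemma kernel_anti (hα : α ∈ Ioo (0 : ℝ) 1) {z w : ℝ} (hz : 0 < z) (hzw : z ≤ w) :
    w ^ (α - 1) / Real.Gamma α ≤ z ^ (α - 1) / Real.Gamma α :=
  div_le_div_of_nonneg_right (Real.rpow_le_rpow_of_nonpos hz hzw (by linarith [hα.2]))
    (Real.Gamma_pos_of_pos hα.1).le

lemma continuous_bump (κ : ℝ) : Continuous fun τ : ℝ => τ * (κ - τ) / 2 := by fun_prop

lemma trapErr_nonneg (hα : 0 < α) (hx : 0 ≤ x) (hκ : 0 ≤ κ) : 0 ≤ trapErr α x κ := by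
  refine intervalIntegral.integral_nonneg hκ fun τ hτ => mul_nonneg
    (kernel_nonneg hα (by linarith [hτ.1])) ?_
  have := mul_nonneg hτ.1 (sub_nonneg.2 hτ.2)
  linarith

/-- Two integrations by parts: the bump τ(κ - τ)/2 vanishes at both ends and has second derivative
-1. For x = 0 the kernel is singular at τ = 0, so the primitive is differentiated only inside the
interval and is continuous up to its ends. -/
lemma trapErr_eq (hα : 0 < α) (hx : 0 ≤ x) (hκ : 0 ≤ κ) :
    trapErr α x κ = κ / 2 * tpow (α + 1) (x + κ) + κ / 2 * tpow (α + 1) x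
      - tpow (α + 2) (x + κ) + tpow (α + 2) x := by
  have hG : 0 < Real.Gamma α := Real.Gamma_pos_of_pos hα
  set P : ℝ → ℝ := fun τ => tpow α (x + τ) * (τ * (κ - τ) / 2)
    - tpow (α + 1) (x + τ) * ((κ - 2 * τ) / 2) - tpow (α + 1 + 1) (x + τ) with hP
  have hc : ∀ p, 0 < p → Continuous fun τ => tpow p (x + τ) := fun p hp =>
    (continuous_tpow hp).comp (continuous_const.add continuous_id)
  have hcont : Continuous P := by
    have c1 := hc α hα
    have c2 := hc (α + 1) (by linarith)
    have c3 := hc (α + 1 + 1) (by linarith)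
    simp only [hP]
    fun_prop
  have hd : ∀ τ ∈ Ioo 0 κ, HasDerivAt P
      ((x + τ) ^ (α - 1) / Real.Gamma α * (τ * (κ - τ) / 2)) τ := by
    intro τ hτ
    have hz : 0 < x + τ := by linarith [hτ.1]
    have d0 : HasDerivAt (fun τ => tpow α (x + τ)) ((x + τ) ^ (α - 1) / Real.Gamma α) τ := by
      have e1 : HasDerivAt (tpow α) ((x + τ) ^ (α - 1) / Real.Gamma α) (x + τ) := by
        have e2 : HasDerivAt (fun y : ℝ => y ^ α / Real.Gamma (α + 1))
            (α * (x + τ) ^ (α - 1) / Real.Gamma (α + 1)) (x + τ) :=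
          (Real.hasDerivAt_rpow_const (Or.inl hz.ne')).div_const _
        have e3 : α * (x + τ) ^ (α - 1) / Real.Gamma (α + 1)
            = (x + τ) ^ (α - 1) / Real.Gamma α := by
          rw [Real.Gamma_add_one hα.ne']; field_simp
        rw [e3] at e2
        refine e2.congr_of_eventuallyEq ?_
        filter_upwards [Ioi_mem_nhds hz] with y hy
        exact tpow_of_nonneg (le_of_lt hy)
      simpa using e1.comp_const_add x τ
    have d1 : HasDerivAt (fun τ => tpow (α + 1) (x + τ)) (tpow α (x + τ)) τ := by
      simpa using (hasDerivAt_tpow hα (x + τ)).comp_const_add x τ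
    have d2 : HasDerivAt (fun τ => tpow (α + 1 + 1) (x + τ)) (tpow (α + 1) (x + τ)) τ := by
      simpa using (hasDerivAt_tpow (p := α + 1) (by linarith) (x + τ)).comp_const_add x τ
    have p1 : HasDerivAt (fun τ : ℝ => τ * (κ - τ) / 2) ((κ - 2 * τ) / 2) τ := by
      have := ((hasDerivAt_id' τ).fun_mul ((hasDerivAt_id' τ).const_sub κ)).div_const 2
      exact this.congr_deriv (by ring)
    have p2 : HasDerivAt (fun τ : ℝ => (κ - 2 * τ) / 2) (-1) τ := by
      have := (((hasDerivAt_id' τ).const_mul 2).const_sub κ).div_const 2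
      exact this.congr_deriv (by ring)
    exact (((d0.fun_mul p1).fun_sub (d1.fun_mul p2)).fun_sub d2).congr_deriv (by ring)
  have h := intervalIntegral.integral_eq_sub_of_hasDerivAt_of_le hκ hcont.continuousOn hd
    (intervalIntegrable_shift_kernel hα x 0 κ (continuous_bump κ))
  rw [trapErr, h]
  simp only [hP, add_zero]
  have : α + 1 + 1 = α + 2 := by ring
  rw [this]
  ring

lemma trapErr_le (hα : 0 < α) (hx : 0 ≤ x) (hκ : 0 ≤ κ) :
    trapErr α x κ ≤ κ ^ 2 * (tpow α (x + κ) - tpow α x) := by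
  have h1 := integral_shift_kernel hα (x := x) (a := 0) (by linarith) hκ
  rw [add_zero] at h1
  rw [← h1, ← intervalIntegral.integral_const_mul]
  have hi := intervalIntegrable_shift_kernel hα x 0 κ (continuous_const (y := κ ^ 2))
  refine intervalIntegral.integral_mono_on hκ
    (intervalIntegrable_shift_kernel hα x 0 κ (continuous_bump κ))
    (by simpa only [mul_comm] using hi) fun τ hτ => ?_
  rw [mul_comm (κ ^ 2)]
  refine mul_le_mul_of_nonneg_left ?_ (kernel_nonneg hα (by linarith [hτ.1]))
  nlinarith [hτ.1, hτ.2]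

lemma trapErr_anti (hα : α ∈ Ioo (0 : ℝ) 1) (hx : 0 ≤ x) (hxy : x ≤ y) (hκ : 0 ≤ κ) :
    trapErr α y κ ≤ trapErr α x κ := by
  refine intervalIntegral.integral_mono_on_of_le_Ioo hκ
    (intervalIntegrable_shift_kernel hα.1 y 0 κ (continuous_bump κ))
    (intervalIntegrable_shift_kernel hα.1 x 0 κ (continuous_bump κ)) fun τ hτ => ?_
  refine mul_le_mul_of_nonneg_right (kernel_anti hα (by linarith [hτ.1]) (by linarith)) ?_
  nlinarith [hτ.1, hτ.2]

/-- On (0, κ) the two bumps differ by (κ' - κ)τ/2, and on (κ, κ') the new bump is at most (κ' -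
κ)κ'/2. -/
lemma trapErr_sub_width (hα : 0 < α) (hy : 0 ≤ y) (hκ : 0 ≤ κ) (hκκ : κ ≤ κ') :
    |trapErr α y κ' - trapErr α y κ|
      ≤ (κ' - κ) * κ' * (tpow α (y + κ') - tpow α y) := by
  have hi := fun a b => intervalIntegrable_shift_kernel hα y a b (continuous_bump κ')
  have hi' := fun a b => intervalIntegrable_shift_kernel hα y a b (continuous_bump κ)
  have h1 := fun a b => intervalIntegrable_shift_kernel hα y a b
    (continuous_const (y := (κ' - κ) * κ'))
  have e1 : trapErr α y κ' - trapErr α y κ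
      = (∫ τ in (0 : ℝ)..κ, ((y + τ) ^ (α - 1) / Real.Gamma α * (τ * (κ' - τ) / 2)
          - (y + τ) ^ (α - 1) / Real.Gamma α * (τ * (κ - τ) / 2)))
        + ∫ τ in κ..κ', (y + τ) ^ (α - 1) / Real.Gamma α * (τ * (κ' - τ) / 2) := by
    rw [intervalIntegral.integral_sub (hi 0 κ) (hi' 0 κ), trapErr, trapErr,
      ← intervalIntegral.integral_add_adjacent_intervals (hi 0 κ) (hi κ κ')]
    ring
  have n1 : 0 ≤ ∫ τ in (0 : ℝ)..κ, ((y + τ) ^ (α - 1) / Real.Gamma α * (τ * (κ' - τ) / 2)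
          - (y + τ) ^ (α - 1) / Real.Gamma α * (τ * (κ - τ) / 2)) := by
    refine intervalIntegral.integral_nonneg hκ fun τ hτ => ?_
    rw [← mul_sub]
    exact mul_nonneg (kernel_nonneg hα (by linarith [hτ.1])) (by nlinarith [hτ.1])
  have n2 : 0 ≤ ∫ τ in κ..κ', (y + τ) ^ (α - 1) / Real.Gamma α * (τ * (κ' - τ) / 2) := by
    refine intervalIntegral.integral_nonneg hκκ fun τ hτ => ?_
    exact mul_nonneg (kernel_nonneg hα (by linarith [hτ.1])) (by nlinarith [hτ.1, hτ.2])
  rw [e1, abs_of_nonneg (add_nonneg n1 n2)]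
  have e2 : (κ' - κ) * κ' * (tpow α (y + κ') - tpow α y)
      = (∫ τ in (0 : ℝ)..κ, (y + τ) ^ (α - 1) / Real.Gamma α * ((κ' - κ) * κ'))
        + ∫ τ in κ..κ', (y + τ) ^ (α - 1) / Real.Gamma α * ((κ' - κ) * κ') := by
    rw [intervalIntegral.integral_add_adjacent_intervals (h1 0 κ) (h1 κ κ'),
      intervalIntegral.integral_mul_const, integral_shift_kernel hα (by linarith) (by linarith),
      add_zero]
    ring
  rw [e2]
  refine add_le_add ?_ ?_
  · refine intervalIntegral.integral_mono_on hκ ((hi 0 κ).sub (hi' 0 κ)) (h1 0 κ) fun τ hτ => ?_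
    rw [← mul_sub]
    refine mul_le_mul_of_nonneg_left ?_ (kernel_nonneg hα (by linarith [hτ.1]))
    have : τ * (κ' - τ) / 2 - τ * (κ - τ) / 2 = (κ' - κ) * (τ / 2) := by ring
    rw [this]
    exact mul_le_mul_of_nonneg_left (by linarith [hτ.1, hτ.2]) (by linarith)
  · refine intervalIntegral.integral_mono_on hκκ (hi κ κ') (h1 κ κ') fun τ hτ => ?_
    refine mul_le_mul_of_nonneg_left ?_ (kernel_nonneg hα (by linarith [hτ.1]))
    have a1 : 0 ≤ κ' - τ := by linarith [hτ.2]
    have a2 : 0 ≤ τ := by linarith [hτ.1]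
    have a3 : τ * (κ' - τ) ≤ κ' * (κ' - κ) :=
      mul_le_mul hτ.2 (by linarith [hτ.1]) a1 (by linarith)
    nlinarith

/-- Since 0 < 1 - α < 1, the ratio of the kernel values is (z/w)^(1-α) ≥ z/w, and 1 - z/w ≤ w/z - 1.
-/
lemma kernel_sub_le (hα : α ∈ Ioo (0 : ℝ) 1) {z w : ℝ} (hz : 0 < z) (hzw : z ≤ w) :
    z ^ (α - 1) / Real.Gamma α - w ^ (α - 1) / Real.Gamma α
      ≤ (w - z) / z * (z ^ (α - 1) / Real.Gamma α) := by
  have hG : 0 < Real.Gamma α := Real.Gamma_pos_of_pos hα.1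
  have hw : 0 < w := by linarith
  have h1 : (z / w) * z ^ (α - 1) ≤ w ^ (α - 1) := by
    have h2 : (z / w) ^ (1 : ℝ) ≤ (z / w) ^ (1 - α) :=
      Real.rpow_le_rpow_of_exponent_ge (by positivity) ((div_le_one hw).2 hzw)
        (by linarith [hα.1])
    rw [Real.rpow_one] at h2
    have h3 : (z / w) ^ (1 - α) * z ^ (α - 1) = w ^ (α - 1) := by
      rw [Real.div_rpow hz.le hw.le, div_mul_eq_mul_div, ← Real.rpow_add hz,
        show (1 - α) + (α - 1) = 0 by ring, Real.rpow_zero, show α - 1 = -(1 - α) by ring,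
        Real.rpow_neg hw.le, one_div]
    rw [← h3]
    exact mul_le_mul_of_nonneg_right h2 (Real.rpow_nonneg hz.le _)
  have h4 : 2 - w / z ≤ z / w := by
    rw [sub_le_iff_le_add, div_add_div _ _ hw.ne' hz.ne', le_div_iff₀ (by positivity)]
    nlinarith [sq_nonneg (z - w)]
  have hzp : 0 ≤ z ^ (α - 1) := Real.rpow_nonneg hz.le _
  have h5 : z ^ (α - 1) - w ^ (α - 1) ≤ (w - z) / z * z ^ (α - 1) := by
    have : (w - z) / z = w / z - 1 := by field_simp
    rw [this]
    nlinarith [mul_le_mul_of_nonneg_right h4 hzp]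
  rw [← sub_div, ← mul_div_assoc]
  exact div_le_div_of_nonneg_right h5 hG.le

/-- The hypothesis gives (y - x)/(x + τ) ≤ ε/κ for all τ > 0, so the kernel loses at most the
fraction ε/κ pointwise. A relative bound remains useful near the singularity. -/
lemma trapErr_sub_shift (hα : α ∈ Ioo (0 : ℝ) 1) (hx : 0 ≤ x) (hxy : x ≤ y) (hκ : 0 < κ) {ε : ℝ}
    (hε : 0 ≤ ε) (h : (y - x) * κ ≤ ε * x) :
    trapErr α x κ - trapErr α y κ ≤ ε / κ * trapErr α x κ := by
  have hi := intervalIntegrable_shift_kernel hα.1 x 0 κ (continuous_bump κ)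
  have hi' := intervalIntegrable_shift_kernel hα.1 y 0 κ (continuous_bump κ)
  unfold trapErr
  rw [← intervalIntegral.integral_sub hi hi', ← intervalIntegral.integral_const_mul]
  refine intervalIntegral.integral_mono_on_of_le_Ioo hκ.le (hi.sub hi') (hi.const_mul _)
    fun τ hτ => ?_
  have hz : 0 < x + τ := by linarith [hτ.1]
  have h1 := kernel_sub_le hα hz (show x + τ ≤ y + τ by linarith)
  have h2 : (y + τ - (x + τ)) / (x + τ) ≤ ε / κ := by
    rw [div_le_div_iff₀ hz hκ]
    nlinarith [hτ.1]
  have h3 := kernel_nonneg hα.1 hz.le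
  have h4 : 0 ≤ τ * (κ - τ) / 2 := by nlinarith [hτ.1, hτ.2]
  rw [← sub_mul, ← mul_assoc]
  exact mul_le_mul_of_nonneg_right (h1.trans (mul_le_mul_of_nonneg_right h2 h3)) h4

lemma trapErr_le_of_pos (hα : α ∈ Ioo (0 : ℝ) 1) (hx : 0 < x) (hκ : 0 ≤ κ) :
    trapErr α x κ ≤ κ ^ 3 * (x ^ (α - 1) / Real.Gamma α) := by
  refine (trapErr_le hα.1 hx.le hκ).trans ?_
  have h1 := integral_shift_kernel hα.1 (x := x) (a := 0) (by linarith) hκ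
  rw [add_zero] at h1
  have h2 : ∫ τ in (0 : ℝ)..κ, (x + τ) ^ (α - 1) / Real.Gamma α
      ≤ ∫ _ in (0 : ℝ)..κ, x ^ (α - 1) / Real.Gamma α := by
    refine intervalIntegral.integral_mono_on hκ ?_ (by simp) fun τ hτ => ?_
    · simpa using intervalIntegrable_shift_kernel hα.1 x 0 κ (continuous_const (y := 1))
    · exact kernel_anti hα hx (by linarith [hτ.1])
  rw [intervalIntegral.integral_const, sub_zero, smul_eq_mul] at h2
  rw [← h1]
  calc _ ≤ κ ^ 2 * (κ * (x ^ (α - 1) / Real.Gamma α)) := by gcongr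
    _ = _ := by ring

/-- Concavity of x^α. -/
lemma tpow_midpoint (hα : α ∈ Ioo (0 : ℝ) 1) (hκ : 0 ≤ κ) (hx : κ ≤ x) :
    tpow α (x + κ) - tpow α x ≤ tpow α x - tpow α (x - κ) := by
  have hG : 0 < Real.Gamma (α + 1) := Real.Gamma_pos_of_pos (by linarith [hα.1])
  have hc := (Real.concaveOn_rpow hα.1.le hα.2.le).2 (show x + κ ∈ Ici 0 by simp; linarith)
    (show x - κ ∈ Ici 0 by simp; linarith) (show (0 : ℝ) ≤ 1 / 2 by norm_num)
    (show (0 : ℝ) ≤ 1 / 2 by norm_num) (by norm_num)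
  simp only [smul_eq_mul] at hc
  rw [show 1 / 2 * (x + κ) + 1 / 2 * (x - κ) = x by ring] at hc
  rw [tpow_of_nonneg (by linarith), tpow_of_nonneg (by linarith), tpow_of_nonneg (by linarith),
    ← sub_div, ← sub_div]
  exact div_le_div_of_nonneg_right (by linarith) hG.le

end

/-! ### Sums of trapezoidal errors over the mesh -/

namespace IsGradedMesh

variable {α T γ Γ cγ k : ℝ} {N : ℕ} {t : ℕ → ℝ}

/-- For n > m, concavity moves the increment of length k_m to the left of t_n - t_m, where it fits
into the step k_n ≥ k_m; the increments then telescope. The term n = m is counted separately, whence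
the factor 2. -/
lemma sum_tpow_le (hm : IsGradedMesh T γ Γ cγ k N t) (hα : α ∈ Ioo (0 : ℝ) 1) {m : ℕ}
    (h2 : 2 ≤ m) (hmN : m ≤ N) :
    ∑ n ∈ Finset.Icc m N, (tpow α (t n - t m + tstep t m) - tpow α (t n - t m))
      ≤ 2 * tpow α T := by
  have key : ∀ n, m ≤ n → n ≤ N →
      ∑ i ∈ Finset.Icc m n, (tpow α (t i - t m + tstep t m) - tpow α (t i - t m))
        ≤ tpow α (tstep t m) + tpow α (t n - t m) := by
    intro n hn
    induction n, hn using Nat.le_induction with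
    | base =>
      intro _
      simp [tpow_of_nonpos hα.1 le_rfl]
    | succ n hn ih =>
      intro hnN
      rw [Finset.sum_Icc_succ_top (by omega)]
      have h1 := ih (by omega)
      have hk0 := hm.tstep_pos (by omega : 1 ≤ m) hmN
      have hk1 := hm.tstep_mono h2 (show m ≤ n + 1 by omega) hnN
      have ht : t (n + 1) - t n = tstep t (n + 1) := by simp [tstep]
      have hmn := hm.mono hn (by omega)
      have h3 := tpow_midpoint hα hk0.le (x := t (n + 1) - t m) (by linarith)
      have h4 := tpow_mono hα.1 (show t n - t m ≤ t (n + 1) - t m - tstep t m by linarith)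
      linarith
  have h1 := key N hmN le_rfl
  have h3 := tpow_mono hα.1 (show tstep t m ≤ T by
    have := hm.le_T hmN
    have := hm.nonneg (show m - 1 ≤ N by omega)
    unfold tstep; linarith)
  have h4 := tpow_mono hα.1 (show t N - t m ≤ T by
    linarith [hm.le_T le_rfl, hm.nonneg hmN])
  linarith

/-- The weights of the sawtooth on the `m`-th interval, up to time `t_n`. -/
lemma sum_trapErr_le (hm : IsGradedMesh T γ Γ cγ k N t) (hα : α ∈ Ioo (0 : ℝ) 1) {m : ℕ}
    (h2 : 2 ≤ m) (hmN : m ≤ N) :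
    ∑ n ∈ Finset.Icc m N, trapErr α (t n - t m) (tstep t m)
      ≤ 2 * tpow α T * tstep t m ^ 2 := by
  have hk0 := hm.tstep_pos (by omega : 1 ≤ m) hmN
  have h1 : ∀ n ∈ Finset.Icc m N, trapErr α (t n - t m) (tstep t m)
      ≤ tstep t m ^ 2 * (tpow α (t n - t m + tstep t m) - tpow α (t n - t m)) := by
    intro n hn
    rw [Finset.mem_Icc] at hn
    exact trapErr_le hα.1 (sub_nonneg.2 (hm.mono hn.1 hn.2)) hk0.le
  refine (Finset.sum_le_sum h1).trans ?_
  rw [← Finset.mul_sum]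
  nlinarith [hm.sum_tpow_le hα h2 hmN, sq_nonneg (tstep t m)]

/-- As long as the nodes stay within a factor 2 of t_(m-1), the bounds on the single increments are
comparable, with factor 2 because 1 - 2/γ < 1. -/
lemma step_growth_le (hm : IsGradedMesh T γ Γ cγ k N t) (hΓ : 1 ≤ Γ) (hk : 0 < k) (hγ : 1 ≤ γ)
    {m n : ℕ} (h3 : 3 ≤ m) (hmn : m ≤ n) (hn : n ≤ N) (hnear : t (n - 1) ≤ 2 * t (m - 1)) :
    tstep t n - tstep t m
      ≤ (n - m : ℕ) * (2 * (Γ * k ^ 2 * t (m - 1) ^ (1 - 2 / γ))) := by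
  induction n, hmn using Nat.le_induction with
  | base => simp
  | succ n hmn ih =>
    have h1 := ih (by omega) ((hm.mono (by omega) (by omega)).trans hnear)
    have h4 := hm.step_diff_le n (by omega) hn
    rw [Nat.add_sub_cancel] at hnear
    have hpos := hm.pos (show 1 ≤ m - 1 by omega) (by omega)
    have h5 : t n ^ (1 - 2 / γ) ≤ 2 * t (m - 1) ^ (1 - 2 / γ) := by
      have hle : t (m - 1) ≤ t n := hm.mono (by omega) (by omega)
      rcases le_total (1 - 2 / γ) 0 with hp | hp
      · have := Real.rpow_le_rpow_of_nonpos hpos hle hp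
        have := Real.rpow_nonneg hpos.le (1 - 2 / γ)
        linarith
      · have h6 := Real.rpow_le_rpow (hpos.le.trans hle) hnear hp
        rw [Real.mul_rpow (by norm_num) hpos.le] at h6
        refine h6.trans (mul_le_mul_of_nonneg_right ?_ (Real.rpow_nonneg hpos.le _))
        calc (2 : ℝ) ^ (1 - 2 / γ) ≤ 2 ^ (1 : ℝ) :=
              Real.rpow_le_rpow_of_exponent_le (by norm_num) (by
                have : 0 < 2 / γ := by positivity
                linarith)
          _ = 2 := by norm_num
    have h6 : Γ * k ^ 2 * t n ^ (1 - 2 / γ) ≤ 2 * (Γ * k ^ 2 * t (m - 1) ^ (1 - 2 / γ)) := by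
      have : 0 ≤ Γ * k ^ 2 := by positivity
      nlinarith
    rw [Nat.succ_sub hmn]
    push_cast
    linarith

/-- The variation along the diagonals of the weights of the sawtooths. -/
lemma sum_abs_trapErr_sub_le (hm : IsGradedMesh T γ Γ cγ k N t) (hα : α ∈ Ioo (0 : ℝ) 1)
    (hΓ : 1 ≤ Γ) (hk : 0 < k) (hγ : 1 ≤ γ) {m : ℕ} (h3 : 3 ≤ m) (hmN : m ≤ N) :
    ∑ n ∈ Finset.Icc m N, |trapErr α (t n - t m) (tstep t m)
        - trapErr α (t (n - 1) - t (m - 1)) (tstep t (m - 1))|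
      ≤ 6 * tpow α T * (Γ * k ^ 2 * t (m - 1) ^ (1 - 2 / γ)) * tstep t m
        + tstep t (m - 1) ^ 3 * (t (m - 1) ^ (α - 1) / Real.Gamma α) := by
  set ε := Γ * k ^ 2 * t (m - 1) ^ (1 - 2 / γ) with hε
  set κ' := tstep t m with hκ'
  set κ := tstep t (m - 1) with hκ
  have hpos := hm.pos (show 1 ≤ m - 1 by omega) (by omega)
  have hε0 : 0 ≤ ε := by positivity
  have hκ0 : 0 < κ := hm.tstep_pos (by omega) (by omega)
  have hκκ : κ ≤ κ' := hm.tstep_mono (by omega) (by omega) hmN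
  have hδ : κ' - κ ≤ ε := by
    have := hm.step_diff_le (m - 1) (by omega) (by omega)
    rwa [Nat.sub_add_cancel (by omega)] at this
  have hBT : 0 ≤ tpow α T := tpow_nonneg hα.1 T
  -- the two parts of the difference
  have hxy : ∀ n, m ≤ n → n ≤ N → t (n - 1) - t (m - 1) ≤ t n - t m := by
    intro n hn hnN
    have := hm.tstep_mono (by omega : 2 ≤ m) hn hnN
    unfold tstep at this
    linarith
  have hy0 : ∀ n, m ≤ n → n ≤ N → 0 ≤ t n - t m := fun n hn hnN =>
    sub_nonneg.2 (hm.mono hn hnN)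
  have hx0 : ∀ n, m ≤ n → n ≤ N → 0 ≤ t (n - 1) - t (m - 1) := fun n hn hnN =>
    sub_nonneg.2 (hm.mono (by omega) (by omega))
  -- One diagonal step changes the weight by widening the cell from κ to κ' and by moving it away
  -- from the singularity, by k_n - k_m ≥ 0. The second effect has a sign.
  have hsplit : ∀ n ∈ Finset.Icc m N,
      |trapErr α (t n - t m) κ' - trapErr α (t (n - 1) - t (m - 1)) κ|
        ≤ (κ' - κ) * κ' * (tpow α (t n - t m + κ') - tpow α (t n - t m))
          + (trapErr α (t (n - 1) - t (m - 1)) κ - trapErr α (t n - t m) κ) := by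
    intro n hn
    rw [Finset.mem_Icc] at hn
    have h1 := trapErr_sub_width hα.1 (hy0 n hn.1 hn.2) hκ0.le hκκ
    have h4 := trapErr_anti hα (hx0 n hn.1 hn.2) (hxy n hn.1 hn.2) hκ0.le
    refine (abs_sub_le _ (trapErr α (t n - t m) κ) _).trans (add_le_add h1 ?_)
    rw [abs_sub_comm, abs_of_nonneg (sub_nonneg.2 h4)]
  have hpart1 : ∑ n ∈ Finset.Icc m N,
      (κ' - κ) * κ' * (tpow α (t n - t m + κ') - tpow α (t n - t m))
        ≤ 2 * tpow α T * ε * κ' := by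
    rw [← Finset.mul_sum]
    have h1 := hm.sum_tpow_le hα (by omega : 2 ≤ m) hmN
    calc (κ' - κ) * κ' * _ ≤ (κ' - κ) * κ' * (2 * tpow α T) :=
          mul_le_mul_of_nonneg_left h1 (mul_nonneg (by linarith) (by linarith))
      _ ≤ ε * κ' * (2 * tpow α T) := by
          have : (κ' - κ) * κ' ≤ ε * κ' := mul_le_mul_of_nonneg_right hδ (by linarith)
          exact mul_le_mul_of_nonneg_right this (by linarith)
      _ = _ := by ring
  -- near and far contributions
  set G : ℕ → ℝ := fun n => trapErr α (t (n - 1) - t (m - 1)) κ with hG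
  set F : ℕ → ℝ := fun n =>
    if t (n - 1) ≤ 2 * t (m - 1) then 0 else κ ^ 3 * (t (m - 1) ^ (α - 1) / Real.Gamma α) with hF
  have hker : 0 ≤ κ ^ 3 * (t (m - 1) ^ (α - 1) / Real.Gamma α) :=
    mul_nonneg (by positivity) (kernel_nonneg hα.1 hpos.le)
  have hGF : ∀ n, m ≤ n → n ≤ N → ¬ t (n - 1) ≤ 2 * t (m - 1) →
      G n ≤ κ ^ 3 * (t (m - 1) ^ (α - 1) / Real.Gamma α) := by
    intro n hn hnN hfar
    push Not at hfar
    refine (trapErr_le_of_pos hα (by linarith : 0 < t (n - 1) - t (m - 1)) hκ0.le).trans ?_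
    exact mul_le_mul_of_nonneg_left (kernel_anti hα hpos (by linarith)) (by positivity)
  -- The shift k_n - k_m is at most 2ε(n - m), while the distance to the singularity is at least (n
  -- - m)κ: the relative shift is at most 2ε/κ, uniformly in n.
  have hnear : ∀ n, m ≤ n → n ≤ N → t (n - 1) ≤ 2 * t (m - 1) →
      G n - trapErr α (t n - t m) κ
        ≤ 2 * ε * κ * (tpow α (t (n - 1) - t (m - 1) + κ) - tpow α (t (n - 1) - t (m - 1))) := by
    intro n hn hnN hnear
    have h1 := hm.step_growth_le hΓ hk hγ h3 hn hnN hnear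
    have h4 : ((n - m : ℕ) : ℝ) * κ ≤ t (n - 1) - t (m - 1) := by
      clear hnear h1
      induction n, hn using Nat.le_induction with
      | base => simp
      | succ n hn ih =>
        have h5 := ih (by omega)
        have h6 := hm.tstep_mono (by omega : 2 ≤ m - 1) (by omega : m - 1 ≤ n) (by omega)
        rw [Nat.succ_sub hn]
        have h7 : t n - t (n - 1) = tstep t n := rfl
        push_cast
        linarith
    have h5 := trapErr_sub_shift hα (hx0 n hn hnN) (hxy n hn hnN) hκ0 (ε := 2 * ε)
      (by positivity) (by
        have h6 : t n - t m - (t (n - 1) - t (m - 1)) = tstep t n - tstep t m := by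
          unfold tstep; ring
        rw [h6]
        calc (tstep t n - tstep t m) * κ ≤ ((n - m : ℕ) * (2 * ε)) * κ := by
              exact mul_le_mul_of_nonneg_right h1 hκ0.le
          _ = 2 * ε * ((n - m : ℕ) * κ) := by ring
          _ ≤ _ := mul_le_mul_of_nonneg_left h4 (by positivity))
    refine h5.trans ?_
    have h6 := trapErr_le hα.1 (hx0 n hn hnN) hκ0.le
    calc _ ≤ 2 * ε / κ * (κ ^ 2 * (tpow α (t (n - 1) - t (m - 1) + κ)
          - tpow α (t (n - 1) - t (m - 1)))) := by gcongr
      _ = _ := by field_simp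
  have hinc : ∀ n, 0 ≤ tpow α (t (n - 1) - t (m - 1) + κ) - tpow α (t (n - 1) - t (m - 1)) :=
    fun n => sub_nonneg.2 (tpow_mono hα.1 (by linarith))
  have hstep : ∀ n, m ≤ n → n + 1 ≤ N → G (n + 1) ≤ trapErr α (t n - t m) κ := by
    intro n hn hnN
    simp only [hG, Nat.add_sub_cancel]
    exact trapErr_anti hα (hy0 n hn (by omega))
      (by linarith [hm.mono (show m - 1 ≤ m by omega) hmN]) hκ0.le
  -- Far terms telescope: by `hstep` each G(n + 1) is absorbed by the weight subtracted at index n.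
  -- Only the first far G remains, and it is small by `hGF`. The induction starts with a near term.
  have hpart2 : ∀ n, m ≤ n → n ≤ N →
      ∑ i ∈ Finset.Icc m n, (G i - trapErr α (t i - t m) κ)
        ≤ ∑ i ∈ Finset.Icc m n, 2 * ε * κ * (tpow α (t (i - 1) - t (m - 1) + κ)
            - tpow α (t (i - 1) - t (m - 1)))
          + (F n - if t (n - 1) ≤ 2 * t (m - 1) then 0 else trapErr α (t n - t m) κ) := by
    intro n hn
    induction n, hn using Nat.le_induction with
    | base =>
      intro _
      have hc : t (m - 1) ≤ 2 * t (m - 1) := by linarith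
      simp only [Finset.Icc_self, Finset.sum_singleton, hF, if_pos hc, sub_zero, add_zero]
      exact hnear m le_rfl hmN hc
    | succ n hn ih =>
      intro hnN
      rw [Finset.sum_Icc_succ_top (by omega), Finset.sum_Icc_succ_top (by omega)]
      have h1 := ih (by omega)
      have hpos' := mul_nonneg (show 0 ≤ 2 * ε * κ by positivity) (hinc (n + 1))
      have hmono : t (n - 1) ≤ t n := hm.mono (by omega) (by omega)
      by_cases hc : t (n + 1 - 1) ≤ 2 * t (m - 1)
      · have h4 := hnear (n + 1) (by omega) hnN hc
        have hc' : t (n - 1) ≤ 2 * t (m - 1) := hmono.trans hc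
        simp only [hF, if_pos hc, if_pos hc'] at h1 ⊢
        linarith
      · have h4 := hGF (n + 1) (by omega) hnN hc
        have h5 := hstep n hn hnN
        simp only [hF, if_neg hc] at h1 ⊢
        split_ifs at h1 <;> linarith
  have h4 := hpart2 N hmN le_rfl
  have h5 : F N - (if t (N - 1) ≤ 2 * t (m - 1) then 0 else trapErr α (t N - t m) κ)
      ≤ κ ^ 3 * (t (m - 1) ^ (α - 1) / Real.Gamma α) := by
    have := trapErr_nonneg hα.1 (hy0 N hmN le_rfl) hκ0.le
    simp only [hF]
    split_ifs <;> linarith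
  have h6 : ∑ i ∈ Finset.Icc m N, (tpow α (t (i - 1) - t (m - 1) + κ)
      - tpow α (t (i - 1) - t (m - 1))) ≤ 2 * tpow α T := by
    have h7 := hm.sum_tpow_le hα (by omega : 2 ≤ m - 1) (by omega)
    refine le_trans ?_ h7
    have h8 : ∑ i ∈ Finset.Icc m N, (tpow α (t (i - 1) - t (m - 1) + κ)
        - tpow α (t (i - 1) - t (m - 1)))
        = ∑ i ∈ Finset.Icc (m - 1) (N - 1), (tpow α (t i - t (m - 1) + κ)
          - tpow α (t i - t (m - 1))) := by
      refine Finset.sum_nbij' (fun i => i - 1) (fun i => i + 1) ?_ ?_ ?_ ?_ ?_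
      · intro i hi; simp only [Finset.mem_Icc] at *; omega
      · intro i hi; simp only [Finset.mem_Icc] at *; omega
      · intro i hi; simp only [Finset.mem_Icc] at *; omega
      · intro i hi; simp
      · intro i hi; rfl
    rw [h8]
    refine Finset.sum_le_sum_of_subset_of_nonneg
      (Finset.Icc_subset_Icc_right (Nat.sub_le N 1)) fun i _ _ => ?_
    exact sub_nonneg.2 (tpow_mono hα.1 (by linarith))
  rw [← Finset.mul_sum] at h4
  have h9 : 2 * ε * κ * ∑ i ∈ Finset.Icc m N, (tpow α (t (i - 1) - t (m - 1) + κ)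
      - tpow α (t (i - 1) - t (m - 1))) ≤ 4 * tpow α T * ε * κ' := by
    calc _ ≤ 2 * ε * κ * (2 * tpow α T) := by gcongr
      _ = 4 * tpow α T * ε * κ := by ring
      _ ≤ _ := by gcongr
  have h10 := Finset.sum_le_sum hsplit
  rw [Finset.sum_add_distrib] at h10
  linarith

end IsGradedMesh

/-! ### Positivity of the discrete fractional integral -/

/-- This is tanh(κ/2) ≤ κ/2; it makes the diagonal weight r - 1 + κ large enough in `exp_step_le`.
-/
lemma two_mul_one_sub_exp_le {κ : ℝ} (hκ : 0 ≤ κ) :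
    2 * (1 - Real.exp (-κ)) ≤ κ * (1 + Real.exp (-κ)) := by
  set F : ℝ → ℝ := fun x => x * (1 + Real.exp (-x)) - 2 * (1 - Real.exp (-x)) with hF
  have hd : ∀ x, HasDerivAt F (1 - Real.exp (-x) * (1 + x)) x := by
    intro x
    have h1 : HasDerivAt (fun x : ℝ => Real.exp (-x)) (-Real.exp (-x)) x := by
      simpa using (hasDerivAt_neg x).exp
    have h2 := ((hasDerivAt_id' x).fun_mul (h1.const_add 1)).fun_sub
      ((h1.const_sub 1).const_mul 2)
    exact h2.congr_deriv (by ring)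
  have hmono : Monotone F := by
    refine monotone_of_deriv_nonneg (fun x => (hd x).differentiableAt) fun x => ?_
    rw [(hd x).deriv]
    have h1 := Real.add_one_le_exp x
    have h2 : Real.exp (-x) * Real.exp x = 1 := by rw [← Real.exp_add]; simp
    nlinarith [Real.exp_pos (-x)]
  have := hmono hκ
  simp only [hF] at this
  simp at this
  linarith

/-- The truncated second-order remainder of `exp (-z)`. -/
noncomputable def expRem (z : ℝ) : ℝ := Real.exp (-max z 0) - 1 + max z 0

lemma expRem_nonneg (z : ℝ) : 0 ≤ expRem z := by
  unfold expRem
  linarith [Real.add_one_le_exp (-max z 0)]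

lemma expRem_of_nonneg {z : ℝ} (hz : 0 ≤ z) : expRem z = Real.exp (-z) - 1 + z := by
  rw [expRem, max_eq_left hz]

lemma expRem_of_nonpos {z : ℝ} (hz : z ≤ 0) : expRem z = 0 := by
  simp [expRem, max_eq_right hz]

lemma continuous_expRem : Continuous expRem := by
  unfold expRem
  fun_prop

lemma expRem_le_self {z : ℝ} (hz : 0 ≤ z) : expRem z ≤ z := by
  rw [expRem_of_nonneg hz]
  have : Real.exp (-z) ≤ 1 := Real.exp_le_one_iff.2 (by linarith)
  linarith

lemma expRem_le_sq {z : ℝ} (hz : 0 ≤ z) : expRem z ≤ z ^ 2 := by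
  rw [expRem_of_nonneg hz]
  have h1 := Real.add_one_le_exp z
  have h2 : Real.exp (-z) * Real.exp z = 1 := by rw [← Real.exp_add]; simp
  have h3 := Real.exp_pos (-z)
  nlinarith

/-- For x > 0, the quadratic bound gives l^(-α) near 0, and the linear bound gives l^(-α-1) at
infinity. -/
lemma integrableOn_expRem {α : ℝ} (hα : α ∈ Ioo (0 : ℝ) 1) (x : ℝ) :
    MeasureTheory.IntegrableOn (fun l : ℝ => expRem (l * x) * l ^ (-α - 2)) (Ioi 0) := by
  rcases le_or_gt x 0 with hx | hx
  · refine MeasureTheory.integrableOn_zero.congr_fun (fun l hl => ?_) measurableSet_Ioi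
    simp only [mem_Ioi] at hl
    simp only [expRem_of_nonpos (mul_nonpos_of_nonneg_of_nonpos hl.le hx), zero_mul]
  have hmeas : Measurable (fun l : ℝ => expRem (l * x) * l ^ (-α - 2)) :=
    (continuous_expRem.measurable.comp (measurable_id.mul_const x)).mul (by fun_prop)
  rw [← Ioc_union_Ioi_eq_Ioi (zero_le_one' ℝ)]
  refine MeasureTheory.IntegrableOn.union ?_ ?_
  · have h1 : MeasureTheory.IntegrableOn (fun l : ℝ => x ^ 2 * l ^ (-α)) (Ioc 0 1) := by
      rw [← intervalIntegrable_iff_integrableOn_Ioc_of_le zero_le_one]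
      exact (intervalIntegral.intervalIntegrable_rpow' (by linarith [hα.2])).const_mul _
    refine h1.mono' hmeas.aestronglyMeasurable ?_
    refine (MeasureTheory.ae_restrict_iff' measurableSet_Ioc).2 (Filter.Eventually.of_forall ?_)
    intro l hl
    have hl0 : 0 ≤ l ^ (-α - 2) := Real.rpow_nonneg hl.1.le _
    rw [Real.norm_of_nonneg (mul_nonneg (expRem_nonneg _) hl0)]
    have h2 := expRem_le_sq (mul_pos hl.1 hx).le
    have h3 : l ^ (-α) = l ^ 2 * l ^ (-α - 2) := by
      rw [← Real.rpow_natCast, ← Real.rpow_add hl.1]; congr 1; push_cast; ring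
    rw [h3]
    nlinarith
  · have h1 : MeasureTheory.IntegrableOn (fun l : ℝ => x * l ^ (-α - 1)) (Ioi 1) :=
      (integrableOn_Ioi_rpow_of_lt (by linarith [hα.1]) one_pos).const_mul _
    refine h1.mono' hmeas.aestronglyMeasurable ?_
    refine (MeasureTheory.ae_restrict_iff' measurableSet_Ioi).2 (Filter.Eventually.of_forall ?_)
    intro l hl
    have hlp : 0 < l := one_pos.trans hl
    have hl0 : 0 ≤ l ^ (-α - 2) := Real.rpow_nonneg hlp.le _
    rw [Real.norm_of_nonneg (mul_nonneg (expRem_nonneg _) hl0)]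
    have h2 := expRem_le_self (mul_pos hlp hx).le
    have h3 : l ^ (-α - 1) = l * l ^ (-α - 2) := by
      rw [← Real.rpow_one_add' hlp.le (by linarith [hα.1])]; congr 1; ring
    rw [h3]
    nlinarith

/-- The twice integrated Abel kernel is a positive superposition of exponential remainders. -/
lemma exists_tpow_eq_integral {α : ℝ} (hα : α ∈ Ioo (0 : ℝ) 1) :
    ∃ c : ℝ, 0 < c ∧ ∀ x : ℝ,
      tpow (α + 1) x = c * ∫ l in Ioi (0 : ℝ), expRem (l * x) * l ^ (-α - 2) := by
  set K := ∫ l in Ioi (0 : ℝ), expRem (l * 1) * l ^ (-α - 2) with hK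
  have hK0 : 0 < K := by
    rw [hK, MeasureTheory.setIntegral_pos_iff_support_of_nonneg_ae]
    · have : Ioi (0 : ℝ) ⊆ Function.support (fun l : ℝ => expRem (l * 1) * l ^ (-α - 2)) := by
        intro l hl
        have hl' : (0 : ℝ) < l := hl
        have h1 : 0 < expRem (l * 1) := by
          rw [mul_one, expRem_of_nonneg hl'.le]
          linarith [Real.add_one_lt_exp (show -l ≠ 0 by linarith)]
        exact (mul_pos h1 (Real.rpow_pos_of_pos hl' _)).ne'
      rw [inter_eq_self_of_subset_right this]
      simp
    · refine (MeasureTheory.ae_restrict_iff' measurableSet_Ioi).2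
        (Filter.Eventually.of_forall fun l hl => ?_)
      exact mul_nonneg (expRem_nonneg _) (Real.rpow_nonneg (le_of_lt hl) _)
    · exact integrableOn_expRem hα 1
  have hG : 0 < Real.Gamma (α + 1 + 1) := Real.Gamma_pos_of_pos (by linarith [hα.1])
  refine ⟨1 / (Real.Gamma (α + 1 + 1) * K), by positivity, fun x => ?_⟩
  rcases le_or_gt x 0 with hx | hx
  · rw [tpow_of_nonpos (by linarith [hα.1]) hx]
    rw [MeasureTheory.setIntegral_congr_fun (g := fun _ => 0) measurableSet_Ioi
      fun l hl => by
        simp only [mem_Ioi] at hl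
        simp only [expRem_of_nonpos (mul_nonpos_of_nonneg_of_nonpos hl.le hx), zero_mul]]
    simp
  · have h1 := MeasureTheory.integral_comp_mul_left_Ioi
      (fun l : ℝ => expRem (l * 1) * l ^ (-α - 2)) 0 hx
    rw [mul_zero, ← hK, smul_eq_mul] at h1
    have h2 : ∫ l in Ioi (0 : ℝ), expRem (x * l * 1) * (x * l) ^ (-α - 2)
        = x ^ (-α - 2) * ∫ l in Ioi (0 : ℝ), expRem (l * x) * l ^ (-α - 2) := by
      rw [← MeasureTheory.integral_const_mul]
      refine MeasureTheory.setIntegral_congr_fun measurableSet_Ioi fun l hl => ?_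
      rw [Real.mul_rpow hx.le (le_of_lt hl), mul_one, mul_comm x l]
      ring
    rw [h2] at h1
    rw [tpow_of_nonneg hx.le]
    have h3 : x ^ (-α - 2) * x ^ (α + 1) = x⁻¹ := by
      rw [← Real.rpow_add hx, ← Real.rpow_neg_one]; congr 1; ring
    have h4 : x ^ (α + 1) * x ^ (-α - 2) * x = 1 := by
      rw [mul_comm (x ^ (α + 1)), h3, inv_mul_cancel₀ hx.ne']
    have h5 : (∫ l in Ioi (0 : ℝ), expRem (l * x) * l ^ (-α - 2)) = x ^ (α + 1) * K := by
      have h6 : x ^ (-α - 2) ≠ 0 := (Real.rpow_pos_of_pos hx _).ne'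
      apply mul_left_cancel₀ h6
      rw [h1, ← mul_assoc, h3]
    rw [h5]
    field_simp

/-- The second difference of a kernel primitive `F` over the mesh cells `m` and `n`. -/
def cellDiff (F : ℝ → ℝ) (t : ℕ → ℝ) (n m : ℕ) : ℝ :=
  (F (t n - t (m - 1)) - F (t n - t m)) - (F (t (n - 1) - t (m - 1)) - F (t (n - 1) - t m))

/-- One step of the energy balance: y is the decaying state, r the decay factor, ψ the new value,
and the right side is the new row of the quadratic form. With κ replaced by its lower bound 2(1 -
r)/(1 + r), the defect is a nonnegative multiple of a square. -/
lemma exp_step_le {r κ y ψ : ℝ} (hr0 : 0 ≤ r) (hr1 : r ≤ 1)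
    (hκ : 2 * (1 - r) ≤ κ * (1 + r)) :
    1 / 2 * (r * y + ψ * (1 - r)) ^ 2 - 1 / 2 * y ^ 2
      ≤ ψ * ((1 - r) * y) + ψ ^ 2 * (r - 1 + κ) := by
  have h1 : 2 * (1 - r) / (1 + r) ≤ κ := by rwa [div_le_iff₀ (by linarith)]
  have h2 : ψ * ((1 - r) * y) + ψ ^ 2 * (r - 1 + 2 * (1 - r) / (1 + r))
      - (1 / 2 * (r * y + ψ * (1 - r)) ^ 2 - 1 / 2 * y ^ 2)
      = 1 / 2 * (1 - r) / (1 + r) * ((1 + r) * y + (1 - r) * ψ) ^ 2 := by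
    have : 1 + r ≠ 0 := by linarith
    field_simp
    ring
  have h3 : 0 ≤ 1 / 2 * (1 - r) / (1 + r) * ((1 + r) * y + (1 - r) * ψ) ^ 2 :=
    mul_nonneg (div_nonneg (by linarith) (by linarith)) (sq_nonneg _)
  nlinarith [mul_le_mul_of_nonneg_left h1 (sq_nonneg ψ)]

/-- For one exponential the history enters only through the state e^(-s_n) z_n, which obeys a scalar
recursion; the partial sums of the form dominate half its square. -/
lemma sum_cellDiff_expRem_nonneg {N : ℕ} {s : ℕ → ℝ} (hs : ∀ i j, i ≤ j → j ≤ N → s i ≤ s j)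
    (φ : ℕ → ℝ) :
    0 ≤ ∑ n ∈ Finset.Icc 1 N, ∑ m ∈ Finset.Icc 1 n, cellDiff expRem s n m * φ m * φ n := by
  set z : ℕ → ℝ := fun n => ∑ m ∈ Finset.Icc 1 n, φ m * (Real.exp (s m) - Real.exp (s (m - 1)))
    with hz
  have key : ∀ n, n ≤ N → 1 / 2 * (Real.exp (-s n) * z n) ^ 2
      ≤ ∑ i ∈ Finset.Icc 1 n, ∑ m ∈ Finset.Icc 1 i, cellDiff expRem s i m * φ m * φ i := by
    intro n
    induction n with
    | zero => simp [hz]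
    | succ n ih =>
      intro hn
      have h1 := ih (by omega)
      rw [Finset.sum_Icc_succ_top (by omega)]
      set κ := s (n + 1) - s n with hκ
      have hκ0 : 0 ≤ κ := sub_nonneg.2 (hs _ _ (by omega) hn)
      set r := Real.exp (-κ) with hr
      set y := Real.exp (-s n) * z n with hy
      have hr0 : 0 ≤ r := (Real.exp_pos _).le
      have hr1 : r ≤ 1 := Real.exp_le_one_iff.2 (by linarith)
      have hstep := exp_step_le (y := y) (ψ := φ (n + 1)) hr0 hr1 (two_mul_one_sub_exp_le hκ0)
      have hre : Real.exp (-s (n + 1)) = r * Real.exp (-s n) := by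
        rw [hr, ← Real.exp_add]; congr 1; rw [hκ]; ring
      have hzs : z (n + 1) = z n + φ (n + 1) * (Real.exp (s (n + 1)) - Real.exp (s n)) := by
        simp only [hz]
        rw [Finset.sum_Icc_succ_top (by omega), Nat.add_sub_cancel]
      have e1 : Real.exp (-s n) * Real.exp (s n) = 1 := by rw [← Real.exp_add]; simp
      have e2 : Real.exp (-s (n + 1)) * Real.exp (s (n + 1)) = 1 := by
        rw [← Real.exp_add]; simp
      have hynew : Real.exp (-s (n + 1)) * z (n + 1) = r * y + φ (n + 1) * (1 - r) := by
        rw [hzs, mul_add, mul_left_comm, mul_sub, e2, hre, mul_assoc r (Real.exp (-s n)) (z n),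
          mul_assoc r (Real.exp (-s n)) (Real.exp (s n)), e1, mul_one]
      rw [hynew]
      have hdiag : cellDiff expRem s (n + 1) (n + 1) = r - 1 + κ := by
        simp only [cellDiff, Nat.add_sub_cancel, sub_self]
        rw [expRem_of_nonneg hκ0, expRem_of_nonpos le_rfl,
          expRem_of_nonpos (show s n - s (n + 1) ≤ 0 by linarith)]
        ring
      have hoff : ∀ m ∈ Finset.Icc 1 n, cellDiff expRem s (n + 1) m * φ m * φ (n + 1)
          = φ (n + 1) * ((1 - r) * (Real.exp (-s n)
              * (φ m * (Real.exp (s m) - Real.exp (s (m - 1)))))) := by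
        intro m hm
        rw [Finset.mem_Icc] at hm
        have a1 := hs (m - 1) m (by omega) (by omega)
        have a2 := hs m n hm.2 (by omega)
        simp only [cellDiff, Nat.add_sub_cancel]
        rw [expRem_of_nonneg (by linarith), expRem_of_nonneg (by linarith),
          expRem_of_nonneg (by linarith), expRem_of_nonneg (by linarith)]
        have f : ∀ a b : ℝ, Real.exp (-(a - b)) = Real.exp (-a) * Real.exp b := by
          intro a b; rw [← Real.exp_add]; congr 1; ring
        rw [f, f, f, f, hre]
        ring
      rw [Finset.sum_Icc_succ_top (by omega), Finset.sum_congr rfl hoff, hdiag, ← Finset.mul_sum,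
        ← Finset.mul_sum, ← Finset.mul_sum]
      have : φ (n + 1) * ((1 - r) * (Real.exp (-s n) * z n)) = φ (n + 1) * ((1 - r) * y) := rfl
      rw [this]
      linarith
  exact (by positivity : (0 : ℝ) ≤ 1 / 2 * (Real.exp (-s N) * z N) ^ 2).trans (key N le_rfl)

/-- The weights of the product-integration rule form a positive semidefinite matrix. -/
lemma sum_cellDiff_tpow_nonneg {α : ℝ} (hα : α ∈ Ioo (0 : ℝ) 1) {N : ℕ} {t : ℕ → ℝ}
    (ht : ∀ i j, i ≤ j → j ≤ N → t i ≤ t j) (φ : ℕ → ℝ) :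
    0 ≤ ∑ n ∈ Finset.Icc 1 N, ∑ m ∈ Finset.Icc 1 n,
      cellDiff (tpow (α + 1)) t n m * φ m * φ n := by
  obtain ⟨c, hc, h⟩ := exists_tpow_eq_integral hα
  -- The frequency l enters as a dilation of the mesh, so the result for one exponential applies on
  -- the mesh l·t for each l > 0.
  have hcell : ∀ n m, cellDiff (tpow (α + 1)) t n m
      = c * ∫ l in Ioi (0 : ℝ), cellDiff expRem (fun i => l * t i) n m * l ^ (-α - 2) := by
    intro n m
    have i1 := fun x => integrableOn_expRem hα x
    have : ∀ l : ℝ, cellDiff expRem (fun i => l * t i) n m * l ^ (-α - 2)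
        = (expRem (l * (t n - t (m - 1))) * l ^ (-α - 2)
            - expRem (l * (t n - t m)) * l ^ (-α - 2))
          - (expRem (l * (t (n - 1) - t (m - 1))) * l ^ (-α - 2)
            - expRem (l * (t (n - 1) - t m)) * l ^ (-α - 2)) := by
      intro l
      simp only [cellDiff, ← mul_sub]
      ring
    simp only [this]
    rw [MeasureTheory.integral_sub
        (f := fun l : ℝ => expRem (l * (t n - t (m - 1))) * l ^ (-α - 2)
            - expRem (l * (t n - t m)) * l ^ (-α - 2))
        (g := fun l : ℝ => expRem (l * (t (n - 1) - t (m - 1))) * l ^ (-α - 2)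
            - expRem (l * (t (n - 1) - t m)) * l ^ (-α - 2))
        ((i1 _).sub (i1 _)) ((i1 _).sub (i1 _)),
      MeasureTheory.integral_sub (i1 _) (i1 _), MeasureTheory.integral_sub (i1 _) (i1 _)]
    simp only [cellDiff, h]
    ring
  have hint : ∀ n m, MeasureTheory.IntegrableOn
      (fun l : ℝ => cellDiff expRem (fun i => l * t i) n m * l ^ (-α - 2)) (Ioi 0) := by
    intro n m
    have i1 := fun x => integrableOn_expRem hα x
    refine (((i1 (t n - t (m - 1))).sub (i1 (t n - t m))).sub
      ((i1 (t (n - 1) - t (m - 1))).sub (i1 (t (n - 1) - t m)))).congr_fun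
      (fun l _ => ?_) measurableSet_Ioi
    simp only [cellDiff, ← mul_sub, Pi.sub_apply]
    ring
  have hrew : ∑ n ∈ Finset.Icc 1 N, ∑ m ∈ Finset.Icc 1 n,
      cellDiff (tpow (α + 1)) t n m * φ m * φ n
      = c * ∫ l in Ioi (0 : ℝ), ∑ n ∈ Finset.Icc 1 N, ∑ m ∈ Finset.Icc 1 n,
          cellDiff expRem (fun i => l * t i) n m * l ^ (-α - 2) * (φ m * φ n) := by
    rw [MeasureTheory.integral_finsetSum _ fun n _ => MeasureTheory.integrable_finsetSum _
      fun m _ => (hint n m).mul_const _, Finset.mul_sum]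
    refine Finset.sum_congr rfl fun n _ => ?_
    rw [MeasureTheory.integral_finsetSum _ fun m _ => (hint n m).mul_const _, Finset.mul_sum]
    refine Finset.sum_congr rfl fun m _ => ?_
    rw [MeasureTheory.integral_mul_const, hcell]
    ring
  rw [hrew]
  refine mul_nonneg hc.le (MeasureTheory.setIntegral_nonneg measurableSet_Ioi fun l hl => ?_)
  have hl' : (0 : ℝ) < l := hl
  have h1 := sum_cellDiff_expRem_nonneg (N := N) (s := fun i => l * t i)
    (fun i j hij hj => mul_le_mul_of_nonneg_left (ht i j hij hj) hl'.le) φ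
  have h2 := mul_nonneg h1 (Real.rpow_nonneg hl'.le (-α - 2))
  rw [Finset.sum_mul] at h2
  refine h2.trans (le_of_eq (Finset.sum_congr rfl fun n _ => ?_))
  rw [Finset.sum_mul]
  refine Finset.sum_congr rfl fun m _ => ?_
  ring

/-! ### The product-integration rule and its error -/

/-- The value on the `m`-th cell of the piecewise constant approximation. -/
noncomputable def cellVal (W : ℕ → ℝ) (m : ℕ) : ℝ := if m = 1 then W 1 else half W m

lemma integral_fracInt_sum {α T : ℝ} (hα : 0 < α) {ι : Type*} (s : Finset ι) {w : ι → ℝ → ℝ}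
    (h : ∀ i ∈ s, BddMeas T (w i)) {x y : ℝ} (hx : 0 ≤ x) (hxy : x ≤ y) (hy : y ≤ T) :
    ∫ r in x..y, fracInt α (fun r => ∑ i ∈ s, w i r) r
      = ∑ i ∈ s, ∫ r in x..y, fracInt α (w i) r := by
  rw [← intervalIntegral.integral_finsetSum fun i hi =>
    (bddMeas_fracInt hα (h i hi)).intervalIntegrable hx hxy hy]
  refine intervalIntegral.integral_congr fun r hr => ?_
  rw [uIcc_of_le hxy] at hr
  exact fracInt_sum hα s h ⟨hx.trans hr.1, hr.2.trans hy⟩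

lemma integral_fracInt_const_mul (α : ℝ) (φ : ℝ → ℝ) (c x y : ℝ) :
    ∫ r in x..y, fracInt α (fun s => c * φ s) r = c * ∫ r in x..y, fracInt α φ r := by
  simp only [fracInt_const_mul]
  rw [intervalIntegral.integral_const_mul]

lemma integral_fracInt_add {α T : ℝ} (hα : 0 < α) {φ ψ : ℝ → ℝ} (h : BddMeas T φ)
    (h' : BddMeas T ψ) {x y : ℝ} (hx : 0 ≤ x) (hxy : x ≤ y) (hy : y ≤ T) :
    ∫ r in x..y, fracInt α (fun s => φ s + ψ s) r
      = (∫ r in x..y, fracInt α φ r) + ∫ r in x..y, fracInt α ψ r := by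
  rw [← intervalIntegral.integral_add
    ((bddMeas_fracInt hα h).intervalIntegrable hx hxy hy)
    ((bddMeas_fracInt hα h').intervalIntegrable hx hxy hy)]
  refine intervalIntegral.integral_congr fun r hr => ?_
  rw [uIcc_of_le hxy] at hr
  exact fracInt_add hα h h' ⟨hx.trans hr.1, hr.2.trans hy⟩

lemma integral_fracInt_mono {α T : ℝ} (hα : 0 < α) {φ ψ : ℝ → ℝ} (h : BddMeas T φ)
    (h' : BddMeas T ψ) {x y : ℝ} (hx : 0 ≤ x) (hxy : x ≤ y) (hy : y ≤ T)
    (hle : ∀ᵐ s, s ∈ Ioc 0 y → φ s ≤ ψ s) :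
    ∫ r in x..y, fracInt α φ r ≤ ∫ r in x..y, fracInt α ψ r := by
  refine intervalIntegral.integral_mono_on hxy
    ((bddMeas_fracInt hα h).intervalIntegrable hx hxy hy)
    ((bddMeas_fracInt hα h').intervalIntegrable hx hxy hy) fun r hr => ?_
  refine fracInt_mono hα h h' ⟨hx.trans hr.1, hr.2.trans hy⟩ ?_
  filter_upwards [hle] with s hs hsr
  exact hs ⟨hsr.1, hsr.2.trans hr.2⟩

/-- The step function with value `κ m` on the `m`-th cell. -/
noncomputable def stepFun (t : ℕ → ℝ) (n : ℕ) (κ : ℕ → ℝ) (s : ℝ) : ℝ :=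
  ∑ m ∈ Finset.Icc 1 n, κ m * (Ioo (t (m - 1)) (t m)).indicator (fun _ => 1) s

lemma pieceConst_eq (t : ℕ → ℝ) (n : ℕ) (W : ℕ → ℝ) :
    pieceConst t n W = stepFun t n (cellVal W) := by
  funext s
  unfold pieceConst stepFun cellVal
  refine Finset.sum_congr rfl fun m _ => ?_
  by_cases h : s ∈ Ioo (t (m - 1)) (t m)
  · simp only [indicator_of_mem h, mul_one]
  · simp only [indicator_of_notMem h, mul_zero]

lemma bddMeas_stepFun (T : ℝ) (t : ℕ → ℝ) (n : ℕ) (κ : ℕ → ℝ) : BddMeas T (stepFun t n κ) :=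
  BddMeas.sum _ fun _ _ => (bddMeas_indicator T measurableSet_Ioo continuous_const).const_mul _

namespace IsGradedMesh

variable {α T γ Γ cγ k : ℝ} {N : ℕ} {t : ℕ → ℝ}

lemma integral_stepFun (hm : IsGradedMesh T γ Γ cγ k N t) (hα : 0 < α) {n : ℕ} (h1 : 1 ≤ n)
    (hn : n ≤ N) (κ : ℕ → ℝ) :
    ∫ s in (t (n - 1))..(t n), fracInt α (stepFun t n κ) s
      = ∑ m ∈ Finset.Icc 1 n, cellDiff (tpow (α + 1)) t n m * κ m := by
  have hx := hm.nonneg (show n - 1 ≤ N by omega)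
  have hxy := hm.mono (show n - 1 ≤ n by omega) hn
  unfold stepFun
  rw [integral_fracInt_sum (T := T) hα _ (fun m _ =>
    (bddMeas_indicator T measurableSet_Ioo continuous_const).const_mul _) hx hxy (hm.le_T hn)]
  refine Finset.sum_congr rfl fun m hmem => ?_
  rw [Finset.mem_Icc] at hmem
  rw [integral_fracInt_const_mul, integral_fracInt_box hα (hm.nonneg (by omega))
    (hm.mono (by omega) (by omega)) hx hxy, cellDiff]
  ring

lemma tstep_mul_discFracInt (hm : IsGradedMesh T γ Γ cγ k N t) (hα : 0 < α) {n : ℕ} (h1 : 1 ≤ n)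
    (hn : n ≤ N) (W : ℕ → ℝ) :
    tstep t n * discFracInt α t W n
      = ∑ m ∈ Finset.Icc 1 n, cellDiff (tpow (α + 1)) t n m * cellVal W m := by
  rw [discFracInt, pieceConst_eq, hm.integral_stepFun hα h1 hn, ← mul_assoc,
    mul_one_div_cancel (hm.tstep_pos h1 hn).ne', one_mul]

lemma cellDiff_nonneg (hm : IsGradedMesh T γ Γ cγ k N t) (hα : 0 < α) {n m : ℕ}
    (hn : n ≤ N) (hmN : m ≤ N) : 0 ≤ cellDiff (tpow (α + 1)) t n m := by
  have h1 := hm.mono (show n - 1 ≤ n by omega) hn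
  have h2 := hm.mono (show m - 1 ≤ m by omega) hmN
  have hi : ∀ c, IntervalIntegrable (fun s => tpow α (s - c)) MeasureTheory.volume
      (t (n - 1)) (t n) := fun c =>
    ((continuous_tpow hα).comp (continuous_id.sub continuous_const)).intervalIntegrable _ _
  have h3 : cellDiff (tpow (α + 1)) t n m
      = ∫ s in (t (n - 1))..(t n), (tpow α (s - t (m - 1)) - tpow α (s - t m)) := by
    rw [intervalIntegral.integral_sub (hi _) (hi _), integral_tpow_sub hα, integral_tpow_sub hα,
      cellDiff]
    ring
  rw [h3]
  exact intervalIntegral.integral_nonneg h1 fun s _ =>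
    sub_nonneg.2 (tpow_mono hα (by linarith))

/-- Column sums telescope in n and leave the integral of `tpow α` over an interval of length k_m. -/
lemma sum_cellDiff_le (hm : IsGradedMesh T γ Γ cγ k N t) (hα : 0 < α) {m : ℕ} (h1 : 1 ≤ m)
    (hmN : m ≤ N) :
    ∑ n ∈ Finset.Icc 1 N, cellDiff (tpow (α + 1)) t n m ≤ tpow α T * tstep t m := by
  have key : ∀ n, n ≤ N → ∑ i ∈ Finset.Icc 1 n, cellDiff (tpow (α + 1)) t i m
      = tpow (α + 1) (t n - t (m - 1)) - tpow (α + 1) (t n - t m) := by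
    intro n
    induction n with
    | zero =>
      intro _
      rw [hm.zero, tpow_of_nonpos (by linarith) (by linarith [hm.nonneg (show m - 1 ≤ N by omega)]),
        tpow_of_nonpos (by linarith) (by linarith [hm.nonneg hmN])]
      simp
    | succ n ih =>
      intro hn
      rw [Finset.sum_Icc_succ_top (by omega), ih (by omega), cellDiff, Nat.add_sub_cancel]
      ring
  rw [key N le_rfl]
  have h2 := hm.mono (show m - 1 ≤ m by omega) hmN
  have h3 := integral_tpow_sub hα (t N - t m) (t N - t (m - 1)) 0
  simp only [sub_zero] at h3
  rw [← h3]
  have h4 : ∫ s in (t N - t m)..(t N - t (m - 1)), tpow α s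
      ≤ ∫ _ in (t N - t m)..(t N - t (m - 1)), tpow α T := by
    refine intervalIntegral.integral_mono_on (by linarith)
      ((continuous_tpow hα).intervalIntegrable _ _) (by simp) fun s hs => ?_
    exact tpow_mono hα (by linarith [hs.2, hm.le_T le_rfl, hm.nonneg (show m - 1 ≤ N by omega)])
  rw [intervalIntegral.integral_const, smul_eq_mul] at h4
  calc _ ≤ _ := h4
    _ = tpow α T * tstep t m := by unfold tstep; ring

/-- A pointwise error κ_m on the m-th cell thus contributes k_m κ_m in total over all time steps, up
to a constant. -/
lemma sum_sum_cellDiff_le (hm : IsGradedMesh T γ Γ cγ k N t) (hα : 0 < α) {κ : ℕ → ℝ}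
    (hκ : ∀ m, 1 ≤ m → m ≤ N → 0 ≤ κ m) :
    ∑ n ∈ Finset.Icc 1 N, ∑ m ∈ Finset.Icc 1 n, cellDiff (tpow (α + 1)) t n m * κ m
      ≤ tpow α T * ∑ m ∈ Finset.Icc 1 N, tstep t m * κ m := by
  have h1 : ∀ n ∈ Finset.Icc 1 N, ∑ m ∈ Finset.Icc 1 n, cellDiff (tpow (α + 1)) t n m * κ m
      ≤ ∑ m ∈ Finset.Icc 1 N, cellDiff (tpow (α + 1)) t n m * κ m := by
    intro n hn
    rw [Finset.mem_Icc] at hn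
    refine Finset.sum_le_sum_of_subset_of_nonneg (Finset.Icc_subset_Icc_right hn.2) ?_
    intro m hmem _
    rw [Finset.mem_Icc] at hmem
    exact mul_nonneg (hm.cellDiff_nonneg hα hn.2 hmem.2) (hκ m hmem.1 hmem.2)
  refine (Finset.sum_le_sum h1).trans ?_
  rw [Finset.sum_comm, Finset.mul_sum]
  refine Finset.sum_le_sum fun m hmem => ?_
  rw [Finset.mem_Icc] at hmem
  rw [← Finset.sum_mul, ← mul_assoc]
  exact mul_le_mul_of_nonneg_right (hm.sum_cellDiff_le hα hmem.1 hmem.2) (hκ m hmem.1 hmem.2)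

/-- Almost every point of `(0, t_n]` lies in the interior of a cell. -/
lemma ae_mem_cell (hm : IsGradedMesh T γ Γ cγ k N t) {n : ℕ} (hn : n ≤ N) :
    ∀ᵐ s, s ∈ Ioc 0 (t n) → ∃ m, 1 ≤ m ∧ m ≤ n ∧ s ∈ Ioo (t (m - 1)) (t m) := by
  have h1 : ∀ᵐ s, ∀ i : ℕ, s ≠ t i :=
    MeasureTheory.ae_all_iff.2 fun i => MeasureTheory.Measure.ae_ne MeasureTheory.volume (t i)
  filter_upwards [h1] with s hs hsn
  induction n with
  | zero => rw [hm.zero] at hsn; simp at hsn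
  | succ n ih =>
    rcases le_or_gt s (t n) with h | h
    · obtain ⟨m, a, b, c⟩ := ih (by omega) ⟨hsn.1, h⟩
      exact ⟨m, a, by omega, c⟩
    · exact ⟨n + 1, by omega, le_rfl, by simpa using ⟨h, lt_of_le_of_ne hsn.2 (hs _)⟩⟩

lemma sum_indicator_cell (hm : IsGradedMesh T γ Γ cγ k N t) {n m : ℕ} (h1 : 1 ≤ m) (hmn : m ≤ n)
    (hn : n ≤ N) {s : ℝ} (hs : s ∈ Ioo (t (m - 1)) (t m)) (g : ℕ → ℝ → ℝ) (S : Finset ℕ)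
    (hS : ∀ i ∈ S, 1 ≤ i ∧ i ≤ n) :
    ∑ i ∈ S, (Ioo (t (i - 1)) (t i)).indicator (g i) s = if m ∈ S then g m s else 0 := by
  have h0 : ∀ i ∈ S, i ≠ m → (Ioo (t (i - 1)) (t i)).indicator (g i) s = 0 := by
    intro i hi hne
    refine indicator_of_notMem (fun hsi => ?_) _
    obtain ⟨a, b⟩ := hS i hi
    rcases lt_or_gt_of_ne hne with h | h
    · have := hm.mono (show i ≤ m - 1 by omega) (by omega)
      linarith [hsi.2, hs.1]
    · have := hm.mono (show m ≤ i - 1 by omega) (by omega)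
      linarith [hsi.1, hs.2]
  split_ifs with hmS
  · rw [Finset.sum_eq_single m h0 (fun h => absurd hmS h), indicator_of_mem hs]
  · exact Finset.sum_eq_zero fun i hi => h0 i hi (fun h => hmS (h ▸ hi))

end IsGradedMesh

/-- The slope of the linear interpolant on the `m`-th cell. -/
noncomputable def cellSlope (t : ℕ → ℝ) (W : ℕ → ℝ) (m : ℕ) : ℝ := (W m - W (m - 1)) / tstep t m

/-- The error of the product-integration rule. -/
noncomputable def ruleErr (α : ℝ) (t : ℕ → ℝ) (φ : ℝ → ℝ) (n : ℕ) : ℝ :=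
  (∑ m ∈ Finset.Icc 1 n, cellDiff (tpow (α + 1)) t n m * cellVal (fun i => φ (t i)) m)
    - ∫ s in (t (n - 1))..(t n), fracInt α φ s

/-- The contribution of the sawtooth components to the error of the rule. -/
noncomputable def sawErr (α : ℝ) (t : ℕ → ℝ) (W : ℕ → ℝ) (n : ℕ) : ℝ :=
  ∑ m ∈ Finset.Icc 2 n, cellSlope t W m *
    (sawPrim α (t (m - 1)) (t m) (t n) - sawPrim α (t (m - 1)) (t m) (t (n - 1)))

namespace IsGradedMesh

variable {α T γ Γ cγ k : ℝ} {N : ℕ} {t : ℕ → ℝ}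

/-- For m ≥ 2 the mean of the end values is the linear interpolant plus the slope times the
sawtooth; the first cell has no sawtooth. What remains is a pointwise error, and the positive kernel
preserves inequalities. A one-sided bound suffices, since it is applied to all pairings, hence also
to -ψ. -/
lemma ruleErr_sub_sawErr_le (hm : IsGradedMesh T γ Γ cγ k N t) (hα : 0 < α) {n : ℕ} (h1 : 1 ≤ n)
    (hn : n ≤ N) {φ : ℝ → ℝ} (hφ : BddMeas T φ) {κ : ℕ → ℝ}
    (hκ1 : ∀ s ∈ Ioo 0 (t 1), φ (t 1) - φ s ≤ κ 1)
    (hκ : ∀ m, 2 ≤ m → m ≤ N → ∀ s ∈ Ioo (t (m - 1)) (t m),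
      φ (t (m - 1)) + cellSlope t (fun i => φ (t i)) m * (s - t (m - 1)) - φ s ≤ κ m) :
    ruleErr α t φ n - sawErr α t (fun i => φ (t i)) n
      ≤ ∑ m ∈ Finset.Icc 1 n, cellDiff (tpow (α + 1)) t n m * κ m := by
  set W : ℕ → ℝ := fun i => φ (t i) with hW
  have hx := hm.nonneg (show n - 1 ≤ N by omega)
  have hxy := hm.mono (show n - 1 ≤ n by omega) hn
  have hy := hm.le_T hn
  set saw : ℝ → ℝ := fun s => ∑ m ∈ Finset.Icc 2 n,
    -cellSlope t W m * sawtooth (t (m - 1)) (t m) s with hsaw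
  have hsb : ∀ m, BddMeas T (sawtooth (t (m - 1)) (t m)) := fun m =>
    bddMeas_indicator T measurableSet_Ioo (continuous_const.sub continuous_id)
  have hsawb : BddMeas T saw := BddMeas.sum _ fun m _ => (hsb m).const_mul _
  have hpc := bddMeas_stepFun T t n (cellVal W)
  have hrw : ruleErr α t φ n - sawErr α t W n
      = ∫ r in (t (n - 1))..(t n),
          fracInt α (fun s => (stepFun t n (cellVal W) s + (-1) * φ s) + saw s) r := by
    rw [integral_fracInt_add hα (hpc.add (hφ.const_mul (-1))) hsawb hx hxy hy,
      integral_fracInt_add hα hpc (hφ.const_mul (-1)) hx hxy hy, integral_fracInt_const_mul,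
      hm.integral_stepFun hα h1 hn, hsaw,
      integral_fracInt_sum hα _ (fun m _ => (hsb m).const_mul _) hx hxy hy]
    have : ∀ m ∈ Finset.Icc 2 n, ∫ r in (t (n - 1))..(t n),
        fracInt α (fun s => -cellSlope t W m * sawtooth (t (m - 1)) (t m) s) r
        = -(cellSlope t W m * (sawPrim α (t (m - 1)) (t m) (t n)
          - sawPrim α (t (m - 1)) (t m) (t (n - 1)))) := by
      intro m hmem
      rw [Finset.mem_Icc] at hmem
      rw [integral_fracInt_const_mul, integral_fracInt_sawtooth hα (hm.nonneg (by omega))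
        (hm.mono (by omega) (by omega)) hx hxy]
      ring
    rw [Finset.sum_congr rfl this, Finset.sum_neg_distrib]
    unfold ruleErr sawErr
    ring
  rw [hrw, ← hm.integral_stepFun hα h1 hn]
  refine integral_fracInt_mono hα ((hpc.add (hφ.const_mul (-1))).add hsawb)
    (bddMeas_stepFun T t n κ) hx hxy hy ?_
  filter_upwards [hm.ae_mem_cell hn] with s hs hsn
  obtain ⟨m, hm1, hmn, hsm⟩ := hs hsn
  have e1 : ∀ c : ℕ → ℝ, stepFun t n c s = c m := by
    intro c
    have := hm.sum_indicator_cell hm1 hmn hn hsm (fun i _ => c i) (Finset.Icc 1 n)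
      (fun i hi => by rwa [Finset.mem_Icc] at hi)
    rw [if_pos (Finset.mem_Icc.2 ⟨hm1, hmn⟩)] at this
    rw [← this]
    unfold stepFun
    refine Finset.sum_congr rfl fun i _ => ?_
    by_cases h : s ∈ Ioo (t (i - 1)) (t i)
    · simp only [indicator_of_mem h, mul_one]
    · simp only [indicator_of_notMem h, mul_zero]
  have e2 : saw s = if m ∈ Finset.Icc 2 n
      then -cellSlope t W m * ((t (m - 1) + t m) / 2 - s) else 0 := by
    rw [← hm.sum_indicator_cell hm1 hmn hn hsm
      (fun i s => -cellSlope t W i * ((t (i - 1) + t i) / 2 - s)) (Finset.Icc 2 n)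
      (fun i hi => by rw [Finset.mem_Icc] at hi; omega)]
    simp only [hsaw, sawtooth]
    refine Finset.sum_congr rfl fun i _ => ?_
    by_cases h : s ∈ Ioo (t (i - 1)) (t i)
    · simp only [indicator_of_mem h]
    · simp only [indicator_of_notMem h, mul_zero]
  rw [e1, e1, e2]
  rcases hm1.eq_or_lt with rfl | hm2
  · have h3 := hκ1 s (by simpa [hm.zero] using hsm)
    simp only [cellVal, if_true]
    rw [if_neg (by simp)]
    simp only [hW]
    linarith
  · have h3 := hκ m hm2 (hmn.trans hn) s hsm
    rw [if_pos (Finset.mem_Icc.2 ⟨hm2, hmn⟩), cellVal, if_neg (by omega), half]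
    have h4 : W m = W (m - 1) + cellSlope t W m * tstep t m := by
      unfold cellSlope
      rw [div_mul_cancel₀ _ (hm.tstep_pos hm1 (hmn.trans hn)).ne']
      ring
    refine le_trans (le_of_eq ?_) h3
    rw [h4]
    simp only [hW, tstep]
    ring

end IsGradedMesh

/-! ### Summation of the sawtooth contributions along diagonals. -/

lemma sum_Icc_swap (N : ℕ) (g : ℕ → ℕ → ℝ) :
    ∑ n ∈ Finset.Icc 2 N, ∑ m ∈ Finset.Icc 3 n, g n m
      = ∑ m ∈ Finset.Icc 3 N, ∑ n ∈ Finset.Icc m N, g n m := by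
  refine Finset.sum_comm' fun n m => ?_
  simp only [Finset.mem_Icc]
  omega

/-- Summation by parts along the diagonals. -/
lemma sum_diag_shift (n : ℕ) (hn : 2 ≤ n) (a : ℕ → ℕ → ℝ) (p p' : ℕ → ℝ) (hp : p' n = 0) :
    ∑ m ∈ Finset.Icc 2 n, (p m - p' m) • a m
      = p 2 • a 2 + ∑ m ∈ Finset.Icc 3 n,
          (p m • (a m - a (m - 1)) + (p m - p' (m - 1)) • a (m - 1)) := by
  have key : ∀ r, 2 ≤ r → ∑ m ∈ Finset.Icc 2 r, (p m - p' m) • a m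
      = p 2 • a 2 + ∑ m ∈ Finset.Icc 3 r,
          (p m • (a m - a (m - 1)) + (p m - p' (m - 1)) • a (m - 1)) - p' r • a r := by
    intro r hr
    induction r, hr using Nat.le_induction with
    | base => simp [sub_smul]
    | succ r hr ih =>
      rw [Finset.sum_Icc_succ_top (by omega), Finset.sum_Icc_succ_top (by omega), ih,
        Nat.add_sub_cancel]
      module
  rw [key n hn, hp, zero_smul, sub_zero]

namespace IsGradedMesh

variable {α T γ Γ cγ k : ℝ} {N : ℕ} {t : ℕ → ℝ}

/-- The mean of the sawtooth is zero, so its fractional integral, accumulated up to t_n, is a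
quadrature error; this brings in the sign and the bounds of `trapErr`. -/
lemma sawPrim_eq_trapErr (hm : IsGradedMesh T γ Γ cγ k N t) (hα : 0 < α) {n m : ℕ}
    (hmn : m ≤ n) (hn : n ≤ N) :
    sawPrim α (t (m - 1)) (t m) (t n) = trapErr α (t n - t m) (tstep t m) := by
  have h1 := hm.mono hmn hn
  have h2 := hm.mono (show m - 1 ≤ m by omega) (hmn.trans hn)
  rw [trapErr_eq hα (by linarith) (by unfold tstep; linarith), sawPrim]
  have : t n - t m + tstep t m = t n - t (m - 1) := by unfold tstep; ring
  rw [this]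
  unfold tstep
  ring

/-- The n-th sawtooth has not started at t_(n-1); this removes the boundary term of the summation by
parts. -/
lemma sawPrim_eq_zero (hm : IsGradedMesh T γ Γ cγ k N t) (hα : 0 < α) {n : ℕ} (h1 : 1 ≤ n)
    (hn : n ≤ N) : sawPrim α (t (n - 1)) (t n) (t (n - 1)) = 0 := by
  have h2 := hm.mono (show n - 1 ≤ n by omega) hn
  have e := fun p (hp : 0 < p) => tpow_of_nonpos (p := p) hp (show t (n - 1) - t n ≤ 0 by linarith)
  unfold sawPrim
  rw [sub_self, e _ (by linarith), e _ (by linarith), tpow_of_nonpos (by linarith) le_rfl,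
    tpow_of_nonpos (by linarith) le_rfl]
  ring

/-- The sum of the norms of the sawtooth contributions. -/
lemma sum_gridNorm_saw_le (hm : IsGradedMesh T γ Γ cγ k N t) (hα : α ∈ Ioo (0 : ℝ) 1)
    (hΓ : 1 ≤ Γ) (hk : 0 < k) (hγ : 1 ≤ γ) (hN : 2 ≤ N) {L σ A : ℝ} (hL : 0 < L) (J : ℕ)
    (a : ℕ → ℕ → ℝ) (hA : 0 ≤ A)
    (ha : ∀ m, 2 ≤ m → m ≤ N → gridNorm L J (a m) ≤ A * t m ^ (σ - 2))
    (had : ∀ m, 3 ≤ m → m ≤ N →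
      gridNorm L J (a m - a (m - 1)) ≤ A * (tstep t m * t m ^ (σ - 3))) :
    ∑ n ∈ Finset.Icc 2 N, gridNorm L J (∑ m ∈ Finset.Icc 2 n,
        (sawPrim α (t (m - 1)) (t m) (t n) - sawPrim α (t (m - 1)) (t m) (t (n - 1))) • a m)
      ≤ A * (2 * tpow α T * Γ ^ 2) * (k ^ 2 * t 2 ^ (σ - 2 / γ))
        + A * (2 * tpow α T * Γ ^ 2 + (6 * tpow α T * Γ + Γ ^ 2 * T ^ α / Real.Gamma α)
            * Γ ^ |σ - 2 / γ - 1|)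
          * (k ^ 2 * ∑ m ∈ Finset.Icc 2 N, tstep t m * t m ^ (σ - 2 / γ - 1)) := by
  set B := tpow α T with hB
  have hB0 : 0 ≤ B := tpow_nonneg hα.1 T
  have hG : 0 < Real.Gamma α := Real.Gamma_pos_of_pos hα.1
  have hT : 0 < T := (hm.pos (by omega) le_rfl).trans_le (hm.le_T le_rfl)
  set p : ℕ → ℕ → ℝ := fun n m => sawPrim α (t (m - 1)) (t m) (t n) with hp
  have hpe : ∀ n m, m ≤ n → n ≤ N → p n m = trapErr α (t n - t m) (tstep t m) :=
    fun n m h1 h2 => hm.sawPrim_eq_trapErr hα.1 h1 h2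
  have hp0 : ∀ n m, 1 ≤ m → m ≤ n → n ≤ N → 0 ≤ p n m := by
    intro n m h0 h1 h2
    rw [hpe n m h1 h2]
    exact trapErr_nonneg hα.1 (sub_nonneg.2 (hm.mono h1 h2)) (hm.tstep_pos h0 (h1.trans h2)).le
  have hterm : ∀ n ∈ Finset.Icc 2 N,
      gridNorm L J (∑ m ∈ Finset.Icc 2 n, (p n m - p (n - 1) m) • a m)
        ≤ p n 2 * gridNorm L J (a 2) + ∑ m ∈ Finset.Icc 3 n,
          (p n m * gridNorm L J (a m - a (m - 1))
            + |p n m - p (n - 1) (m - 1)| * gridNorm L J (a (m - 1))) := by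
    intro n hn
    rw [Finset.mem_Icc] at hn
    -- The time difference of the weights is traded for a difference of neighbouring slopes and a
    -- diagonal difference of the weights; either gains a power of the step.
    rw [sum_diag_shift n hn.1 a (p n) (p (n - 1)) (hm.sawPrim_eq_zero hα.1 (by omega) hn.2)]
    refine (gridNorm_add_le hL J _ _).trans (add_le_add ?_ ?_)
    · rw [gridNorm_smul, abs_of_nonneg (hp0 n 2 (by omega) hn.1 hn.2)]
    · refine (gridNorm_sum_le hL J _ _).trans (Finset.sum_le_sum fun m hmem => ?_)
      rw [Finset.mem_Icc] at hmem
      refine (gridNorm_add_le hL J _ _).trans (le_of_eq ?_)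
      rw [gridNorm_smul, gridNorm_smul, abs_of_nonneg (hp0 n m (by omega) hmem.2 hn.2)]
  refine (Finset.sum_le_sum hterm).trans ?_
  rw [Finset.sum_add_distrib, ← Finset.sum_mul, sum_Icc_swap]
  have hpow : ∀ m, 1 ≤ m → m ≤ N → ∀ q r : ℝ, t m ^ q * t m ^ r = t m ^ (q + r) := by
    intro m h1 h2 q r
    rw [Real.rpow_add (hm.pos h1 h2)]
  have hsum : ∀ m, 2 ≤ m → m ≤ N → ∑ n ∈ Finset.Icc m N, p n m ≤ 2 * B * tstep t m ^ 2 := by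
    intro m h2 hmN
    refine le_trans (le_of_eq ?_) (hm.sum_trapErr_le hα h2 hmN)
    refine Finset.sum_congr rfl fun n hn => ?_
    rw [Finset.mem_Icc] at hn
    exact hpe n m hn.1 hn.2
  refine add_le_add ?_ ?_
  · have h1 := hsum 2 le_rfl hN
    have h2 := hm.tstep_sq_le hΓ hk (by omega : 1 ≤ 2) hN
    have h3 := ha 2 le_rfl hN
    have ht2 : 0 ≤ t 2 ^ (σ - 2) := Real.rpow_nonneg (hm.nonneg hN) _
    have h4 : t 2 ^ (2 - 2 / γ) * t 2 ^ (σ - 2) = t 2 ^ (σ - 2 / γ) := by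
      rw [hpow 2 (by omega) hN]; congr 1; ring
    calc (∑ n ∈ Finset.Icc 2 N, p n 2) * gridNorm L J (a 2)
        ≤ (2 * B * (Γ ^ 2 * k ^ 2 * t 2 ^ (2 - 2 / γ))) * (A * t 2 ^ (σ - 2)) := by
          refine mul_le_mul (h1.trans ?_) h3 (gridNorm_nonneg _ _ _) ?_
          · exact mul_le_mul_of_nonneg_left h2 (by positivity)
          · exact mul_nonneg (by positivity) (mul_nonneg (by positivity)
              (Real.rpow_nonneg (hm.nonneg hN) _))
      _ = A * (2 * B * Γ ^ 2) * (k ^ 2 * (t 2 ^ (2 - 2 / γ) * t 2 ^ (σ - 2))) := by ring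
      _ = _ := by rw [h4]
  · have hloc : ∀ m ∈ Finset.Icc 3 N, ∑ n ∈ Finset.Icc m N,
        (p n m * gridNorm L J (a m - a (m - 1))
          + |p n m - p (n - 1) (m - 1)| * gridNorm L J (a (m - 1)))
        ≤ A * (2 * B * Γ ^ 2 + (6 * B * Γ + Γ ^ 2 * T ^ α / Real.Gamma α)
            * Γ ^ |σ - 2 / γ - 1|) * (k ^ 2 * (tstep t m * t m ^ (σ - 2 / γ - 1))) := by
      intro m hmem
      rw [Finset.mem_Icc] at hmem
      obtain ⟨h3, hmN⟩ := hmem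
      have hk0 := hm.tstep_pos (by omega : 1 ≤ m) hmN
      have hk1 := hm.tstep_pos (by omega : 1 ≤ m - 1) (by omega)
      have htm := hm.pos (by omega : 1 ≤ m) hmN
      have htm1 := hm.pos (by omega : 1 ≤ m - 1) (by omega)
      rw [Finset.sum_add_distrib, ← Finset.sum_mul, ← Finset.sum_mul]
      have h1 : (∑ n ∈ Finset.Icc m N, p n m) * gridNorm L J (a m - a (m - 1))
          ≤ A * (2 * B * Γ ^ 2) * (k ^ 2 * (tstep t m * t m ^ (σ - 2 / γ - 1))) := by
        have h4 : t m ^ (2 - 2 / γ) * t m ^ (σ - 3) = t m ^ (σ - 2 / γ - 1) := by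
          rw [hpow m (by omega) hmN]; congr 1; ring
        calc (∑ n ∈ Finset.Icc m N, p n m) * gridNorm L J (a m - a (m - 1))
            ≤ (2 * B * (Γ ^ 2 * k ^ 2 * t m ^ (2 - 2 / γ)))
                * (A * (tstep t m * t m ^ (σ - 3))) := by
              refine mul_le_mul ((hsum m (by omega) hmN).trans ?_) (had m h3 hmN)
                (gridNorm_nonneg _ _ _) (by positivity)
              exact mul_le_mul_of_nonneg_left (hm.tstep_sq_le hΓ hk (by omega) hmN)
                (by positivity)
          _ = A * (2 * B * Γ ^ 2)
                * (k ^ 2 * (tstep t m * (t m ^ (2 - 2 / γ) * t m ^ (σ - 3)))) := by ring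
          _ = _ := by rw [h4]
      have h2 : (∑ n ∈ Finset.Icc m N, |p n m - p (n - 1) (m - 1)|)
          ≤ 6 * B * (Γ * k ^ 2 * t (m - 1) ^ (1 - 2 / γ)) * tstep t m
            + tstep t (m - 1) ^ 3 * (t (m - 1) ^ (α - 1) / Real.Gamma α) := by
        refine le_trans (le_of_eq ?_) (hm.sum_abs_trapErr_sub_le hα hΓ hk hγ h3 hmN)
        refine Finset.sum_congr rfl fun n hn => ?_
        rw [Finset.mem_Icc] at hn
        rw [hpe n m hn.1 hn.2, hpe (n - 1) (m - 1) (by omega) (by omega)]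
      -- One factor k_(m-1) is kept as k_m for the Riemann sum; the other two become k² by grading.
      have h5 : tstep t (m - 1) ^ 3 * (t (m - 1) ^ (α - 1) / Real.Gamma α)
          ≤ tstep t m * (Γ ^ 2 * k ^ 2 * t (m - 1) ^ (2 - 2 / γ))
            * (t (m - 1) ^ (α - 1) / Real.Gamma α) := by
        refine mul_le_mul_of_nonneg_right ?_ (kernel_nonneg hα.1 htm1.le)
        rw [pow_succ, mul_comm]
        exact mul_le_mul (hm.tstep_mono (by omega) (by omega) hmN)
          (hm.tstep_sq_le hΓ hk (by omega) (by omega)) (by positivity) hk0.le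
      have h6 : t (m - 1) ^ (σ - 2 / γ - 1) ≤ Γ ^ |σ - 2 / γ - 1| * t m ^ (σ - 2 / γ - 1) :=
        hm.rpow_le hΓ (by omega) hmN ⟨le_rfl, hm.mono (by omega) hmN⟩ _
      have h7 : t (m - 1) ^ α ≤ T ^ α :=
        Real.rpow_le_rpow htm1.le (hm.le_T (by omega)) hα.1.le
      have e1 : t (m - 1) ^ (1 - 2 / γ) * t (m - 1) ^ (σ - 2) = t (m - 1) ^ (σ - 2 / γ - 1) := by
        rw [hpow (m - 1) (by omega) (by omega)]; congr 1; ring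
      have e2 : t (m - 1) ^ (2 - 2 / γ) * t (m - 1) ^ (α - 1) * t (m - 1) ^ (σ - 2)
          = t (m - 1) ^ α * t (m - 1) ^ (σ - 2 / γ - 1) := by
        rw [hpow (m - 1) (by omega) (by omega), hpow (m - 1) (by omega) (by omega),
          hpow (m - 1) (by omega) (by omega)]
        congr 1; ring
      have h8 : (∑ n ∈ Finset.Icc m N, |p n m - p (n - 1) (m - 1)|) * gridNorm L J (a (m - 1))
          ≤ A * ((6 * B * Γ + Γ ^ 2 * T ^ α / Real.Gamma α) * Γ ^ |σ - 2 / γ - 1|)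
            * (k ^ 2 * (tstep t m * t m ^ (σ - 2 / γ - 1))) := by
        calc _ ≤ (6 * B * (Γ * k ^ 2 * t (m - 1) ^ (1 - 2 / γ)) * tstep t m
              + tstep t m * (Γ ^ 2 * k ^ 2 * t (m - 1) ^ (2 - 2 / γ))
                * (t (m - 1) ^ (α - 1) / Real.Gamma α)) * (A * t (m - 1) ^ (σ - 2)) := by
              refine mul_le_mul (h2.trans (by linarith)) (ha (m - 1) (by omega) (by omega))
                (gridNorm_nonneg _ _ _) (by positivity)
          _ = A * (k ^ 2 * tstep t m) * (6 * B * Γ * (t (m - 1) ^ (1 - 2 / γ)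
                * t (m - 1) ^ (σ - 2)) + Γ ^ 2 / Real.Gamma α * (t (m - 1) ^ (2 - 2 / γ)
                  * t (m - 1) ^ (α - 1) * t (m - 1) ^ (σ - 2))) := by ring
          _ = A * (k ^ 2 * tstep t m) * (6 * B * Γ * t (m - 1) ^ (σ - 2 / γ - 1)
                + Γ ^ 2 / Real.Gamma α * (t (m - 1) ^ α * t (m - 1) ^ (σ - 2 / γ - 1))) := by
              rw [e1, e2]
          _ ≤ A * (k ^ 2 * tstep t m) * (6 * B * Γ * (Γ ^ |σ - 2 / γ - 1| * t m ^ (σ - 2 / γ - 1))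
                + Γ ^ 2 / Real.Gamma α
                  * (T ^ α * (Γ ^ |σ - 2 / γ - 1| * t m ^ (σ - 2 / γ - 1)))) := by
              gcongr
          _ = _ := by ring
      linarith
    refine (Finset.sum_le_sum hloc).trans ?_
    rw [← Finset.mul_sum, ← Finset.mul_sum]
    have hsub : ∑ m ∈ Finset.Icc 3 N, tstep t m * t m ^ (σ - 2 / γ - 1)
        ≤ ∑ m ∈ Finset.Icc 2 N, tstep t m * t m ^ (σ - 2 / γ - 1) := by
      refine Finset.sum_le_sum_of_subset_of_nonneg (Finset.Icc_subset_Icc_left (by omega)) ?_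
      intro m hmem _
      rw [Finset.mem_Icc] at hmem
      exact mul_nonneg (hm.tstep_pos (by omega) hmem.2).le
        (Real.rpow_nonneg (hm.nonneg hmem.2) _)
    gcongr

end IsGradedMesh

/-! ### Scalar functions with a weak singularity at `t = 0` -/

/-- `φ` is twice differentiable on `(0, T]`, with `|φ'| ≤ M t^(σ-2)` and `|φ''| ≤ M t^(σ-3)`. -/
structure WeaklySingular (T σ M : ℝ) (φ φ' φ'' : ℝ → ℝ) : Prop where
  deriv₁ : ∀ t ∈ Ioc 0 T, HasDerivWithinAt φ (φ' t) (Ioc 0 T) t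
  deriv₂ : ∀ t ∈ Ioc 0 T, HasDerivWithinAt φ' (φ'' t) (Ioc 0 T) t
  bound₁ : ∀ t ∈ Ioc 0 T, |φ' t| ≤ M * t ^ (σ - 2)
  bound₂ : ∀ t ∈ Ioc 0 T, |φ'' t| ≤ M * t ^ (σ - 3)

lemma HasTimeRegularity.slice_bounds {L T σ M : ℝ} {v : ℝ → ℝ → ℝ}
    (h : HasTimeRegularity L T σ M v) {J : ℕ} (hJ : 1 ≤ J) {t : ℝ} (ht : t ∈ Ioc 0 T) :
    sliceNorm L J (dtPart T v) t ≤ M * t ^ (σ - 2) ∧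
      sliceNorm L J (dtPart T (dtPart T v)) t ≤ M * t ^ (σ - 3) := by
  have hb := h.bound J hJ t ht
  have h1 : 0 ≤ sliceNorm L J (dtPart T v) t := gridNorm_nonneg _ _ _
  have h2 : 0 ≤ sliceNorm L J (dtPart T (dtPart T v)) t := gridNorm_nonneg _ _ _
  have e1 : t ^ (σ - 1) = t ^ (σ - 2) * t := by
    rw [← Real.rpow_add_one ht.1.ne']; congr 1; ring
  have e2 : t ^ (σ - 1) = t ^ (σ - 3) * t ^ 2 := by
    rw [← Real.rpow_natCast t 2, ← Real.rpow_add ht.1]; congr 1; push_cast; ring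
  have ht2 : 0 < t ^ 2 := pow_pos ht.1 2
  constructor
  · have h3 : t * sliceNorm L J (dtPart T v) t ≤ M * t ^ (σ - 1) := by
      linarith [mul_nonneg ht2.le h2]
    rw [e1] at h3
    exact le_of_mul_le_mul_left (h3.trans (le_of_eq (by ring))) ht.1
  · have h3 : t ^ 2 * sliceNorm L J (dtPart T (dtPart T v)) t ≤ M * t ^ (σ - 1) := by
      linarith [mul_nonneg ht.1.le h1]
    rw [e2] at h3
    exact le_of_mul_le_mul_left (h3.trans (le_of_eq (by ring))) ht2

lemma HasTimeRegularity.nonneg {L T σ M : ℝ} (hT : 0 < T) {v : ℝ → ℝ → ℝ}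
    (h : HasTimeRegularity L T σ M v) : 0 ≤ M := by
  have h1 := (h.slice_bounds le_rfl (t := T) ⟨hT, le_rfl⟩).1
  have h2 : 0 ≤ M * T ^ (σ - 2) := (gridNorm_nonneg _ _ _).trans h1
  exact nonneg_of_mul_nonneg_left h2 (Real.rpow_pos_of_pos hT _)

lemma node_mem_Ioo {L : ℝ} (hL : 0 < L) {J j : ℕ} (h1 : 1 ≤ j) (hj : j < J) :
    node L J j ∈ Ioo 0 L := by
  have hJ : (0 : ℝ) < J := by exact_mod_cast (by omega : 0 < J)
  have hj1 : (0 : ℝ) < j := by exact_mod_cast h1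
  have hjJ : (j : ℝ) < J := by exact_mod_cast hj
  unfold node
  refine ⟨by positivity, ?_⟩
  calc (j : ℝ) * (L / J) < J * (L / J) := by gcongr
    _ = L := by field_simp

/-- Pairing with a normalised grid function yields a weakly singular scalar function. -/
lemma HasTimeRegularity.pairing {L T σ M : ℝ} (hL : 0 < L) {v : ℝ → ℝ → ℝ}
    (h : HasTimeRegularity L T σ M v) {J : ℕ} (hJ : 1 ≤ J) {ψ : ℕ → ℝ}
    (hψ : gridNorm L J ψ = 1) :
    WeaklySingular T σ M (fun t => gip L J ψ (fun j => v (node L J j) t))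
      (fun t => gip L J ψ (fun j => dtPart T v (node L J j) t))
      (fun t => gip L J ψ (fun j => dtPart T (dtPart T v) (node L J j) t)) where
  deriv₁ := fun t ht => by
    unfold gip
    refine HasDerivWithinAt.const_mul _ (HasDerivWithinAt.fun_sum fun j hj => ?_)
    rw [Finset.mem_Ico] at hj
    exact ((h.differentiable _ (node_mem_Ioo hL hj.1 hj.2) t ht).hasDerivWithinAt).const_mul _
  deriv₂ := fun t ht => by
    unfold gip
    refine HasDerivWithinAt.const_mul _ (HasDerivWithinAt.fun_sum fun j hj => ?_)
    rw [Finset.mem_Ico] at hj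
    exact ((h.differentiable_deriv _ (node_mem_Ioo hL hj.1 hj.2) t ht).hasDerivWithinAt).const_mul _
  bound₁ := fun t ht => by
    refine (abs_gip_le hL J _ _).trans ?_
    rw [hψ, one_mul]
    exact (h.slice_bounds hJ ht).1
  bound₂ := fun t ht => by
    refine (abs_gip_le hL J _ _).trans ?_
    rw [hψ, one_mul]
    exact (h.slice_bounds hJ ht).2

lemma intervalIntegral_linear_interp (a b p q : ℝ) :
    ∫ s in a..b, (p + q * (s - a)) = (b - a) * p + q * ((b - a) ^ 2 / 2) := by
  have i1 : IntervalIntegrable (fun _ : ℝ => p) MeasureTheory.volume a b := by simp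
  have i2 : IntervalIntegrable (fun s : ℝ => q * (s - a)) MeasureTheory.volume a b :=
    (by fun_prop : Continuous fun s : ℝ => q * (s - a)).intervalIntegrable _ _
  rw [intervalIntegral.integral_add i1 i2, intervalIntegral.integral_const,
    intervalIntegral.integral_const_mul,
    intervalIntegral.integral_comp_sub_right (fun x => x), integral_id, smul_eq_mul]
  ring

namespace WeaklySingular

variable {T σ M : ℝ} {φ φ' φ'' : ℝ → ℝ}

lemma continuousOn (h : WeaklySingular T σ M φ φ' φ'') : ContinuousOn φ (Ioc 0 T) :=
  fun t ht => (h.deriv₁ t ht).continuousWithinAt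

lemma exists_slope (h : WeaklySingular T σ M φ φ' φ'') {a b : ℝ} (ha : 0 < a) (hab : a < b)
    (hb : b ≤ T) : ∃ ξ ∈ Ioo a b, φ' ξ = (φ b - φ a) / (b - a) := by
  refine exists_hasDerivAt_eq_slope φ φ' hab
    (h.continuousOn.mono fun s hs => ⟨ha.trans_le hs.1, hs.2.trans hb⟩) fun s hs => ?_
  exact (h.deriv₁ s ⟨ha.trans hs.1, hs.2.le.trans hb⟩).hasDerivAt
    (Ioc_mem_nhds (ha.trans hs.1) (hs.2.trans_le hb))

lemma abs_deriv_sub_le (h : WeaklySingular T σ M φ φ' φ'') {a b K : ℝ} (ha : 0 < a)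
    (hb : b ≤ T) (hK : ∀ s ∈ Icc a b, M * s ^ (σ - 3) ≤ K) {x y : ℝ} (hx : x ∈ Icc a b)
    (hy : y ∈ Icc a b) : |φ' x - φ' y| ≤ K * |x - y| := by
  have hsub : Icc a b ⊆ Ioc 0 T := fun s hs => ⟨ha.trans_le hs.1, hs.2.trans hb⟩
  exact (convex_Icc a b).norm_image_sub_le_of_norm_hasDerivWithin_le
    (fun s hs => (h.deriv₂ s (hsub hs)).mono hsub)
    (fun s hs => (h.bound₂ s (hsub hs)).trans (hK s hs)) hy hx

/-- The slope of the chord and the slope from a to s are both values of φ' in (a, b), so they differ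
by at most K(b - a). -/
lemma interp_error (h : WeaklySingular T σ M φ φ' φ'') {a b K : ℝ} (ha : 0 < a) (hab : a < b)
    (hb : b ≤ T) (hK : ∀ s ∈ Icc a b, M * s ^ (σ - 3) ≤ K) {s : ℝ} (hs : s ∈ Ioo a b) :
    |φ a + (φ b - φ a) / (b - a) * (s - a) - φ s| ≤ K * (b - a) ^ 2 := by
  obtain ⟨ξ, hξ, e1⟩ := h.exists_slope ha hab hb
  obtain ⟨η, hη, e2⟩ := h.exists_slope ha hs.1 (hs.2.le.trans hb)
  have e3 : φ s = φ a + φ' η * (s - a) := by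
    rw [e2, div_mul_cancel₀ _ (by linarith [hs.1])]; ring
  have h1 := h.abs_deriv_sub_le ha hb hK (x := ξ) (y := η) ⟨hξ.1.le, hξ.2.le⟩
    ⟨hη.1.le, hη.2.le.trans hs.2.le⟩
  have hK0 : 0 ≤ K := by
    by_contra hneg
    push Not at hneg
    have h2 := hK a ⟨le_rfl, hab.le⟩
    have h3 := h.bound₂ a ⟨ha, hab.le.trans hb⟩
    linarith [abs_nonneg (φ'' a)]
  rw [← e1, e3]
  have e4 : φ a + φ' ξ * (s - a) - (φ a + φ' η * (s - a)) = (φ' ξ - φ' η) * (s - a) := by ring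
  rw [e4, abs_mul, abs_of_pos (show 0 < s - a by linarith [hs.1])]
  have h4 : |ξ - η| ≤ b - a := by
    rw [abs_le]; constructor <;> linarith [hξ.1, hξ.2, hη.1, hη.2, hs.2]
  calc _ ≤ (K * (b - a)) * (b - a) :=
        mul_le_mul (h1.trans (mul_le_mul_of_nonneg_left h4 hK0)) (by linarith [hs.2])
          (by linarith [hs.1]) (mul_nonneg hK0 (by linarith))
    _ = _ := by ring

lemma abs_slope_le (h : WeaklySingular T σ M φ φ' φ'') {a b K : ℝ} (ha : 0 < a) (hab : a < b)
    (hb : b ≤ T) (hK : ∀ s ∈ Icc a b, M * s ^ (σ - 2) ≤ K) :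
    |(φ b - φ a) / (b - a)| ≤ K := by
  obtain ⟨ξ, hξ, e1⟩ := h.exists_slope ha hab hb
  rw [← e1]
  exact (h.bound₁ ξ ⟨ha.trans hξ.1, hξ.2.le.trans hb⟩).trans (hK ξ ⟨hξ.1.le, hξ.2.le⟩)

lemma abs_slope_sub_le (h : WeaklySingular T σ M φ φ' φ'') {a b c K : ℝ} (ha : 0 < a)
    (hab : a < b) (hbc : b < c) (hc : c ≤ T) (hK : ∀ s ∈ Icc a c, M * s ^ (σ - 3) ≤ K) :
    |(φ c - φ b) / (c - b) - (φ b - φ a) / (b - a)| ≤ K * (c - a) := by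
  obtain ⟨ξ, hξ, e1⟩ := h.exists_slope ha hab (hbc.le.trans hc)
  obtain ⟨η, hη, e2⟩ := h.exists_slope (ha.trans hab) hbc hc
  rw [← e1, ← e2]
  have hK0 : 0 ≤ K := by
    have h3 := h.bound₂ a ⟨ha, (hab.trans hbc).le.trans hc⟩
    linarith [abs_nonneg (φ'' a), hK a ⟨le_rfl, (hab.trans hbc).le⟩]
  refine (h.abs_deriv_sub_le ha hc hK ⟨by linarith [hη.1], hη.2.le⟩
    ⟨hξ.1.le, by linarith [hξ.2]⟩).trans (mul_le_mul_of_nonneg_left ?_ hK0)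
  rw [abs_le]
  constructor <;> linarith [hξ.1, hξ.2, hη.1, hη.2]

lemma trapezoid_error (h : WeaklySingular T σ M φ φ' φ'') {a b K : ℝ} (ha : 0 < a) (hab : a < b)
    (hb : b ≤ T) (hK : ∀ s ∈ Icc a b, M * s ^ (σ - 3) ≤ K) :
    |(b - a) * ((φ b + φ a) / 2) - ∫ s in a..b, φ s| ≤ K * (b - a) ^ 3 := by
  have hi : IntervalIntegrable φ MeasureTheory.volume a b :=
    (h.continuousOn.mono fun s hs => by
      rw [uIcc_of_le hab.le] at hs
      exact ⟨ha.trans_le hs.1, hs.2.trans hb⟩).intervalIntegrable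
  have hl : IntervalIntegrable (fun s => φ a + (φ b - φ a) / (b - a) * (s - a))
      MeasureTheory.volume a b :=
    (by fun_prop : Continuous fun s => φ a + (φ b - φ a) / (b - a) * (s - a)).intervalIntegrable _ _
  have e1 : (b - a) * ((φ b + φ a) / 2)
      = ∫ s in a..b, (φ a + (φ b - φ a) / (b - a) * (s - a)) := by
    rw [intervalIntegral_linear_interp]
    have : b - a ≠ 0 := by linarith
    field_simp
    ring
  rw [e1, ← intervalIntegral.integral_sub hl hi]
  have hae : ∀ᵐ s, s ∈ uIoc a b →
      ‖φ a + (φ b - φ a) / (b - a) * (s - a) - φ s‖ ≤ K * (b - a) ^ 2 := by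
    filter_upwards [MeasureTheory.Measure.ae_ne MeasureTheory.volume b] with s hs hsm
    rw [uIoc_of_le hab.le] at hsm
    exact h.interp_error ha hab hb hK ⟨hsm.1, lt_of_le_of_ne hsm.2 hs⟩
  have := intervalIntegral.norm_integral_le_of_norm_le_const_ae hae
  rw [Real.norm_eq_abs, abs_of_pos (show 0 < b - a by linarith)] at this
  exact this.trans (le_of_eq (by ring))

end WeaklySingular

/-- A Landau-type inequality: boundedness improves the bound on the first derivative. -/
lemma exists_landau_bound {T σ M c : ℝ} (hT : 0 < T) (hM : 0 ≤ M) (hc : 0 ≤ c) :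
    ∃ C : ℝ, 0 ≤ C ∧ ∀ φ φ' φ'' : ℝ → ℝ, WeaklySingular T σ M φ φ' φ'' →
      (∀ t ∈ Ioc 0 T, |φ t| ≤ c) → ∀ t ∈ Ioc 0 T, |φ' t| ≤ C * t ^ ((σ - 3) / 2) := by
  refine ⟨M * T ^ ((σ - 1) / 2) + (4 * c * T ^ ((1 - σ) / 2)
    + M * 2 ^ |σ - 3| * T ^ ((σ - 1) / 2)), by positivity, fun φ φ' φ'' h hb t ht => ?_⟩
  have htp : 0 ≤ t ^ ((σ - 3) / 2) := Real.rpow_nonneg ht.1.le _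
  -- For σ ≥ 1 the bound t^(σ-2) is already at least as good as t^((σ-3)/2).
  rcases le_total 1 σ with hσ | hσ
  · have h1 := h.bound₁ t ht
    have e1 : t ^ (σ - 2) = t ^ ((σ - 1) / 2) * t ^ ((σ - 3) / 2) := by
      rw [← Real.rpow_add ht.1]; congr 1; ring
    have h2 : t ^ ((σ - 1) / 2) ≤ T ^ ((σ - 1) / 2) :=
      Real.rpow_le_rpow ht.1.le ht.2 (by linarith)
    have h3 : 0 ≤ (4 * c * T ^ ((1 - σ) / 2)
      + M * 2 ^ |σ - 3| * T ^ ((σ - 1) / 2)) * t ^ ((σ - 3) / 2) := by positivity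
    rw [add_mul]
    calc |φ' t| ≤ M * (t ^ ((σ - 1) / 2) * t ^ ((σ - 3) / 2)) := by rw [← e1]; exact h1
      _ ≤ M * (T ^ ((σ - 1) / 2) * t ^ ((σ - 3) / 2)) := by gcongr
      _ = M * T ^ ((σ - 1) / 2) * t ^ ((σ - 3) / 2) := by ring
      _ ≤ _ := le_add_of_nonneg_right h3
  -- This δ balances the slope bound 2c/δ against the variation t^(σ-3) δ of φ' on (t - δ, t). The
  -- power of T ensures δ ≤ t/2, so that all points used are comparable with t.
  · set δ := t ^ ((3 - σ) / 2) * T ^ ((σ - 1) / 2) / 2 with hδ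
    have hδ0 : 0 < δ := by have := ht.1; positivity
    have hδt : δ ≤ t / 2 := by
      have e1 : t ^ ((3 - σ) / 2) = t ^ ((1 - σ) / 2) * t := by
        rw [← Real.rpow_add_one ht.1.ne']; congr 1; ring
      have e2 : T ^ ((1 - σ) / 2) * T ^ ((σ - 1) / 2) = 1 := by
        rw [← Real.rpow_add hT, show (1 - σ) / 2 + (σ - 1) / 2 = 0 by ring, Real.rpow_zero]
      have h2 : t ^ ((1 - σ) / 2) ≤ T ^ ((1 - σ) / 2) :=
        Real.rpow_le_rpow ht.1.le ht.2 (by linarith)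
      have h3 : t ^ ((1 - σ) / 2) * T ^ ((σ - 1) / 2) ≤ 1 := by
        calc _ ≤ T ^ ((1 - σ) / 2) * T ^ ((σ - 1) / 2) := by gcongr
          _ = 1 := e2
      rw [hδ, e1]
      nlinarith [ht.1]
    have ha : 0 < t - δ := by linarith [ht.1]
    obtain ⟨ξ, hξ, e1⟩ := h.exists_slope ha (show t - δ < t by linarith) ht.2
    have hK : ∀ s ∈ Icc (t - δ) t, M * s ^ (σ - 3) ≤ M * (2 ^ |σ - 3| * t ^ (σ - 3)) := by
      intro s hs
      refine mul_le_mul_of_nonneg_left ?_ hM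
      exact rpow_le_of_comparable ht.1 (by norm_num) (by linarith [hs.1])
        (by linarith [hs.2, ht.1]) _
    have h1 := h.abs_deriv_sub_le ha ht.2 hK (x := t) (y := ξ) ⟨by linarith, le_rfl⟩
      ⟨hξ.1.le, hξ.2.le⟩
    have h2 : |φ' ξ| ≤ 2 * c / δ := by
      rw [e1, sub_sub_cancel, abs_div, abs_of_pos hδ0]
      refine div_le_div_of_nonneg_right ?_ hδ0.le
      have := abs_sub (φ t) (φ (t - δ))
      linarith [hb t ht, hb (t - δ) ⟨ha, by linarith [ht.2]⟩]
    have h3 : |t - ξ| ≤ δ := by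
      rw [abs_le]; constructor <;> linarith [hξ.1, hξ.2]
    have h4 : |φ' t| ≤ 2 * c / δ + M * (2 ^ |σ - 3| * t ^ (σ - 3)) * δ := by
      have h5 := abs_add_le (φ' t - φ' ξ) (φ' ξ)
      rw [sub_add_cancel] at h5
      have h6 : M * (2 ^ |σ - 3| * t ^ (σ - 3)) * |t - ξ|
          ≤ M * (2 ^ |σ - 3| * t ^ (σ - 3)) * δ := by
        have := ht.1
        gcongr
      linarith
    have e3 : 2 * c / δ = 4 * c * T ^ ((1 - σ) / 2) * t ^ ((σ - 3) / 2) := by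
      have f1 : T ^ ((σ - 1) / 2) = (T ^ ((1 - σ) / 2))⁻¹ := by
        rw [← Real.rpow_neg hT.le]; congr 1; ring
      have f2 : t ^ ((3 - σ) / 2) = (t ^ ((σ - 3) / 2))⁻¹ := by
        rw [← Real.rpow_neg ht.1.le]; congr 1; ring
      have g1 : 0 < T ^ ((1 - σ) / 2) := Real.rpow_pos_of_pos hT _
      have g2 : 0 < t ^ ((σ - 3) / 2) := Real.rpow_pos_of_pos ht.1 _
      rw [hδ, f1, f2]
      field_simp
      ring
    have e4 : M * (2 ^ |σ - 3| * t ^ (σ - 3)) * δ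
        = M * 2 ^ |σ - 3| * T ^ ((σ - 1) / 2) * t ^ ((σ - 3) / 2) / 2 := by
      have f1 : t ^ (σ - 3) * t ^ ((3 - σ) / 2) = t ^ ((σ - 3) / 2) := by
        rw [← Real.rpow_add ht.1]; congr 1; ring
      rw [hδ, ← f1]
      ring
    have h7 : 0 ≤ M * T ^ ((σ - 1) / 2) * t ^ ((σ - 3) / 2) := by positivity
    have h8 : 0 ≤ M * 2 ^ |σ - 3| * T ^ ((σ - 1) / 2) * t ^ ((σ - 3) / 2) := by positivity
    rw [e3, e4] at h4
    rw [add_mul, add_mul]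
    linarith

/-- The increments on the first cell. -/
lemma exists_increment_bound {T σ M c : ℝ} (hT : 0 < T) (hM : 0 ≤ M)
    (hc : 0 ≤ c) :
    ∃ C : ℝ, 0 ≤ C ∧ ∀ φ φ' φ'' : ℝ → ℝ, WeaklySingular T σ M φ φ' φ'' →
      (∀ t ∈ Ioc 0 T, |φ t| ≤ c) → ∀ s t, 0 < s → s ≤ t → t ≤ T →
        |φ t - φ s| ≤ C * t ^ (σ - 1) := by
  -- For σ ≤ 1 boundedness alone suffices, since t^(σ-1) is bounded below; for σ > 1 the bound on φ'
  -- is integrable at 0.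
  rcases le_or_gt σ 1 with hσ1 | hσ1
  · refine ⟨2 * c * T ^ (1 - σ), by positivity, fun φ φ' φ'' h hb s t hs hst ht => ?_⟩
    have ht0 : 0 < t := hs.trans_le hst
    have h1 : 1 ≤ T ^ (1 - σ) * t ^ (σ - 1) := by
      have e1 : t ^ (1 - σ) * t ^ (σ - 1) = 1 := by
        rw [← Real.rpow_add ht0, show (1 - σ) + (σ - 1) = 0 by ring, Real.rpow_zero]
      have := Real.rpow_le_rpow ht0.le ht (show 0 ≤ 1 - σ by linarith)
      calc 1 = t ^ (1 - σ) * t ^ (σ - 1) := e1.symm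
        _ ≤ _ := by gcongr
    have h2 := abs_sub (φ t) (φ s)
    have h3 := hb t ⟨ht0, ht⟩
    have h4 := hb s ⟨hs, hst.trans ht⟩
    calc |φ t - φ s| ≤ 2 * c * 1 := by linarith
      _ ≤ 2 * c * (T ^ (1 - σ) * t ^ (σ - 1)) := by gcongr
      _ = _ := by ring
  · refine ⟨M / (σ - 1), div_nonneg hM (by linarith), fun φ φ' φ'' h hb s t hs hst ht => ?_⟩
    have hsub : Icc s t ⊆ Ioc 0 T := fun r hr => ⟨hs.trans_le hr.1, hr.2.trans ht⟩
    have hg : ∀ r, HasDerivAt (fun r : ℝ => M / (σ - 1) * r ^ (σ - 1) - M / (σ - 1) * s ^ (σ - 1))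
        (M * r ^ (σ - 2)) r ∨ r ≤ 0 := by
      intro r
      rcases le_or_gt r 0 with hr | hr
      · exact Or.inr hr
      · left
        have := ((Real.hasDerivAt_rpow_const (x := r) (p := σ - 1) (Or.inl hr.ne')).const_mul
          (M / (σ - 1))).sub_const (M / (σ - 1) * s ^ (σ - 1))
        refine this.congr_deriv ?_
        have hne : σ - 1 ≠ 0 := by linarith
        rw [show σ - 1 - 1 = σ - 2 by ring]
        field_simp
    have hr0 : ∀ r ∈ Icc s t, 0 < r := fun r hr => hs.trans_le hr.1
    have key := image_norm_le_of_norm_deriv_right_le_deriv_boundary' (a := s) (b := t)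
      (f := fun r => φ r - φ s) (f' := φ')
      (B := fun r : ℝ => M / (σ - 1) * r ^ (σ - 1) - M / (σ - 1) * s ^ (σ - 1))
      (B' := fun r => M * r ^ (σ - 2))
      ((h.continuousOn.mono hsub).sub continuousOn_const)
      (fun r hr => by
        have hrT : r < T := hr.2.trans_le ht
        have hrpos := hr0 r ⟨hr.1, hr.2.le⟩
        exact ((h.deriv₁ r ⟨hrpos, hrT.le⟩).hasDerivAt
          (Ioc_mem_nhds hrpos hrT)).hasDerivWithinAt.sub_const _)
      (by simp)
      (fun r hr => ((hg r).resolve_right (not_le.2 (hr0 r hr))).continuousAt.continuousWithinAt)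
      (fun r hr => ((hg r).resolve_right
        (not_le.2 (hr0 r ⟨hr.1, hr.2.le⟩))).hasDerivWithinAt)
      (fun r hr => h.bound₁ r (hsub ⟨hr.1, hr.2.le⟩))
      (show t ∈ Icc s t from ⟨hst, le_rfl⟩)
    rw [Real.norm_eq_abs] at key
    have : 0 ≤ M / (σ - 1) * s ^ (σ - 1) :=
      mul_nonneg (div_nonneg hM (by linarith)) (Real.rpow_nonneg hs.le _)
    linarith

/-! ### Consequences on the mesh, in the discrete norm -/

/-- The hypotheses on `v` under which the truncation errors are estimated: time regularity and
boundedness at the interior points. -/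
structure RegularField (L T σ M c : ℝ) (v : ℝ → ℝ → ℝ) : Prop where
  regularity : HasTimeRegularity L T σ M v
  bounded : ∀ x ∈ Ioo 0 L, ∀ t ∈ Ioc 0 T, |v x t| ≤ c

namespace RegularField

variable {α L T σ M c γ Γ cγ k : ℝ} {v : ℝ → ℝ → ℝ} {J N : ℕ} {t : ℕ → ℝ}

lemma bddMeas (h : RegularField L T σ M c v) {x : ℝ} (hx : x ∈ Ioo 0 L) : BddMeas T (v x) :=
  BddMeas.of_continuousOn (h.regularity.differentiable x hx).continuousOn (h.bounded x hx)

lemma abs_pairing_le (h : RegularField L T σ M c v) (hL : 0 < L) (hc : 0 ≤ c) {ψ : ℕ → ℝ}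
    (hψ : gridNorm L J ψ = 1) {s : ℝ} (hs : s ∈ Ioc 0 T) :
    |gip L J ψ (fun j => v (node L J j) s)| ≤ c * √L := by
  refine (abs_gip_le hL J _ _).trans ?_
  rw [hψ, one_mul]
  exact gridNorm_le_of_abs_le hL hc fun j h1 hj => h.bounded _ (node_mem_Ioo hL h1 hj) s hs

lemma weight_le (hm : IsGradedMesh T γ Γ cγ k N t) (hΓ : 1 ≤ Γ) (hM : 0 ≤ M) {n : ℕ}
    (h2 : 2 ≤ n) (hn : n ≤ N) (p : ℝ) :
    ∀ s ∈ Icc (t (n - 1)) (t n), M * s ^ p ≤ M * Γ ^ |p| * t n ^ p := fun s hs => by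
  rw [mul_assoc]
  exact mul_le_mul_of_nonneg_left (hm.rpow_le hΓ h2 hn hs p) hM

lemma gridNorm_slope_le (h : RegularField L T σ M c v) (hL : 0 < L) (hM : 0 ≤ M) (hJ : 1 ≤ J)
    (hm : IsGradedMesh T γ Γ cγ k N t) (hΓ : 1 ≤ Γ) {n : ℕ} (h2 : 2 ≤ n) (hn : n ≤ N) :
    gridNorm L J (fun j => cellSlope t (fun i => v (node L J j) (t i)) n)
      ≤ M * Γ ^ |σ - 2| * t n ^ (σ - 2) := by
  have htn := hm.pos (by omega : 1 ≤ n) hn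
  refine gridNorm_le_of_dual hL (by positivity) fun ψ hψ => ?_
  have hw := h.regularity.pairing hL hJ hψ
  have h1 := hw.abs_slope_le (hm.pos (by omega : 1 ≤ n - 1) (by omega)) (hm.lt n (by omega) hn)
    (hm.le_T hn) (weight_le hm hΓ hM h2 hn (σ - 2))
  refine le_trans (le_of_eq ?_) ((le_abs_self _).trans h1)
  have : (fun j => cellSlope t (fun i => v (node L J j) (t i)) n)
      = (tstep t n)⁻¹ • ((fun j => v (node L J j) (t n)) - fun j => v (node L J j) (t (n - 1))) := by
    funext j
    simp only [cellSlope, Pi.smul_apply, Pi.sub_apply, smul_eq_mul]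
    ring
  rw [this, gip_smul_right, gip_sub_right, tstep]
  ring

/-- Two neighbouring cells are involved, hence the node ratio Γ² and the length t_n - t_(n-2) ≤
2k_n; n ≥ 3 keeps t_(n-2) positive. -/
lemma gridNorm_slope_sub_le (h : RegularField L T σ M c v) (hL : 0 < L) (hM : 0 ≤ M)
    (hJ : 1 ≤ J) (hm : IsGradedMesh T γ Γ cγ k N t) (hΓ : 1 ≤ Γ) {n : ℕ} (h3 : 3 ≤ n)
    (hn : n ≤ N) :
    gridNorm L J ((fun j => cellSlope t (fun i => v (node L J j) (t i)) n)
        - fun j => cellSlope t (fun i => v (node L J j) (t i)) (n - 1))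
      ≤ 2 * M * (Γ ^ 2) ^ |σ - 3| * (tstep t n * t n ^ (σ - 3)) := by
  have htn := hm.pos (by omega : 1 ≤ n) hn
  have hkn := hm.tstep_pos (by omega : 1 ≤ n) hn
  refine gridNorm_le_of_dual hL (by positivity) fun ψ hψ => ?_
  have hw := h.regularity.pairing hL hJ hψ
  have e : n - 1 - 1 = n - 2 := by omega
  have l1 := hm.lt (n - 1) (by omega) (by omega)
  rw [e] at l1
  have hΓ2 : 1 ≤ Γ ^ 2 := one_le_pow₀ hΓ
  have h1 := hw.abs_slope_sub_le (hm.pos (by omega : 1 ≤ n - 2) (by omega)) l1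
    (hm.lt n (by omega) hn) (hm.le_T hn) (K := M * (Γ ^ 2) ^ |σ - 3| * t n ^ (σ - 3)) (by
      intro s hs
      rw [mul_assoc]
      refine mul_le_mul_of_nonneg_left (rpow_le_of_comparable htn hΓ2 ?_ ?_ _) hM
      · have a1 := hm.ratio_le n (by omega) hn
        have a2 := hm.ratio_le (n - 1) (by omega) (by omega)
        rw [e] at a2
        have a3 : t n ≤ Γ * (Γ * t (n - 2)) := a1.trans (mul_le_mul_of_nonneg_left a2 (by linarith))
        have a4 : Γ * (Γ * t (n - 2)) ≤ Γ ^ 2 * s := by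
          rw [sq, mul_assoc]
          exact mul_le_mul_of_nonneg_left (mul_le_mul_of_nonneg_left hs.1 (by linarith))
            (by linarith)
        linarith
      · exact hs.2.trans (by nlinarith))
  have h4 : t n - t (n - 2) ≤ 2 * tstep t n := by
    have := hm.tstep_mono (by omega : 2 ≤ n - 1) (by omega : n - 1 ≤ n) hn
    unfold tstep at this ⊢
    rw [e] at this
    linarith
  have h5 : M * (Γ ^ 2) ^ |σ - 3| * t n ^ (σ - 3) * (t n - t (n - 2))
      ≤ 2 * M * (Γ ^ 2) ^ |σ - 3| * (tstep t n * t n ^ (σ - 3)) := by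
    calc _ ≤ M * (Γ ^ 2) ^ |σ - 3| * t n ^ (σ - 3) * (2 * tstep t n) := by gcongr
      _ = _ := by ring
  refine le_trans (le_of_eq ?_) ((le_abs_self _).trans (h1.trans h5))
  have : ∀ r, (fun j => cellSlope t (fun i => v (node L J j) (t i)) r)
      = (tstep t r)⁻¹ • ((fun j => v (node L J j) (t r)) - fun j => v (node L J j) (t (r - 1))) := by
    intro r
    funext j
    simp only [cellSlope, Pi.smul_apply, Pi.sub_apply, smul_eq_mul]
    ring
  rw [this, this, gip_sub_right, gip_smul_right, gip_smul_right, gip_sub_right, gip_sub_right,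
    tstep, tstep, e]
  ring

lemma gridNorm_trapezoid_le (h : RegularField L T σ M c v) (hL : 0 < L) (hM : 0 ≤ M) (hJ : 1 ≤ J)
    (hm : IsGradedMesh T γ Γ cγ k N t) (hΓ : 1 ≤ Γ) {n : ℕ} (h2 : 2 ≤ n) (hn : n ≤ N) :
    gridNorm L J (fun j => tstep t n * half (fun i => v (node L J j) (t i)) n
        - ∫ s in (t (n - 1))..(t n), v (node L J j) s)
      ≤ M * Γ ^ |σ - 3| * (tstep t n ^ 3 * t n ^ (σ - 3)) := by
  have htn := hm.pos (by omega : 1 ≤ n) hn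
  have hkn := hm.tstep_pos (by omega : 1 ≤ n) hn
  refine gridNorm_le_of_dual hL (by positivity) fun ψ hψ => ?_
  have hw := h.regularity.pairing hL hJ hψ
  have h1 := hw.trapezoid_error (hm.pos (by omega : 1 ≤ n - 1) (by omega))
    (hm.lt n (by omega) hn) (hm.le_T hn) (weight_le hm hΓ hM h2 hn (σ - 3))
  refine le_trans (le_of_eq ?_) ((le_abs_self _).trans (h1.trans (le_of_eq ?_)))
  · have e1 : (fun j => tstep t n * half (fun i => v (node L J j) (t i)) n
        - ∫ s in (t (n - 1))..(t n), v (node L J j) s)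
        = (tstep t n / 2) • ((fun j => v (node L J j) (t n)) + fun j => v (node L J j) (t (n - 1)))
          - fun j => ∫ s in (t (n - 1))..(t n), v (node L J j) s := by
      funext j
      simp only [half, Pi.smul_apply, Pi.sub_apply, Pi.add_apply, smul_eq_mul]
      ring
    have e2 : gip L J ψ (fun j => ∫ s in (t (n - 1))..(t n), v (node L J j) s)
        = ∫ s in (t (n - 1))..(t n), gip L J ψ (fun j => v (node L J j) s) := by
      unfold gip
      rw [intervalIntegral.integral_const_mul, intervalIntegral.integral_finsetSum]
      · simp only [intervalIntegral.integral_const_mul]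
      · intro j hj
        rw [Finset.mem_Ico] at hj
        exact ((h.bddMeas (node_mem_Ioo hL hj.1 hj.2)).intervalIntegrable
          (hm.nonneg (by omega)) (hm.mono (by omega) hn) (hm.le_T hn)).const_mul _
    rw [e1, gip_sub_right, gip_smul_right, gip_add_right, e2]
    unfold tstep
    ring
  · unfold tstep; ring

/-- Increments on a cell away from the origin. -/
lemma exists_cell_increment_bound (hL : 0 < L) (hT : 0 < T) (hM : 0 ≤ M) (hc : 0 ≤ c)
    (hΓ : 1 ≤ Γ) :
    ∃ C : ℝ, 0 ≤ C ∧ ∀ v, RegularField L T σ M c v → ∀ (J N : ℕ) (k cγ : ℝ) (t : ℕ → ℝ), 1 ≤ J →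
      IsGradedMesh T γ Γ cγ k N t → ∀ n, 2 ≤ n → n ≤ N →
      ∀ s ∈ Icc (t (n - 1)) (t n), ∀ r ∈ Icc (t (n - 1)) (t n),
        gridNorm L J (fun j => v (node L J j) s - v (node L J j) r)
          ≤ C * (tstep t n * t n ^ ((σ - 3) / 2)) := by
  -- The increments are needed squared, so the exponent (σ - 3)/2 is used instead of σ - 2.
  obtain ⟨C, hC, hl⟩ := exists_landau_bound (T := T) (σ := σ) (M := M) (c := c * √L) hT hM
    (by positivity)
  refine ⟨C * Γ ^ |(σ - 3) / 2|, by positivity, ?_⟩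
  intro v h J N k cγ t hJ hm n h2 hn s hs r hr
  have htn := hm.pos (by omega : 1 ≤ n) hn
  have hkn := hm.tstep_pos (by omega : 1 ≤ n) hn
  have hpos := hm.pos (by omega : 1 ≤ n - 1) (by omega)
  refine gridNorm_le_of_dual hL (by positivity) fun ψ hψ => ?_
  have hw := h.regularity.pairing hL hJ hψ
  have hsub : Icc (t (n - 1)) (t n) ⊆ Ioc 0 T := fun z hz =>
    ⟨hpos.trans_le hz.1, hz.2.trans (hm.le_T hn)⟩
  have h1 := (convex_Icc (t (n - 1)) (t n)).norm_image_sub_le_of_norm_hasDerivWithin_le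
    (C := C * (Γ ^ |(σ - 3) / 2| * t n ^ ((σ - 3) / 2)))
    (fun z hz => (hw.deriv₁ z (hsub hz)).mono hsub)
    (fun z hz => (hl _ _ _ hw (fun z hz => h.abs_pairing_le hL hc hψ hz) z (hsub hz)).trans
      (mul_le_mul_of_nonneg_left (hm.rpow_le hΓ h2 hn hz _) hC)) hr hs
  have e1 : gip L J ψ (fun j => v (node L J j) s - v (node L J j) r)
      = gip L J ψ (fun j => v (node L J j) s) - gip L J ψ (fun j => v (node L J j) r) := by
    rw [← gip_sub_right]; rfl
  rw [e1]
  refine (le_abs_self _).trans (h1.trans ?_)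
  have h3 : ‖s - r‖ ≤ tstep t n := by
    rw [Real.norm_eq_abs, abs_le]
    unfold tstep
    constructor <;> linarith [hs.1, hs.2, hr.1, hr.2]
  calc _ ≤ C * (Γ ^ |(σ - 3) / 2| * t n ^ ((σ - 3) / 2)) * tstep t n := by gcongr
    _ = _ := by ring

lemma exists_first_increment_bound (hL : 0 < L) (hT : 0 < T) (hM : 0 ≤ M) (hc : 0 ≤ c) :
    ∃ C : ℝ, 0 ≤ C ∧ ∀ v, RegularField L T σ M c v → ∀ (J : ℕ), 1 ≤ J →
      ∀ s t, 0 < s → s ≤ t → t ≤ T →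
        gridNorm L J (fun j => v (node L J j) t - v (node L J j) s) ≤ C * t ^ (σ - 1) := by
  obtain ⟨C, hC, hl⟩ := exists_increment_bound (T := T) (σ := σ) (M := M) (c := c * √L) hT hM
    (by positivity)
  refine ⟨C, hC, fun v h J hJ s t hs hst ht => ?_⟩
  have := hs.trans_le hst
  refine gridNorm_le_of_dual hL (by positivity) fun ψ hψ => ?_
  have e1 : gip L J ψ (fun j => v (node L J j) t - v (node L J j) s)
      = gip L J ψ (fun j => v (node L J j) t) - gip L J ψ (fun j => v (node L J j) s) := by
    rw [← gip_sub_right]; rfl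
  rw [e1]
  exact (le_abs_self _).trans (hl _ _ _ (h.regularity.pairing hL hJ hψ)
    (fun z hz => h.abs_pairing_le hL hc hψ hz) s t hs hst ht)

lemma gip_ruleErr (h : RegularField L T σ M c v) (hL : 0 < L) (hα : 0 < α)
    (hm : IsGradedMesh T γ Γ cγ k N t) {n : ℕ} (hn : n ≤ N) (ψ : ℕ → ℝ) :
    gip L J ψ (fun j => ruleErr α t (v (node L J j)) n)
      = ruleErr α t (fun s => gip L J ψ (fun j => v (node L J j) s)) n := by
  have hb : ∀ j ∈ Finset.Ico 1 J, BddMeas T (fun s => ψ j * v (node L J j) s) := fun j hj => by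
    rw [Finset.mem_Ico] at hj
    exact (h.bddMeas (node_mem_Ioo hL hj.1 hj.2)).const_mul _
  have e1 : ∫ s in (t (n - 1))..(t n), fracInt α (fun s => gip L J ψ (fun j => v (node L J j) s)) s
      = gip L J ψ (fun j => ∫ s in (t (n - 1))..(t n), fracInt α (v (node L J j)) s) := by
    unfold gip
    rw [integral_fracInt_const_mul, integral_fracInt_sum hα _ hb (hm.nonneg (by omega))
      (hm.mono (by omega) hn) (hm.le_T hn)]
    congr 1
    refine Finset.sum_congr rfl fun j _ => ?_
    rw [integral_fracInt_const_mul]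
  have e2 : ∀ m, gip L J ψ (fun j => cellVal (fun i => v (node L J j) (t i)) m)
      = cellVal (fun i => gip L J ψ (fun j => v (node L J j) (t i))) m := by
    intro m
    unfold cellVal
    split_ifs
    · rfl
    · unfold half
      rw [← gip_add_right]
      have : (fun j => (v (node L J j) (t m) + v (node L J j) (t (m - 1))) / 2)
          = (1 / 2 : ℝ) • ((fun j => v (node L J j) (t m)) + fun j => v (node L J j) (t (m - 1))) := by
        funext j; simp; ring
      rw [this, gip_smul_right]
      ring
  unfold ruleErr
  rw [e1]
  have e3 : (fun j => (∑ m ∈ Finset.Icc 1 n, cellDiff (tpow (α + 1)) t n m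
        * cellVal (fun i => v (node L J j) (t i)) m)
      - ∫ s in (t (n - 1))..(t n), fracInt α (v (node L J j)) s)
      = (∑ m ∈ Finset.Icc 1 n, cellDiff (tpow (α + 1)) t n m
          • fun j => cellVal (fun i => v (node L J j) (t i)) m)
        - fun j => ∫ s in (t (n - 1))..(t n), fracInt α (v (node L J j)) s := by
    funext j
    simp [Finset.sum_apply]
  rw [e3, gip_sub_right, gip_sum_right]
  congr 1
  refine Finset.sum_congr rfl fun m _ => ?_
  rw [gip_smul_right, e2]

lemma gip_sawErr (ψ : ℕ → ℝ) (n : ℕ) :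
    gip L J ψ (fun j => sawErr α t (fun i => v (node L J j) (t i)) n)
      = sawErr α t (fun i => gip L J ψ (fun j => v (node L J j) (t i))) n := by
  have e : ∀ m, gip L J ψ (fun j => cellSlope t (fun i => v (node L J j) (t i)) m)
      = cellSlope t (fun i => gip L J ψ (fun j => v (node L J j) (t i))) m := by
    intro m
    unfold cellSlope
    rw [← gip_sub_right]
    have : (fun j => (v (node L J j) (t m) - v (node L J j) (t (m - 1))) / tstep t m)
        = (tstep t m)⁻¹ • ((fun j => v (node L J j) (t m)) - fun j => v (node L J j) (t (m - 1))) := by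
      funext j; simp; ring
    rw [this, gip_smul_right]
    ring
  unfold sawErr
  have e3 : (fun j => ∑ m ∈ Finset.Icc 2 n, cellSlope t (fun i => v (node L J j) (t i)) m *
        (sawPrim α (t (m - 1)) (t m) (t n) - sawPrim α (t (m - 1)) (t m) (t (n - 1))))
      = ∑ m ∈ Finset.Icc 2 n,
          (sawPrim α (t (m - 1)) (t m) (t n) - sawPrim α (t (m - 1)) (t m) (t (n - 1)))
          • fun j => cellSlope t (fun i => v (node L J j) (t i)) m := by
    funext j
    simp [Finset.sum_apply, mul_comm]
  rw [e3, gip_sum_right]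
  refine Finset.sum_congr rfl fun m _ => ?_
  rw [gip_smul_right, e]
  ring

/-- The total error of the product-integration rule. -/
lemma exists_sum_ruleErr_le {ρ : ℝ} (hα : α ∈ Ioo (0 : ℝ) 1) (hL : 0 < L) (hT : 0 < T)
    (hσ : 0 < σ) (hγ : 1 ≤ γ) (hΓ : 1 ≤ Γ) (hcγ : 0 < cγ) (hρ : 1 < ρ) (hM : 0 ≤ M) (hc : 0 ≤ c) :
    ∃ C : ℝ, 0 ≤ C ∧ ∀ v, RegularField L T σ M c v → ∀ (J N : ℕ) (k : ℝ) (t : ℕ → ℝ), 1 ≤ J →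
      1 ≤ N → 0 < k → IsGradedMesh T γ Γ cγ k N t → (γ = 2 / σ → ρ * t 1 ≤ t N) →
      ∑ n ∈ Finset.Icc 1 N, gridNorm L J (fun j => ruleErr α t (v (node L J j)) n)
        ≤ C * errK σ γ k (t 1) (t N) := by
  obtain ⟨C1, hC1, hinc⟩ := exists_first_increment_bound (σ := σ) hL hT hM hc
  obtain ⟨K1, hK1, hk1⟩ := exists_sq_mul_rpow_le_errK (Γ := Γ) hT hσ hγ hcγ hρ
  obtain ⟨K2, hK2, hk2⟩ := exists_first_rpow_le_errK hT hσ hγ hΓ hcγ hρ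
  obtain ⟨K3, hK3, hk3⟩ := exists_sum_step_le_errK hT hσ hγ hΓ hcγ hρ
  set A := M * Γ ^ |σ - 2| + 2 * M * (Γ ^ 2) ^ |σ - 3| with hA
  have hA0 : 0 ≤ A := by positivity
  have hB0 : 0 ≤ tpow α T := tpow_nonneg hα.1 T
  have hG : 0 < Real.Gamma α := Real.Gamma_pos_of_pos hα.1
  set D1 := A * (2 * tpow α T * Γ ^ 2) with hD1
  set D2 := A * (2 * tpow α T * Γ ^ 2 + (6 * tpow α T * Γ + Γ ^ 2 * T ^ α / Real.Gamma α)
            * Γ ^ |σ - 2 / γ - 1|) with hD2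
  set D3 := M * Γ ^ |σ - 3| with hD3
  have hD1' : 0 ≤ D1 := by positivity
  have hD2' : 0 ≤ D2 := by positivity
  have hD3' : 0 ≤ D3 := by positivity
  refine ⟨tpow α T * (C1 * K2 + D3 * Γ ^ 2 * K3) + (D1 * K1 + D2 * K3), by positivity, ?_⟩
  intro v h J N k t hJ hN hk hm hend
  set E := errK σ γ k (t 1) (t N) with hE
  have hE0 : 0 ≤ E := errK_nonneg hk.le (hm.pos le_rfl hN) (hm.mono hN le_rfl)
  -- The first cell uses the plain increment of v; the other cells use the interpolation error.
  set κ : ℕ → ℝ := fun m => if m = 1 then C1 * t 1 ^ (σ - 1)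
    else D3 * t m ^ (σ - 3) * tstep t m ^ 2 with hκ
  have hκ0 : ∀ m, 1 ≤ m → m ≤ N → 0 ≤ κ m := by
    intro m h1 hmN
    have := hm.pos h1 hmN
    have := hm.pos le_rfl hN
    simp only [hκ]
    split_ifs <;> positivity
  have hsplit : ∀ n ∈ Finset.Icc 1 N, gridNorm L J (fun j => ruleErr α t (v (node L J j)) n)
      ≤ (∑ m ∈ Finset.Icc 1 n, cellDiff (tpow (α + 1)) t n m * κ m)
        + gridNorm L J (fun j => sawErr α t (fun i => v (node L J j) (t i)) n) := by
    intro n hn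
    rw [Finset.mem_Icc] at hn
    have e1 : (fun j => ruleErr α t (v (node L J j)) n)
        = ((fun j => ruleErr α t (v (node L J j)) n)
            - fun j => sawErr α t (fun i => v (node L J j) (t i)) n)
          + fun j => sawErr α t (fun i => v (node L J j) (t i)) n := by simp
    rw [e1]
    refine (gridNorm_add_le hL J _ _).trans (add_le_add ?_ le_rfl)
    refine gridNorm_le_of_dual hL (Finset.sum_nonneg fun m hmem => ?_) fun ψ hψ => ?_
    · rw [Finset.mem_Icc] at hmem
      exact mul_nonneg (hm.cellDiff_nonneg hα.1 hn.2 (hmem.2.trans hn.2))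
        (hκ0 m hmem.1 (hmem.2.trans hn.2))
    · rw [gip_sub_right, h.gip_ruleErr hL hα.1 hm hn.2, gip_sawErr]
      have hw := h.regularity.pairing hL hJ hψ
      refine hm.ruleErr_sub_sawErr_le hα.1 hn.1 hn.2 (φ := fun s => gip L J ψ fun j =>
        v (node L J j) s) (BddMeas.of_continuousOn hw.continuousOn
          fun s hs => h.abs_pairing_le hL hc hψ hs) ?_ ?_
      · intro s hs
        have h1 := hinc v h J hJ s (t 1) hs.1 hs.2.le (hm.le_T hN)
        have h2 := gip_le hL J ψ (fun j => v (node L J j) (t 1) - v (node L J j) s)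
        rw [hψ, one_mul] at h2
        have e2 : gip L J ψ (fun j => v (node L J j) (t 1) - v (node L J j) s)
          = gip L J ψ (fun j => v (node L J j) (t 1)) - gip L J ψ (fun j => v (node L J j) s) := by
          rw [← gip_sub_right]; rfl
        simp only [hκ, if_true]
        linarith
      · intro m h2 hmN s hs
        have h1 := hw.interp_error (hm.pos (by omega : 1 ≤ m - 1) (by omega))
          (hm.lt m (by omega) hmN) (hm.le_T hmN) (weight_le hm hΓ hM h2 hmN (σ - 3)) hs
        simp only [hκ, if_neg (show m ≠ 1 by omega)]
        exact (le_abs_self _).trans h1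
  refine (Finset.sum_le_sum hsplit).trans ?_
  rw [Finset.sum_add_distrib, add_mul]
  refine add_le_add ?_ ?_
  · refine (hm.sum_sum_cellDiff_le hα.1 hκ0).trans ?_
    rw [mul_assoc]
    refine mul_le_mul_of_nonneg_left ?_ hB0
    rw [← Finset.add_sum_Ioc_eq_sum_Icc hN, add_mul]
    refine add_le_add ?_ ?_
    · simp only [hκ, if_true]
      have e1 : tstep t 1 = t 1 := by simp [tstep, hm.zero]
      have e2 : t 1 ^ (σ - 1) * t 1 = t 1 ^ σ := by
        rw [← Real.rpow_add_one (hm.pos le_rfl hN).ne', sub_add_cancel]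
      calc tstep t 1 * (C1 * t 1 ^ (σ - 1)) = C1 * t 1 ^ σ := by rw [e1, ← e2]; ring
        _ ≤ C1 * (K2 * E) := mul_le_mul_of_nonneg_left (hk2 N k t hk hN hm hend) hC1
        _ = _ := by ring
    · have hset : Finset.Ioc 1 N = Finset.Icc 2 N := by ext; simp; omega
      rw [hset]
      have h3 := hk3 N k t hk hN hm hend
      calc ∑ m ∈ Finset.Icc 2 N, tstep t m * κ m
          ≤ ∑ m ∈ Finset.Icc 2 N, D3 * Γ ^ 2 * (k ^ 2 * (tstep t m * t m ^ (σ - 2 / γ - 1))) := by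
            refine Finset.sum_le_sum fun m hmem => ?_
            rw [Finset.mem_Icc] at hmem
            simp only [hκ, if_neg (show m ≠ 1 by omega)]
            have htm := hm.pos (by omega : 1 ≤ m) hmem.2
            have hkm := hm.tstep_pos (by omega : 1 ≤ m) hmem.2
            have e1 : t m ^ (2 - 2 / γ) * t m ^ (σ - 3) = t m ^ (σ - 2 / γ - 1) := by
              rw [← Real.rpow_add htm]; congr 1; ring
            calc _ ≤ tstep t m * (D3 * t m ^ (σ - 3) * (Γ ^ 2 * k ^ 2 * t m ^ (2 - 2 / γ))) := by
                  have := hm.tstep_sq_le hΓ hk (by omega : 1 ≤ m) hmem.2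
                  gcongr
              _ = D3 * Γ ^ 2 * (k ^ 2 * (tstep t m * (t m ^ (2 - 2 / γ) * t m ^ (σ - 3)))) := by
                  ring
              _ = _ := by rw [e1]
        _ = D3 * Γ ^ 2 * (k ^ 2 * ∑ m ∈ Finset.Icc 2 N, tstep t m * t m ^ (σ - 2 / γ - 1)) := by
            rw [← Finset.mul_sum, ← Finset.mul_sum]
        _ ≤ D3 * Γ ^ 2 * (K3 * E) := by gcongr
        _ = _ := by ring
  · have e0 : gridNorm L J (fun j => sawErr α t (fun i => v (node L J j) (t i)) 1) = 0 := by
      have : (fun j => sawErr α t (fun i => v (node L J j) (t i)) 1) = 0 := by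
        funext j; simp [sawErr]
      rw [this, gridNorm_zero]
    have hset : Finset.Ioc 1 N = Finset.Icc 2 N := by ext; simp; omega
    rw [← Finset.add_sum_Ioc_eq_sum_Icc hN, e0, zero_add, hset]
    -- For N = 1 there is no sawtooth, and t 2 is not a mesh node.
    rcases hN.eq_or_lt with h1 | h2
    · rw [← h1]
      simp
      positivity
    · set a : ℕ → ℕ → ℝ := fun m j => cellSlope t (fun i => v (node L J j) (t i)) m with ha
      have e1 : ∀ n, (fun j => sawErr α t (fun i => v (node L J j) (t i)) n)
          = ∑ m ∈ Finset.Icc 2 n, (sawPrim α (t (m - 1)) (t m) (t n)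
              - sawPrim α (t (m - 1)) (t m) (t (n - 1))) • a m := by
        intro n
        funext j
        simp [Finset.sum_apply, sawErr, ha, mul_comm]
      simp only [e1]
      refine (hm.sum_gridNorm_saw_le hα hΓ hk hγ h2 hL J a hA0 (σ := σ) ?_ ?_).trans ?_
      · intro m h3 hmN
        refine (h.gridNorm_slope_le hL hM hJ hm hΓ h3 hmN).trans ?_
        have := hm.pos (by omega : 1 ≤ m) hmN
        refine mul_le_mul_of_nonneg_right ?_ (by positivity)
        rw [hA]
        exact le_add_of_nonneg_right (by positivity)
      · intro m h3 hmN
        refine (h.gridNorm_slope_sub_le hL hM hJ hm hΓ h3 hmN).trans ?_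
        have := hm.pos (by omega : 1 ≤ m) hmN
        have := hm.tstep_pos (by omega : 1 ≤ m) hmN
        refine mul_le_mul_of_nonneg_right ?_ (by positivity)
        rw [hA]
        exact le_add_of_nonneg_left (by positivity)
      · have h3 := hk1 N k t hk hm hend 2 (by omega) h2
        have h4 := hk3 N k t hk hN hm hend
        have h5 := mul_le_mul_of_nonneg_left h3 hD1'
        have h6 := mul_le_mul_of_nonneg_left h4 hD2'
        linarith

end RegularField

/-! ### Spatial consistency -/

/-- A function on `[0, L]` with its first four derivatives, the zeroth and first bounded by `c` and
the fourth by `B`. -/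
structure C4Chain (L c B : ℝ) (g : ℕ → ℝ → ℝ) : Prop where
  deriv : ∀ i, i < 4 → ∀ x ∈ Icc 0 L, HasDerivWithinAt (g i) (g (i + 1) x) (Icc 0 L) x
  bound₀ : ∀ x ∈ Icc 0 L, |g 0 x| ≤ c
  bound₁ : ∀ x ∈ Icc 0 L, |g 1 x| ≤ c
  bound₄ : ∀ x ∈ Icc 0 L, |g 4 x| ≤ B

/-- The bound on the third derivative. -/
noncomputable def thirdBound (L c B : ℝ) : ℝ := 36 * c / L ^ 2 + B * L

/-- The bound on the second derivative. -/
noncomputable def secondBound (L c B : ℝ) : ℝ := 6 * c / L + thirdBound L c B * L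

/-- Iterating this replaces Taylor's formula; factorials are given away, so later constants are not
sharp. -/
lemma abs_le_pow_succ_of_deriv {F F' : ℝ → ℝ} {h K : ℝ} {n : ℕ} (hK : 0 ≤ K) (h0 : F 0 = 0)
    (hd : ∀ s ∈ Icc 0 h, HasDerivWithinAt F (F' s) (Icc 0 h) s)
    (hb : ∀ s ∈ Icc 0 h, |F' s| ≤ K * s ^ n) : ∀ s ∈ Icc 0 h, |F s| ≤ K * s ^ (n + 1) := by
  intro s hs
  have hsub : Icc 0 s ⊆ Icc 0 h := Icc_subset_Icc_right hs.2
  have := (convex_Icc 0 s).norm_image_sub_le_of_norm_hasDerivWithin_le (f := F) (f' := F')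
    (C := K * s ^ n) (fun r hr => (hd r (hsub hr)).mono hsub)
    (fun r hr => (hb r (hsub hr)).trans
      (mul_le_mul_of_nonneg_left (pow_le_pow_left₀ hr.1 hr.2 n) hK))
    (show (0 : ℝ) ∈ Icc 0 s from ⟨le_rfl, hs.1⟩) (show s ∈ Icc 0 s from ⟨hs.1, le_rfl⟩)
  rw [h0, sub_zero, sub_zero, Real.norm_eq_abs, Real.norm_of_nonneg hs.1] at this
  calc |F s| ≤ K * s ^ n * s := this
    _ = _ := by ring

namespace C4Chain

variable {L c B : ℝ} {g : ℕ → ℝ → ℝ}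

lemma const_nonneg (hg : C4Chain L c B g) (hL : 0 < L) : 0 ≤ c ∧ 0 ≤ B :=
  ⟨(abs_nonneg _).trans (hg.bound₀ 0 ⟨le_rfl, hL.le⟩),
    (abs_nonneg _).trans (hg.bound₄ 0 ⟨le_rfl, hL.le⟩)⟩

lemma exists_slope (hg : C4Chain L c B g) {i : ℕ} (hi : i < 4) {a b : ℝ} (ha : 0 ≤ a)
    (hab : a < b) (hb : b ≤ L) : ∃ ξ ∈ Ioo a b, g (i + 1) ξ = (g i b - g i a) / (b - a) := by
  have hsub : Icc a b ⊆ Icc 0 L := Icc_subset_Icc ha hb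
  refine exists_hasDerivAt_eq_slope (g i) (g (i + 1)) hab
    (fun x hx => ((hg.deriv i hi x (hsub hx)).continuousWithinAt).mono hsub) fun x hx => ?_
  exact (hg.deriv i hi x (hsub (Ioo_subset_Icc_self hx))).hasDerivAt
    (Icc_mem_nhds (ha.trans_lt hx.1) (hx.2.trans_le hb))

lemma abs_sub_le (hg : C4Chain L c B g) {i : ℕ} (hi : i < 4) {K : ℝ}
    (hK : ∀ x ∈ Icc 0 L, |g (i + 1) x| ≤ K) {x y : ℝ} (hx : x ∈ Icc 0 L) (hy : y ∈ Icc 0 L) :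
    |g i x - g i y| ≤ K * |x - y| :=
  (convex_Icc 0 L).norm_image_sub_le_of_norm_hasDerivWithin_le (hg.deriv i hi) hK hy hx

/-- In the first and in the last third of [0, L] the second derivative is somewhere at most 2c/(L/3)
= 6c/L. These points are at least L/3 apart, so the third derivative is somewhere at most 36c/L².
Integration of the fourth and then of the third derivative does the rest. -/
lemma bounds (hg : C4Chain L c B g) (hL : 0 < L) :
    (∀ x ∈ Icc 0 L, |g 3 x| ≤ thirdBound L c B) ∧
      ∀ x ∈ Icc 0 L, |g 2 x| ≤ secondBound L c B := by
  obtain ⟨hc, hB⟩ := hg.const_nonneg hL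
  have hpt : ∀ a b, 0 ≤ a → b ≤ L → b - a = L / 3 → ∃ ξ ∈ Ioo a b, |g 2 ξ| ≤ 6 * c / L := by
    intro a b ha hb hab
    obtain ⟨ξ, hξ, e⟩ := hg.exists_slope (i := 1) (by norm_num) ha (by linarith) hb
    refine ⟨ξ, hξ, ?_⟩
    rw [e, hab, abs_div, abs_of_pos (by positivity : 0 < L / 3), div_le_div_iff₀ (by positivity) hL]
    have := abs_sub (g 1 b) (g 1 a)
    have h1 := hg.bound₁ b ⟨by linarith, hb⟩
    have h2 := hg.bound₁ a ⟨ha, by linarith⟩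
    nlinarith
  obtain ⟨ξ, hξ, h1⟩ := hpt 0 (L / 3) le_rfl (by linarith) (by ring)
  obtain ⟨η, hη, h2⟩ := hpt (2 * L / 3) L (by positivity) le_rfl (by ring)
  obtain ⟨ζ, hζ, e⟩ := hg.exists_slope (i := 2) (by norm_num) hξ.1.le
    (show ξ < η by linarith [hξ.2, hη.1]) hη.2.le
  have h3 : |g 3 ζ| ≤ 36 * c / L ^ 2 := by
    rw [e, abs_div, abs_of_pos (by linarith [hξ.2, hη.1] : 0 < η - ξ),
      div_le_iff₀ (by linarith [hξ.2, hη.1])]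
    have h4 := abs_sub (g 2 η) (g 2 ξ)
    have h5 : 36 * c / L ^ 2 * (L / 3) ≤ 36 * c / L ^ 2 * (η - ξ) :=
      mul_le_mul_of_nonneg_left (by linarith [hξ.2, hη.1]) (by positivity)
    have h6 : 36 * c / L ^ 2 * (L / 3) = 2 * (6 * c / L) := by field_simp; ring
    linarith
  have hd : ∀ x ∈ Icc 0 L, ∀ y ∈ Icc 0 L, |x - y| ≤ L := by
    intro x hx y hy
    rw [abs_le]; constructor <;> linarith [hx.1, hx.2, hy.1, hy.2]
  have hζL : ζ ∈ Icc 0 L := ⟨by linarith [hξ.1, hζ.1], by linarith [hη.2, hζ.2]⟩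
  have hξL : ξ ∈ Icc 0 L := ⟨hξ.1.le, by linarith [hξ.2]⟩
  have hthird : ∀ x ∈ Icc 0 L, |g 3 x| ≤ thirdBound L c B := by
    intro x hx
    have h4 := hg.abs_sub_le (i := 3) (by norm_num) hg.bound₄ hx hζL
    have h5 := abs_add_le (g 3 x - g 3 ζ) (g 3 ζ)
    rw [sub_add_cancel] at h5
    have h6 := mul_le_mul_of_nonneg_left (hd x hx ζ hζL) hB
    unfold thirdBound
    linarith
  refine ⟨hthird, fun x hx => ?_⟩
  have hC3 : 0 ≤ thirdBound L c B := (abs_nonneg _).trans (hthird x hx)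
  have h4 := hg.abs_sub_le (i := 2) (by norm_num) hthird hx hξL
  have h5 := abs_add_le (g 2 x - g 2 ξ) (g 2 ξ)
  rw [sub_add_cancel] at h5
  have h6 := mul_le_mul_of_nonneg_left (hd x hx ξ hξL) hC3
  unfold secondBound
  linarith

lemma comp_add (hg : C4Chain L c B g) {i : ℕ} (hi : i < 4) {x h : ℝ} (hx : 0 ≤ x)
    (hxh : x + h ≤ L) {s : ℝ} (hs : s ∈ Icc 0 h) :
    HasDerivWithinAt (fun s => g i (x + s)) (g (i + 1) (x + s)) (Icc 0 h) s := by
  have hmap : MapsTo (fun s => x + s) (Icc 0 h) (Icc 0 L) := fun r hr =>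
    ⟨by linarith [hr.1], by linarith [hr.2]⟩
  have := HasDerivWithinAt.comp s (hg.deriv i hi (x + s) (hmap hs))
    ((hasDerivWithinAt_id s (Icc 0 h)).const_add x) hmap
  exact this.congr_deriv (by simp)

lemma comp_sub (hg : C4Chain L c B g) {i : ℕ} (hi : i < 4) {x h : ℝ} (hx : x ≤ L)
    (hxh : 0 ≤ x - h) {s : ℝ} (hs : s ∈ Icc 0 h) :
    HasDerivWithinAt (fun s => g i (x - s)) (-g (i + 1) (x - s)) (Icc 0 h) s := by
  have hmap : MapsTo (fun s => x - s) (Icc 0 h) (Icc 0 L) := fun r hr =>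
    ⟨by linarith [hr.2], by linarith [hr.1]⟩
  have := HasDerivWithinAt.comp s (hg.deriv i hi (x - s) (hmap hs))
    ((hasDerivWithinAt_id s (Icc 0 h)).const_sub x) hmap
  exact this.congr_deriv (by simp)

/-- The even and odd parts of s ↦ g(x ± s) are differentiated in s. Each derivative exchanges
parity, and the chain stops at a difference that is O(s) by the bound on the next derivative. -/
lemma consistency (hg : C4Chain L c B g) (hL : 0 < L) {x h : ℝ} (hh : 0 < h) (h1 : 0 ≤ x - h)
    (h2 : x + h ≤ L) :
    |(g 0 (x + h) - 2 * g 0 x + g 0 (x - h)) / h ^ 2 - g 2 x| ≤ 2 * B * h ^ 2 ∧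
      |(g 0 (x + h) - g 0 (x - h)) / (2 * h) - g 1 x| ≤ thirdBound L c B * h ^ 2 ∧
      |(g 0 (x - h) + g 0 x + g 0 (x + h)) / 3 - g 0 x| ≤ secondBound L c B * h ^ 2 := by
  obtain ⟨hc, hB⟩ := hg.const_nonneg hL
  obtain ⟨hb3, hb2⟩ := hg.bounds hL
  have hx0 : 0 ≤ x := by linarith
  have hxL : x ≤ L := by linarith
  have hxm : x ∈ Icc 0 L := ⟨hx0, hxL⟩
  have hC3 : 0 ≤ thirdBound L c B := (abs_nonneg _).trans (hb3 x hxm)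
  have hC2 : 0 ≤ secondBound L c B := (abs_nonneg _).trans (hb2 x hxm)
  have hp : ∀ s ∈ Icc 0 h, x + s ∈ Icc 0 L := fun s hs =>
    ⟨by linarith [hs.1], by linarith [hs.2]⟩
  have hm : ∀ s ∈ Icc 0 h, x - s ∈ Icc 0 L := fun s hs =>
    ⟨by linarith [hs.2], by linarith [hs.1]⟩
  have hlip : ∀ i, i < 4 → ∀ K, (∀ x ∈ Icc 0 L, |g (i + 1) x| ≤ K) → ∀ s ∈ Icc 0 h,
      |g i (x + s) - g i (x - s)| ≤ 2 * K * s ^ 1 := by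
    intro i hi K hK s hs
    refine (hg.abs_sub_le hi hK (hp s hs) (hm s hs)).trans (le_of_eq ?_)
    rw [show x + s - (x - s) = 2 * s by ring, abs_of_nonneg (by linarith [hs.1])]
    ring
  have hodd : ∀ i, i < 4 → ∀ s ∈ Icc 0 h, HasDerivWithinAt (fun s => g i (x + s) - g i (x - s))
      (g (i + 1) (x + s) + g (i + 1) (x - s)) (Icc 0 h) s := by
    intro i hi s hs
    exact ((hg.comp_add hi hx0 h2 hs).sub (hg.comp_sub hi hxL h1 hs)).congr_deriv (by ring)
  have heven : ∀ i, i < 4 → ∀ s ∈ Icc 0 h,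
      HasDerivWithinAt (fun s => g i (x + s) + g i (x - s) - 2 * g i x)
      (g (i + 1) (x + s) - g (i + 1) (x - s)) (Icc 0 h) s := by
    intro i hi s hs
    exact (((hg.comp_add hi hx0 h2 hs).add (hg.comp_sub hi hxL h1 hs)).sub_const _).congr_deriv
      (by ring)
  have hid : ∀ a s, HasDerivWithinAt (fun s : ℝ => 2 * a * s) (2 * a) (Icc 0 h) s := by
    intro a s
    simpa using (hasDerivWithinAt_id s (Icc 0 h)).const_mul (2 * a)
  have hhm : h ∈ Icc 0 h := ⟨hh.le, le_rfl⟩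
  refine ⟨?_, ?_, ?_⟩
  · have s2 := abs_le_pow_succ_of_deriv (by positivity) (by simp; ring) (heven 2 (by norm_num))
      (hlip 3 (by norm_num) B hg.bound₄)
    have s1 := abs_le_pow_succ_of_deriv (F := fun s => g 1 (x + s) - g 1 (x - s) - 2 * g 2 x * s)
      (by positivity) (by simp)
      (fun s hs => (hodd 1 (by norm_num) s hs).sub (hid (g 2 x) s)) s2
    have s0 := abs_le_pow_succ_of_deriv
      (F := fun s => g 0 (x + s) + g 0 (x - s) - 2 * g 0 x - g 2 x * s ^ 2)
      (by positivity) (by simp; ring)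
      (fun s hs => by
        have hq : HasDerivWithinAt (fun s : ℝ => g 2 x * s ^ 2) (2 * g 2 x * s) (Icc 0 h) s := by
          have := ((hasDerivWithinAt_id s (Icc 0 h)).pow 2).const_mul (g 2 x)
          refine HasDerivWithinAt.congr_deriv this ?_
          simp; ring
        exact (heven 0 (by norm_num) s hs).sub hq) s1
    have := s0 h hhm
    have e : (g 0 (x + h) - 2 * g 0 x + g 0 (x - h)) / h ^ 2 - g 2 x
        = (g 0 (x + h) + g 0 (x - h) - 2 * g 0 x - g 2 x * h ^ 2) / h ^ 2 := by
      field_simp; ring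
    rw [e, abs_div, abs_of_pos (by positivity : 0 < h ^ 2), div_le_iff₀ (by positivity)]
    calc _ ≤ _ := this
      _ = _ := by ring
  · have s1 := abs_le_pow_succ_of_deriv (by positivity) (by simp; ring) (heven 1 (by norm_num))
      (hlip 2 (by norm_num) _ hb3)
    have s0 := abs_le_pow_succ_of_deriv (F := fun s => g 0 (x + s) - g 0 (x - s) - 2 * g 1 x * s)
      (by positivity) (by simp)
      (fun s hs => (hodd 0 (by norm_num) s hs).sub (hid (g 1 x) s)) s1
    have := s0 h hhm
    have e : (g 0 (x + h) - g 0 (x - h)) / (2 * h) - g 1 x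
        = (g 0 (x + h) - g 0 (x - h) - 2 * g 1 x * h) / (2 * h) := by
      field_simp
    rw [e, abs_div, abs_of_pos (by positivity : 0 < 2 * h), div_le_iff₀ (by positivity)]
    calc _ ≤ _ := this
      _ = _ := by ring
  · have s0 := abs_le_pow_succ_of_deriv (by positivity) (by simp; ring) (heven 0 (by norm_num))
      (hlip 1 (by norm_num) _ hb2)
    have := s0 h hhm
    have e : (g 0 (x - h) + g 0 x + g 0 (x + h)) / 3 - g 0 x
        = (g 0 (x + h) + g 0 (x - h) - 2 * g 0 x) / 3 := by ring
    rw [e, abs_div, abs_of_pos (by norm_num : (0:ℝ) < 3), div_le_iff₀ (by norm_num)]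
    have h3 : 0 ≤ secondBound L c B * h ^ 2 := by positivity
    calc _ ≤ _ := this
      _ = 2 * (secondBound L c B * h ^ 2) := by ring
      _ ≤ _ := by linarith

end C4Chain

/-! ### The exact solution on the spatial grid. -/

lemma node_succ (L : ℝ) (J j : ℕ) : node L J (j + 1) = node L J j + L / J := by
  unfold node; push_cast; ring

lemma node_pred (L : ℝ) (J : ℕ) {j : ℕ} (hj : 1 ≤ j) : node L J (j - 1) = node L J j - L / J := by
  unfold node; push_cast [Nat.cast_sub hj]; ring

lemma node_mem_Icc {L : ℝ} (hL : 0 < L) {J j : ℕ} (hJ : 1 ≤ J) (hj : j ≤ J) :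
    node L J j ∈ Icc 0 L := by
  have hJ' : (0 : ℝ) < J := by exact_mod_cast hJ
  have hjJ : (j : ℝ) ≤ J := by exact_mod_cast hj
  unfold node
  refine ⟨by positivity, ?_⟩
  calc (j : ℝ) * (L / J) ≤ J * (L / J) := by gcongr
    _ = L := by field_simp

/-- The hypotheses on the exact solution that enter the spatial estimates. -/
structure SmoothField (L T c B : ℝ) (u : ℝ → ℝ → ℝ) : Prop where
  chain : ∀ t ∈ Ioc 0 T, C4Chain L c B (fun i x => dxPart L i u x t)
  continuous_time : ∀ x ∈ Icc 0 L, ContinuousOn (u x) (Icc 0 T)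
  boundary_left : ∀ t ∈ Ioc 0 T, u 0 t = 0
  boundary_right : ∀ t ∈ Ioc 0 T, u L t = 0

lemma dxPart_zero (L : ℝ) (u : ℝ → ℝ → ℝ) (x t : ℝ) : dxPart L 0 u x t = u x t := by
  simp [dxPart]

lemma c4Chain_of_contDiffOn {L c B : ℝ} (hL : 0 < L) {u : ℝ → ℝ → ℝ} {t : ℝ}
    (h : ContDiffOn ℝ 4 (fun x => u x t) (Icc 0 L))
    (h0 : ∀ x ∈ Icc 0 L, |u x t| ≤ c) (h1 : ∀ x ∈ Icc 0 L, |dxPart L 1 u x t| ≤ c)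
    (h4 : ∀ x ∈ Icc 0 L, |dxPart L 4 u x t| ≤ B) :
    C4Chain L c B (fun i x => dxPart L i u x t) where
  deriv := fun i hi x hx => by
    have hd := h.differentiableOn_iteratedDerivWithin (m := i) (by exact_mod_cast hi)
      (uniqueDiffOn_Icc hL)
    have := (hd x hx).hasDerivWithinAt
    rw [← iteratedDerivWithin_succ] at this
    exact this
  bound₀ := fun x hx => by rw [dxPart_zero]; exact h0 x hx
  bound₁ := h1
  bound₄ := h4

namespace SmoothField

variable {L T c B : ℝ} {u : ℝ → ℝ → ℝ}

lemma abs_le (h : SmoothField L T c B u) {x t : ℝ} (hx : x ∈ Icc 0 L) (ht : t ∈ Ioc 0 T) :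
    |u x t| ≤ c := by
  have := (h.chain t ht).bound₀ x hx
  rwa [dxPart_zero] at this

lemma bddMeas (h : SmoothField L T c B u) {x : ℝ} (hx : x ∈ Icc 0 L) : BddMeas T (u x) :=
  BddMeas.of_continuousOn ((h.continuous_time x hx).mono Ioc_subset_Icc_self)
    fun _ ht => h.abs_le hx ht

/-- Nothing is assumed on the dependence of u_x on time; it is measurable as a limit of difference
quotients of u, which is continuous in time. The increments (L - x)/(n + 1) stay inside [0, L]. -/
lemma bddMeas_deriv (h : SmoothField L T c B u) {x : ℝ} (hx : x ∈ Ioo 0 L) :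
    BddMeas T (dxPart L 1 u x) := by
  refine ⟨⟨c, fun t ht => (h.chain t ht).bound₁ x (Ioo_subset_Icc_self hx)⟩, ?_⟩
  set δ : ℕ → ℝ := fun n => (L - x) / (n + 1) with hδ
  have hδ0 : ∀ n, 0 < δ n := fun n => div_pos (by linarith [hx.2]) (by positivity)
  have hδL : ∀ n, x + δ n ∈ Icc 0 L := fun n => by
    refine ⟨by linarith [hδ0 n, hx.1], ?_⟩
    have : δ n ≤ L - x := div_le_self (by linarith [hx.2]) (by linarith [n.cast_nonneg (α := ℝ)])
    linarith
  have hδt : Filter.Tendsto δ Filter.atTop (nhdsWithin 0 {0}ᶜ) := by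
    refine tendsto_nhdsWithin_iff.2 ⟨?_, Filter.Eventually.of_forall fun n => (hδ0 n).ne'⟩
    have h1 := (tendsto_one_div_add_atTop_nhds_zero_nat (𝕜 := ℝ)).const_mul (L - x)
    rw [mul_zero] at h1
    refine h1.congr fun n => ?_
    simp only [hδ]; ring
  refine aestronglyMeasurable_of_tendsto_ae Filter.atTop
    (f := fun n t => (δ n)⁻¹ • (u (x + δ n) t - u x t)) (fun n => ?_) ?_
  · exact ((h.bddMeas (hδL n)).2.sub (h.bddMeas (Ioo_subset_Icc_self hx)).2).const_smul ((δ n)⁻¹)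
  · refine (MeasureTheory.ae_restrict_iff' measurableSet_Ioc).2
      (Filter.Eventually.of_forall fun t ht => ?_)
    have hd := ((h.chain t ht).deriv 0 (by norm_num) x (Ioo_subset_Icc_self hx)).hasDerivAt
      (Icc_mem_nhds hx.1 hx.2)
    have := hd.tendsto_slope_zero.comp hδt
    simp only [dxPart_zero] at this
    exact this

lemma node_estimates (h : SmoothField L T c B u) (hL : 0 < L) {J : ℕ} {t : ℝ}
    (ht : t ∈ Ioc 0 T) {j : ℕ} (h1 : 1 ≤ j) (hj : j < J) :
    |secDiff (L / J) (fun i => u (node L J i) t) j - dxPart L 2 u (node L J j) t|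
        ≤ 2 * B * (L / J) ^ 2 ∧
      |centDiff (L / J) (fun i => u (node L J i) t) j - dxPart L 1 u (node L J j) t|
        ≤ thirdBound L c B * (L / J) ^ 2 ∧
      |mean3 (fun i => u (node L J i) t) j - u (node L J j) t|
        ≤ secondBound L c B * (L / J) ^ 2 := by
  have hJ' : (0 : ℝ) < J := by exact_mod_cast (by omega : 0 < J)
  have hn1 := node_mem_Icc hL (by omega) (show j + 1 ≤ J by omega)
  have hn2 := node_mem_Icc hL (by omega) (show j - 1 ≤ J by omega)
  rw [node_succ] at hn1
  rw [node_pred L J h1] at hn2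
  have := (h.chain t ht).consistency hL (x := node L J j) (h := L / J) (by positivity) hn2.1 hn1.2
  simp only [dxPart_zero] at this
  unfold secDiff centDiff mean3
  simp only [node_succ, node_pred L J h1]
  exact this

lemma abs_quotient_le (h : SmoothField L T c B u) (hL : 0 < L) {J : ℕ} {t : ℝ}
    (ht : t ∈ Ioc 0 T) {j : ℕ} (hj : j < J) :
    |(u (node L J (j + 1)) t - u (node L J j) t) / (L / J)| ≤ c := by
  have hJ' : (0 : ℝ) < J := by exact_mod_cast (by omega : 0 < J)
  have hh : (0 : ℝ) < L / J := by positivity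
  have h2 := (h.chain t ht).abs_sub_le (i := 0) (by norm_num) (h.chain t ht).bound₁
    (node_mem_Icc hL (by omega) (show j + 1 ≤ J by omega))
    (node_mem_Icc hL (by omega) (show j ≤ J by omega))
  simp only [dxPart_zero] at h2
  rw [node_succ, add_sub_cancel_left, abs_of_pos hh, ← node_succ] at h2
  rw [abs_div, abs_of_pos hh, div_le_iff₀ hh]
  exact h2

end SmoothField

/-! ### The equation integrated over a time step -/

lemma abs_le_gridNorm {L : ℝ} (hL : 0 < L) {J j : ℕ} (h1 : 1 ≤ j) (hj : j < J) (w : ℕ → ℝ) :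
    |w j| ≤ (√(L / J))⁻¹ * gridNorm L J w := by
  have hJ' : (0 : ℝ) < J := by exact_mod_cast (by omega : 0 < J)
  have hh : (0 : ℝ) < L / J := by positivity
  rw [le_inv_mul_iff₀ (Real.sqrt_pos.2 hh), ← Real.sqrt_sq_eq_abs, ← Real.sqrt_mul hh.le]
  refine Real.sqrt_le_sqrt (mul_le_mul_of_nonneg_left ?_ hh.le)
  exact Finset.single_le_sum (f := fun s => w s ^ 2) (fun _ _ => sq_nonneg _)
    (Finset.mem_Ico.2 ⟨h1, hj⟩)

lemma le_of_deriv_lower_bound {T p K : ℝ} (hp : p < 1) {φ φ' : ℝ → ℝ}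
    (hd : ∀ t ∈ Ioc 0 T, HasDerivWithinAt φ (φ' t) (Ioc 0 T) t)
    (hb : ∀ t ∈ Ioc 0 T, -(K * t ^ (p - 2)) ≤ φ' t) :
    ∀ t ∈ Ioc 0 T, φ t ≤ φ T + K / (1 - p) * t ^ (p - 1) - K / (1 - p) * T ^ (p - 1) := by
  intro t ht
  have hT : 0 < T := ht.1.trans_le ht.2
  have hmono : MonotoneOn (fun s => φ s - K / (1 - p) * s ^ (p - 1)) (Ioc 0 T) := by
    refine monotoneOn_of_hasDerivWithinAt_nonneg (convex_Ioc 0 T)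
      (f' := fun s => φ' s - K / (1 - p) * ((p - 1) * s ^ (p - 1 - 1))) ?_ ?_ ?_
    · refine ContinuousOn.sub (fun s hs => (hd s hs).continuousWithinAt) ?_
      exact continuousOn_const.mul (continuousOn_id.rpow_const fun s hs => Or.inl hs.1.ne')
    · intro s hs
      have hs' := interior_subset hs
      exact ((hd s hs').mono interior_subset).sub
        ((Real.hasDerivAt_rpow_const (Or.inl hs'.1.ne')).hasDerivWithinAt.const_mul _)
    · intro s hs
      have h1 := hb s (interior_subset hs)
      have e : K / (1 - p) * ((p - 1) * s ^ (p - 1 - 1)) = -(K * s ^ (p - 2)) := by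
        rw [show p - 1 - 1 = p - 2 by ring]
        have : 1 - p ≠ 0 := by linarith
        field_simp
        ring
      simp only [e]
      linarith
  have := hmono ht ⟨hT, le_rfl⟩ ht.2
  simp only at this
  linarith

/-- Integrating the derivative back from T gives |φ| = O(1 + t^(p-1)), integrable at 0. The exponent
is first lowered to p = min(σ, 1/2) < 1, which avoids the logarithm at σ = 1. -/
lemma intervalIntegrable_of_deriv_bound {T σ K : ℝ} (hσ : 0 < σ) (hK : 0 ≤ K) {φ φ' : ℝ → ℝ}
    (hd : ∀ t ∈ Ioc 0 T, HasDerivWithinAt φ (φ' t) (Ioc 0 T) t)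
    (hb : ∀ t ∈ Ioc 0 T, |φ' t| ≤ K * t ^ (σ - 2)) {a b : ℝ} (ha : 0 ≤ a) (hab : a ≤ b)
    (hbT : b ≤ T) : IntervalIntegrable φ MeasureTheory.volume a b := by
  set p := min σ (1 / 2) with hp
  have hp0 : 0 < p := lt_min hσ (by norm_num)
  have hp1 : p < 1 := (min_le_right _ _).trans_lt (by norm_num)
  set K' := K * T ^ (σ - p) with hK'
  have hb' : ∀ t ∈ Ioc 0 T, |φ' t| ≤ K' * t ^ (p - 2) := fun t ht => by
    refine (hb t ht).trans ?_
    rw [hK', mul_assoc, show σ - 2 = (σ - p) + (p - 2) by ring, Real.rpow_add ht.1]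
    have h1 : t ^ (σ - p) ≤ T ^ (σ - p) :=
      Real.rpow_le_rpow ht.1.le ht.2 (sub_nonneg.2 (min_le_left _ _))
    have := Real.rpow_nonneg ht.1.le (p - 2)
    gcongr
  have hbound : ∀ t ∈ Ioc 0 T, |φ t| ≤ |φ T| + K' / (1 - p) * t ^ (p - 1) := fun t ht => by
    have hT : 0 < T := ht.1.trans_le ht.2
    have h0 : 0 ≤ K' / (1 - p) * T ^ (p - 1) := by
      have : 0 < 1 - p := by linarith
      positivity
    have h1 := le_of_deriv_lower_bound hp1 hd (fun s hs => neg_le_of_abs_le (hb' s hs)) t ht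
    have h2 := le_of_deriv_lower_bound hp1 (φ := fun s => -φ s) (fun s hs => (hd s hs).neg)
      (fun s hs => neg_le_neg (le_of_abs_le (hb' s hs))) t ht
    rw [abs_le]
    constructor <;> linarith [le_abs_self (φ T), neg_abs_le (φ T)]
  have hdom : IntervalIntegrable (fun t => |φ T| + K' / (1 - p) * t ^ (p - 1))
      MeasureTheory.volume a b :=
    intervalIntegrable_const.add
      ((intervalIntegral.intervalIntegrable_rpow' (by linarith)).const_mul _)
  have hsub : Ioc a b ⊆ Ioc 0 T := Ioc_subset_Ioc ha hbT
  refine hdom.mono_fun' ?_ ?_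
  · rw [uIoc_of_le hab]
    exact ContinuousOn.aestronglyMeasurable
      (fun s hs => ((hd s (hsub hs)).continuousWithinAt).mono hsub) measurableSet_Ioc
  · rw [uIoc_of_le hab]
    refine (MeasureTheory.ae_restrict_iff' measurableSet_Ioc).2
      (Filter.Eventually.of_forall fun t ht => ?_)
    exact hbound t (hsub ht)

/-- The pointwise bound degenerates with J, which is harmless because only integrability is
concluded. -/
lemma HasTimeRegularity.intervalIntegrable_node {L T σ M : ℝ} {f : ℝ → ℝ → ℝ}
    (hf : HasTimeRegularity L T σ M f) (hL : 0 < L) (hT : 0 < T) (hσ : 0 < σ) {J j : ℕ}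
    (h1 : 1 ≤ j) (hj : j < J) {a b : ℝ} (ha : 0 ≤ a) (hab : a ≤ b) (hb : b ≤ T) :
    IntervalIntegrable (f (node L J j)) MeasureTheory.volume a b := by
  have hM := hf.nonneg hT
  refine intervalIntegrable_of_deriv_bound hσ (K := (√(L / J))⁻¹ * M) (by positivity)
    (φ' := dtPart T f (node L J j))
    (fun t ht => (hf.differentiable _ (node_mem_Ioo hL h1 hj) t ht).hasDerivWithinAt)
    (fun t ht => ?_) ha hab hb
  rw [mul_assoc]
  refine (abs_le_gridNorm hL h1 hj (fun i => dtPart T f (node L J i) t)).trans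
    (mul_le_mul_of_nonneg_left ?_ (by positivity))
  exact (hf.slice_bounds (by omega) ht).1

/-- All terms of the equation are integrable up to t = 0, where u is merely continuous; so the
fundamental theorem of calculus covers the first cell too. -/
lemma IsExactSolution.integrated {α L T c B : ℝ} {f u : ℝ → ℝ → ℝ} {u₀ : ℝ → ℝ}
    (hu : IsExactSolution α L T f u₀ u) (hs : SmoothField L T c B u) (hα : 0 < α) {x : ℝ}
    (hx : x ∈ Ioo 0 L) (hv : BddMeas T (dxPart L 2 u x)) {a b : ℝ} (ha : 0 ≤ a) (hab : a ≤ b)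
    (hb : b ≤ T) (hf : IntervalIntegrable (f x) MeasureTheory.volume a b) :
    u x b - u x a = (∫ s in a..b, f x s) - (∫ s in a..b, u x s * dxPart L 1 u x s)
      + ∫ s in a..b, fracInt α (dxPart L 2 u x) s := by
  have i1 := ((hs.bddMeas (Ioo_subset_Icc_self hx)).mul (hs.bddMeas_deriv hx)).intervalIntegrable
    ha hab hb
  have i2 := (bddMeas_fracInt hα hv).intervalIntegrable ha hab hb
  rw [← intervalIntegral.integral_sub hf i1, ← intervalIntegral.integral_add (hf.sub i1) i2]
  symm
  refine intervalIntegral.integral_eq_sub_of_hasDerivAt_of_le hab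
    ((hu.continuous_time x (Ioo_subset_Icc_self hx)).mono (Icc_subset_Icc ha hb)) (fun s hs => ?_)
    ((hf.sub i1).add i2)
  have hsT : s ∈ Ioc 0 T := ⟨ha.trans_lt hs.1, hs.2.le.trans hb⟩
  have h1 := ((hu.differentiable_time x hx s hsT).hasDerivWithinAt).hasDerivAt
    (Ioc_mem_nhds hsT.1 (hs.2.trans_le hb))
  refine h1.congr_deriv ?_
  have h2 := hu.equation x hx s hsT
  unfold dtPart at h2
  change derivWithin (u x) (Ioc 0 T) s + _ - fracInt α (dxPart L 2 u x) s = _ at h2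
  linarith

/-! ### The residual of the convection term -/

lemma integral_mean3 {w : ℕ → ℝ → ℝ} {a b : ℝ} {j : ℕ}
    (h : ∀ i, i ≤ j + 1 → IntervalIntegrable (w i) MeasureTheory.volume a b) :
    ∫ s in a..b, mean3 (fun i => w i s) j = mean3 (fun i => ∫ s in a..b, w i s) j := by
  have h1 := h (j - 1) (by omega)
  have h2 := h j (by omega)
  have h3 := h (j + 1) le_rfl
  unfold mean3
  rw [intervalIntegral.integral_div, intervalIntegral.integral_add (h1.add h2) h3,
    intervalIntegral.integral_add h1 h2]

lemma integral_centDiff {w : ℕ → ℝ → ℝ} {a b h : ℝ} {j : ℕ}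
    (hw : ∀ i, i ≤ j + 1 → IntervalIntegrable (w i) MeasureTheory.volume a b) :
    ∫ s in a..b, centDiff h (fun i => w i s) j = centDiff h (fun i => ∫ s in a..b, w i s) j := by
  have h1 := hw (j - 1) (by omega)
  have h3 := hw (j + 1) le_rfl
  unfold centDiff
  rw [intervalIntegral.integral_div, intervalIntegral.integral_sub h3 h1]

lemma integral_secDiff {w : ℕ → ℝ → ℝ} {a b h : ℝ} {j : ℕ}
    (hw : ∀ i, i ≤ j + 1 → IntervalIntegrable (w i) MeasureTheory.volume a b) :
    ∫ s in a..b, secDiff h (fun i => w i s) j = secDiff h (fun i => ∫ s in a..b, w i s) j := by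
  have h1 := hw (j - 1) (by omega)
  have h2 := hw j (by omega)
  have h3 := hw (j + 1) le_rfl
  unfold secDiff
  rw [intervalIntegral.integral_div, intervalIntegral.integral_add (h3.sub (h2.const_mul 2)) h1,
    intervalIntegral.integral_sub h3 (h2.const_mul 2), intervalIntegral.integral_const_mul]

lemma abs_mean3_le {w : ℕ → ℝ} {K : ℝ} {j : ℕ} (h : ∀ i, i ≤ j + 1 → |w i| ≤ K) :
    |mean3 w j| ≤ K := by
  have h1 := abs_le.1 (h (j - 1) (by omega))
  have h2 := abs_le.1 (h j (by omega))
  have h3 := abs_le.1 (h (j + 1) le_rfl)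
  unfold mean3
  rw [abs_le]
  constructor <;> linarith [h1.1, h1.2, h2.1, h2.2, h3.1, h3.2]

lemma abs_centDiff_le {w : ℕ → ℝ} {h K : ℝ} {j : ℕ} (h1 : 1 ≤ j)
    (hK : ∀ i, i ≤ j → |(w (i + 1) - w i) / h| ≤ K) : |centDiff h w j| ≤ K := by
  have e : centDiff h w j
      = ((w (j + 1) - w j) / h + (w (j - 1 + 1) - w (j - 1)) / h) / 2 := by
    unfold centDiff
    rw [Nat.sub_add_cancel h1, ← add_div, mul_comm, div_mul_eq_div_div]
    ring
  have h2 := abs_le.1 (hK j le_rfl)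
  have h3 := abs_le.1 (hK (j - 1) (by omega))
  rw [e, abs_le]
  constructor <;> linarith [h2.1, h2.2, h3.1, h3.2]

/-- Applied to time differences of u: the estimates in time are available for u_xx, and reach u and
its difference quotients through the second difference. -/
lemma abs_mean3_centDiff_le_secDiff {L : ℝ} (hL : 0 < L) {J j : ℕ} (h1 : 1 ≤ j) (hj : j < J)
    {w : ℕ → ℝ} (h0 : w 0 = 0) (hwJ : w J = 0) :
    |mean3 w j| ≤ L * (√L * gridNorm L J (secDiff (L / J) w)) ∧
      |centDiff (L / J) w j| ≤ √L * gridNorm L J (secDiff (L / J) w) :=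
  ⟨abs_mean3_le fun i hi => abs_le_secDiff hL (by omega) w h0 hwJ i (by omega),
    abs_centDiff_le h1 fun i hi => abs_diff_le_secDiff hL (by omega) w h0 hwJ i (by omega)⟩

namespace SmoothField

variable {L T c B : ℝ} {u : ℝ → ℝ → ℝ} {J : ℕ}

lemma const_nonneg (h : SmoothField L T c B u) (hL : 0 < L) (hT : 0 < T) :
    0 ≤ c ∧ 0 ≤ B ∧ 0 ≤ thirdBound L c B ∧ 0 ≤ secondBound L c B := by
  have hc := h.chain T ⟨hT, le_rfl⟩
  obtain ⟨h3, h2⟩ := hc.bounds hL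
  exact ⟨(hc.const_nonneg hL).1, (hc.const_nonneg hL).2,
    (abs_nonneg _).trans (h3 0 ⟨le_rfl, hL.le⟩), (abs_nonneg _).trans (h2 0 ⟨le_rfl, hL.le⟩)⟩

lemma node_zero (h : SmoothField L T c B u) {s : ℝ} (hs : s ∈ Ioc 0 T) : u (node L J 0) s = 0 := by
  have : node L J 0 = 0 := by simp [node]
  rw [this, h.boundary_left s hs]

lemma node_last (h : SmoothField L T c B u) (hJ : 1 ≤ J) {s : ℝ} (hs : s ∈ Ioc 0 T) :
    u (node L J J) s = 0 := by
  have hJ' : (J : ℝ) ≠ 0 := by exact_mod_cast (by omega : J ≠ 0)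
  have : node L J J = L := by unfold node; field_simp
  rw [this, h.boundary_right s hs]

lemma abs_mean3_le (h : SmoothField L T c B u) (hL : 0 < L) {j : ℕ} (hj : j < J) {s : ℝ}
    (hs : s ∈ Ioc 0 T) : |mean3 (fun i => u (node L J i) s) j| ≤ c :=
  _root_.abs_mean3_le fun _ hi => h.abs_le (node_mem_Icc hL (by omega) (by omega)) hs

lemma abs_centDiff_le (h : SmoothField L T c B u) (hL : 0 < L) {j : ℕ} (h1 : 1 ≤ j) (hj : j < J)
    {s : ℝ} (hs : s ∈ Ioc 0 T) : |centDiff (L / J) (fun i => u (node L J i) s) j| ≤ c :=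
  _root_.abs_centDiff_le h1 fun _ hi => h.abs_quotient_le hL hs (by omega)

/-- The discrete convection term is consistent. -/
lemma abs_conv_sub_le (h : SmoothField L T c B u) (hL : 0 < L) (hT : 0 < T) {j : ℕ} (h1 : 1 ≤ j)
    (hj : j < J) {s : ℝ} (hs : s ∈ Ioc 0 T) :
    |conv (L / J) (fun i => u (node L J i) s) (fun i => u (node L J i) s) j
      - u (node L J j) s * dxPart L 1 u (node L J j) s|
      ≤ c * (thirdBound L c B + secondBound L c B) * (L / J) ^ 2 := by
  obtain ⟨hc, -, -, -⟩ := h.const_nonneg hL hT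
  obtain ⟨-, e1, e2⟩ := h.node_estimates hL hs h1 hj
  have b1 := h.abs_mean3_le hL hj hs
  have b2 := (h.chain s hs).bound₁ _ (node_mem_Icc hL (by omega) hj.le)
  unfold conv
  set m := mean3 (fun i => u (node L J i) s) j
  set q := centDiff (L / J) (fun i => u (node L J i) s) j
  set y := u (node L J j) s
  set y' := dxPart L 1 u (node L J j) s
  have e : m * q - y * y' = m * (q - y') + (m - y) * y' := by ring
  rw [e]
  refine (abs_add_le _ _).trans ?_
  rw [abs_mul, abs_mul]
  have p1 := mul_le_mul b1 e1 (abs_nonneg _) hc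
  have p2 := mul_le_mul e2 b2 (abs_nonneg _) ((abs_nonneg _).trans e2)
  linarith

lemma abs_secDiff_sub_le (h : SmoothField L T c B u) (hL : 0 < L) {j : ℕ} (h1 : 1 ≤ j)
    (hj : j < J) {s r : ℝ} (hs : s ∈ Ioc 0 T) (hr : r ∈ Ioc 0 T) :
    |secDiff (L / J) (fun i => u (node L J i) s - u (node L J i) r) j
      - (dxPart L 2 u (node L J j) s - dxPart L 2 u (node L J j) r)| ≤ 4 * B * (L / J) ^ 2 := by
  have e1 := (h.node_estimates hL hs h1 hj).1
  have e2 := (h.node_estimates hL hr h1 hj).1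
  have e : secDiff (L / J) (fun i => u (node L J i) s - u (node L J i) r) j
      = secDiff (L / J) (fun i => u (node L J i) s) j
        - secDiff (L / J) (fun i => u (node L J i) r) j := by
    unfold secDiff; ring
  rw [e, _root_.abs_le]
  have e1 := _root_.abs_le.1 e1
  have e2 := _root_.abs_le.1 e2
  constructor <;> linarith [e1.1, e1.2, e2.1, e2.2]

lemma gridNorm_le_add_of_abs_sub_le {L : ℝ} (hL : 0 < L) {J : ℕ} {a b : ℕ → ℝ} {K : ℝ}
    (hK : 0 ≤ K) (h : ∀ j, 1 ≤ j → j < J → |a j - b j| ≤ K) :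
    gridNorm L J a ≤ gridNorm L J b + K * √L := by
  have h1 := gridNorm_add_le hL J (a - b) b
  rw [sub_add_cancel] at h1
  have h2 := gridNorm_le_of_abs_le hL hK (w := a - b) h
  linarith

lemma gridNorm_secDiff_sub_le (h : SmoothField L T c B u) (hL : 0 < L) (hT : 0 < T)
    {s r : ℝ} (hs : s ∈ Ioc 0 T) (hr : r ∈ Ioc 0 T) :
    gridNorm L J (secDiff (L / J) (fun i => u (node L J i) s - u (node L J i) r))
      ≤ gridNorm L J (fun j => dxPart L 2 u (node L J j) s - dxPart L 2 u (node L J j) r)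
        + 4 * B * (L / J) ^ 2 * √L := by
  obtain ⟨-, hB, -, -⟩ := h.const_nonneg hL hT
  exact gridNorm_le_add_of_abs_sub_le hL (by positivity)
    fun j h1 hj => h.abs_secDiff_sub_le hL h1 hj hs hr

/-- Two states of the field are compared through the difference of their second derivatives. -/
lemma abs_conv_sub_conv_le (h : SmoothField L T c B u) (hL : 0 < L) (hT : 0 < T) {j : ℕ}
    (h1 : 1 ≤ j) (hj : j < J) {s r : ℝ} (hs : s ∈ Ioc 0 T) (hr : r ∈ Ioc 0 T) :
    |conv (L / J) (fun i => u (node L J i) s) (fun i => u (node L J i) s) j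
      - conv (L / J) (fun i => u (node L J i) r) (fun i => u (node L J i) r) j|
      ≤ c * (L + 1) * √L *
        (gridNorm L J (fun j => dxPart L 2 u (node L J j) s - dxPart L 2 u (node L J j) r)
          + 4 * B * (L / J) ^ 2 * √L) := by
  obtain ⟨hc, hB, -, -⟩ := h.const_nonneg hL hT
  obtain ⟨d1, d2⟩ := abs_mean3_centDiff_le_secDiff hL h1 hj
    (w := fun i => u (node L J i) s - u (node L J i) r)
    (by simp only [h.node_zero hs, h.node_zero hr, sub_zero])
    (by simp only [h.node_last (by omega : 1 ≤ J) hs, h.node_last (by omega : 1 ≤ J) hr, sub_zero])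
  have hd := h.gridNorm_secDiff_sub_le (J := J) hL hT hs hr
  set X := gridNorm L J (secDiff (L / J) (fun i => u (node L J i) s - u (node L J i) r))
  set Y := gridNorm L J (fun j => dxPart L 2 u (node L J j) s - dxPart L 2 u (node L J j) r)
    + 4 * B * (L / J) ^ 2 * √L
  have b1 := h.abs_mean3_le hL hj hr
  have b2 := h.abs_centDiff_le hL h1 hj hs
  have e : conv (L / J) (fun i => u (node L J i) s) (fun i => u (node L J i) s) j
      - conv (L / J) (fun i => u (node L J i) r) (fun i => u (node L J i) r) j
      = mean3 (fun i => u (node L J i) s - u (node L J i) r) j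
          * centDiff (L / J) (fun i => u (node L J i) s) j
        + mean3 (fun i => u (node L J i) r) j
          * centDiff (L / J) (fun i => u (node L J i) s - u (node L J i) r) j := by
    unfold conv mean3 centDiff; ring
  rw [e]
  refine (abs_add_le _ _).trans ?_
  rw [abs_mul, abs_mul]
  have p1 := mul_le_mul d1 b2 (abs_nonneg _) ((abs_nonneg _).trans d1)
  have p2 := mul_le_mul b1 d2 (abs_nonneg _) hc
  have p3 := mul_le_mul_of_nonneg_left hd (by positivity : 0 ≤ c * (L + 1) * √L)
  calc _ ≤ L * (√L * X) * c + c * (√L * X) := add_le_add p1 p2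
    _ = c * (L + 1) * √L * X := by ring
    _ ≤ _ := p3

end SmoothField

/-- The residual of the discrete convection term in a time step. -/
noncomputable def convRes (L : ℝ) (J : ℕ) (t : ℕ → ℝ) (u : ℝ → ℝ → ℝ) (n j : ℕ) : ℝ :=
  tstep t n * conv (L / J) (fun i => cellVal (fun m => u (node L J i) (t m)) n)
      (fun i => cellVal (fun m => u (node L J i) (t m)) n) j
    - ∫ s in (t (n - 1))..(t n), u (node L J j) s * dxPart L 1 u (node L J j) s

lemma abs_mul_sub_integral_le {a b A K : ℝ} (hab : a ≤ b) {F : ℝ → ℝ}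
    (hF : IntervalIntegrable F MeasureTheory.volume a b)
    (h : ∀ s ∈ Ioc a b, |A - F s| ≤ K) : |(b - a) * A - ∫ s in a..b, F s| ≤ K * (b - a) := by
  have e : (b - a) * A - ∫ s in a..b, F s = ∫ s in a..b, (A - F s) := by
    rw [intervalIntegral.integral_sub intervalIntegrable_const hF,
      intervalIntegral.integral_const, smul_eq_mul]
  rw [e]
  have := intervalIntegral.norm_integral_le_of_norm_le_const (a := a) (b := b)
    (f := fun s => A - F s) (C := K) (fun s hs => h s (by rwa [uIoc_of_le hab] at hs))
  rwa [Real.norm_eq_abs, abs_of_nonneg (sub_nonneg.2 hab)] at this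

namespace SmoothField

variable {L T σ M c B γ Γ cγ k c₂ : ℝ} {u : ℝ → ℝ → ℝ} {J N : ℕ} {t : ℕ → ℝ}

/-- No cancellation is needed: freezing u at t₁ costs t₁^(σ-1) per unit time on a cell of length t₁.
-/
lemma exists_gridNorm_convRes_first_le (h : SmoothField L T c B u)
    (hv : RegularField L T σ M c₂ (dxPart L 2 u)) (hL : 0 < L) (hT : 0 < T) (hM : 0 ≤ M)
    (hc₂ : 0 ≤ c₂) :
    ∃ C : ℝ, 0 ≤ C ∧ ∀ (J N : ℕ) (k cγ : ℝ) (t : ℕ → ℝ), 1 ≤ J → 1 ≤ N →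
      IsGradedMesh T γ Γ cγ k N t →
      gridNorm L J (convRes L J t u 1) ≤ C * (t 1 ^ σ + t 1 * (L / J) ^ 2) := by
  obtain ⟨C, hC, hinc⟩ := RegularField.exists_first_increment_bound (σ := σ) hL hT hM hc₂
  obtain ⟨hc, hB, h3, h2⟩ := h.const_nonneg hL hT
  set Λ := c * (L + 1) * √L with hΛ
  set Θ := Λ * (4 * B * √L) + c * (thirdBound L c B + secondBound L c B) with hΘ
  refine ⟨(Λ * C + Θ) * √L, by positivity, fun J N k cγ t hJ hN hm => ?_⟩
  have ht1 := hm.mem_Ioc le_rfl hN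
  have hp : t 1 ^ (σ - 1) * t 1 = t 1 ^ σ := by
    rw [← Real.rpow_add_one ht1.1.ne', sub_add_cancel]
  have h1σ : 0 ≤ t 1 ^ σ := Real.rpow_nonneg ht1.1.le _
  have h1h : 0 ≤ t 1 * (L / J) ^ 2 := mul_nonneg ht1.1.le (sq_nonneg _)
  have key : ∀ j, 1 ≤ j → j < J → |convRes L J t u 1 j|
      ≤ Λ * C * t 1 ^ σ + Θ * (t 1 * (L / J) ^ 2) := by
    intro j hj1 hj
    have hx := node_mem_Icc hL hJ hj.le
    have hi := ((h.bddMeas hx).mul (h.bddMeas_deriv (node_mem_Ioo hL hj1 hj))).intervalIntegrable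
      le_rfl ht1.1.le ht1.2
    have := abs_mul_sub_integral_le
      (A := conv (L / J) (fun i => u (node L J i) (t 1)) (fun i => u (node L J i) (t 1)) j)
      (K := Λ * (C * t 1 ^ (σ - 1) + 4 * B * (L / J) ^ 2 * √L)
        + c * (thirdBound L c B + secondBound L c B) * (L / J) ^ 2) ht1.1.le hi fun s hs => by
      have hsT : s ∈ Ioc 0 T := ⟨hs.1, hs.2.trans ht1.2⟩
      refine (abs_sub_le _ (conv (L / J) (fun i => u (node L J i) s)
        (fun i => u (node L J i) s) j) _).trans (add_le_add ?_ (h.abs_conv_sub_le hL hT hj1 hj hsT))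
      refine (h.abs_conv_sub_conv_le hL hT hj1 hj ht1 hsT).trans ?_
      have := hinc _ hv J hJ s (t 1) hs.1 hs.2 ht1.2
      gcongr
    have e : convRes L J t u 1 j = (t 1 - 0) * conv (L / J) (fun i => u (node L J i) (t 1))
        (fun i => u (node L J i) (t 1)) j
        - ∫ s in (0:ℝ)..t 1, u (node L J j) s * dxPart L 1 u (node L J j) s := by
      simp [convRes, tstep, cellVal, hm.zero]
    rw [e]
    refine this.trans (le_of_eq ?_)
    rw [← hp, hΘ]; ring
  refine (gridNorm_le_of_abs_le hL (by positivity) key).trans ?_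
  have p1 : Λ * C * t 1 ^ σ ≤ (Λ * C + Θ) * t 1 ^ σ := by
    have : 0 ≤ Θ := by positivity
    gcongr; linarith
  have p2 : Θ * (t 1 * (L / J) ^ 2) ≤ (Λ * C + Θ) * (t 1 * (L / J) ^ 2) := by
    have : 0 ≤ Λ * C := by positivity
    gcongr; linarith
  calc _ ≤ ((Λ * C + Θ) * t 1 ^ σ + (Λ * C + Θ) * (t 1 * (L / J) ^ 2)) * √L := by gcongr
    _ = _ := by ring

-- The convection term is expanded about the mean w of the end values. The terms linear in the
-- deviation d have constant coefficients and integrate to a trapezoidal error of third order; the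
-- quadratic term is estimated pointwise by the Landau bound.
set_option maxHeartbeats 800000 in
lemma exists_gridNorm_convRes_le (h : SmoothField L T c B u)
    (hv : RegularField L T σ M c₂ (dxPart L 2 u)) (hL : 0 < L) (hT : 0 < T) (hM : 0 ≤ M)
    (hc₂ : 0 ≤ c₂) (hΓ : 1 ≤ Γ) :
    ∃ C : ℝ, 0 ≤ C ∧ ∀ (J N : ℕ) (k cγ : ℝ) (t : ℕ → ℝ), 1 ≤ J →
      IsGradedMesh T γ Γ cγ k N t → ∀ n, 2 ≤ n → n ≤ N →
      gridNorm L J (convRes L J t u n)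
        ≤ C * (tstep t n ^ 3 * t n ^ (σ - 3) + tstep t n * (L / J) ^ 2) := by
  obtain ⟨C, hC, hinc⟩ := RegularField.exists_cell_increment_bound (σ := σ) (γ := γ) hL hT hM hc₂ hΓ
  obtain ⟨hc, hB, h3, h2⟩ := h.const_nonneg hL hT
  set R := √L with hR
  have hR0 : 0 ≤ R := Real.sqrt_nonneg _
  have hR2 : R ^ 2 = L := Real.sq_sqrt hL.le
  set C₁ := L * R * R * (2 * C ^ 2) + c * (L + 1) * R * (M * Γ ^ |σ - 3|) with hC₁
  set C₂ := L * R * R * (2 * (4 * B * R) ^ 2 * L ^ 2)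
    + c * (thirdBound L c B + secondBound L c B) + c * (L + 1) * R * (4 * B * R) with hC₂
  have hC₁0 : 0 ≤ C₁ := by positivity
  have hC₂0 : 0 ≤ C₂ := by positivity
  refine ⟨(C₁ + C₂) * R, by positivity, fun J N k cγ t hJ hm n hn2 hn => ?_⟩
  have hJ' : (1 : ℝ) ≤ J := by exact_mod_cast hJ
  have hb := hm.mem_Ioc (by omega : 1 ≤ n) hn
  have ha := hm.mem_Ioc (by omega : 1 ≤ n - 1) (by omega)
  have hκ := hm.tstep_pos (by omega : 1 ≤ n) hn
  have hab : t (n - 1) ≤ t n := (hm.lt n (by omega) hn).le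
  set κ := tstep t n with hκd
  have hκab : κ = t n - t (n - 1) := rfl
  set a := t (n - 1)
  set b := t n
  set H := (L / J) ^ 2 with hH
  have hH0 : 0 ≤ H := sq_nonneg _
  have hHL : H ≤ L ^ 2 := by
    rw [hH]; gcongr; exact div_le_self hL.le hJ'
  set v := dxPart L 2 u
  set w : ℕ → ℝ := fun i => (u (node L J i) b + u (node L J i) a) / 2 with hw
  set d : ℝ → ℕ → ℝ := fun s i => u (node L J i) s - w i with hd
  set P := b ^ ((σ - 3) / 2) with hP
  have hP0 : 0 ≤ P := Real.rpow_nonneg hb.1.le _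
  have hP2 : P ^ 2 = b ^ (σ - 3) := by
    rw [hP, ← Real.rpow_natCast, ← Real.rpow_mul hb.1.le]; congr 1; push_cast; ring
  have hmem : ∀ s ∈ Icc a b, s ∈ Ioc 0 T := fun s hs => ⟨ha.1.trans_le hs.1, hs.2.trans hb.2⟩
  have hd0 : ∀ s ∈ Icc a b, d s 0 = 0 := fun s hs => by
    simp only [hd, hw, h.node_zero (hmem s hs), h.node_zero ha, h.node_zero hb]; norm_num
  have hdJ : ∀ s ∈ Icc a b, d s J = 0 := fun s hs => by
    simp only [hd, hw, h.node_last hJ (hmem s hs), h.node_last hJ ha, h.node_last hJ hb]; norm_num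
  have hsec : ∀ s ∈ Icc a b, ∀ j, 1 ≤ j → j < J → |secDiff (L / J) (d s) j
      - (v (node L J j) s - (v (node L J j) b + v (node L J j) a) / 2)| ≤ 4 * B * H := by
    intro s hs j hj1 hj
    have e1 := _root_.abs_le.1 (h.abs_secDiff_sub_le hL hj1 hj (hmem s hs) ha)
    have e2 := _root_.abs_le.1 (h.abs_secDiff_sub_le hL hj1 hj (hmem s hs) hb)
    have e : secDiff (L / J) (d s) j
        = (secDiff (L / J) (fun i => u (node L J i) s - u (node L J i) a) j
          + secDiff (L / J) (fun i => u (node L J i) s - u (node L J i) b) j) / 2 := by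
      simp only [hd, hw, secDiff]; ring
    rw [e, _root_.abs_le]
    constructor <;> linarith [e1.1, e1.2, e2.1, e2.2]
  have hX : ∀ s ∈ Icc a b, gridNorm L J (secDiff (L / J) (d s))
      ≤ C * (κ * P) + 4 * B * H * R := by
    intro s hs
    refine (gridNorm_le_add_of_abs_sub_le hL (by positivity) (hsec s hs)).trans ?_
    have e1 := hinc _ hv J N k cγ t hJ hm n hn2 hn s hs a ⟨le_rfl, hab⟩
    have e2 := hinc _ hv J N k cγ t hJ hm n hn2 hn s hs b ⟨hab, le_rfl⟩
    have e3 := gridNorm_add_le hL J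
      ((1 / 2 : ℝ) • fun j => v (node L J j) s - v (node L J j) a)
      ((1 / 2 : ℝ) • fun j => v (node L J j) s - v (node L J j) b)
    rw [gridNorm_smul, gridNorm_smul, abs_of_pos (by norm_num : (0 : ℝ) < 1 / 2)] at e3
    have e4 : (fun j => v (node L J j) s - (v (node L J j) b + v (node L J j) a) / 2)
        = ((1 / 2 : ℝ) • fun j => v (node L J j) s - v (node L J j) a)
          + ((1 / 2 : ℝ) • fun j => v (node L J j) s - v (node L J j) b) := by
      funext j; simp only [Pi.add_apply, Pi.smul_apply, smul_eq_mul]; ring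
    rw [e4]
    linarith
  have hint : ∀ i, i ≤ J → IntervalIntegrable (fun s => d s i) MeasureTheory.volume a b :=
    fun i hi => ((h.bddMeas (node_mem_Icc hL hJ hi)).intervalIntegrable ha.1.le hab hb.2).sub
      intervalIntegrable_const
  set D : ℕ → ℝ := fun i => ∫ s in a..b, d s i with hD
  have hDz : ∀ i, (∀ s ∈ Icc a b, d s i = 0) → D i = 0 := fun i hi => by
    simp only [hD]
    rw [intervalIntegral.integral_congr (g := fun _ => (0 : ℝ))
      (fun s hs => hi s (by rwa [uIcc_of_le hab] at hs)), intervalIntegral.integral_zero]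
  -- D is minus the trapezoidal error of u on the cell; its second difference is that of u_xx up to
  -- O(h²) per unit time.
  have hDX : gridNorm L J (secDiff (L / J) D)
      ≤ M * Γ ^ |σ - 3| * (κ ^ 3 * b ^ (σ - 3)) + 4 * B * H * κ * R := by
    have htr := hv.gridNorm_trapezoid_le hL hM hJ hm hΓ hn2 hn
    refine (gridNorm_le_add_of_abs_sub_le hL (K := 4 * B * H * κ) (by positivity) (b := -fun j =>
      κ * half (fun i => v (node L J j) (t i)) n - ∫ s in a..b, v (node L J j) s)
      fun j hj1 hj => ?_).trans (by rw [gridNorm_neg]; linarith)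
    have hvi := (hv.bddMeas (node_mem_Ioo hL hj1 hj)).intervalIntegrable ha.1.le hab hb.2
    have hsi : IntervalIntegrable (fun s => secDiff (L / J) (d s) j)
        MeasureTheory.volume a b := by
      unfold secDiff
      exact (((hint _ (by omega)).sub ((hint _ (by omega)).const_mul 2)).add
        (hint _ (by omega))).div_const _
    have h1 := abs_mul_sub_integral_le (A := (v (node L J j) b + v (node L J j) a) / 2)
      (K := 4 * B * H) hab (hvi.sub hsi) fun s hs => by
        refine le_trans (le_of_eq ?_) (hsec s (Ioc_subset_Icc_self hs) j hj1 hj)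
        congr 1; ring
    rw [intervalIntegral.integral_sub hvi hsi,
      integral_secDiff fun i hi => hint i (by omega)] at h1
    have e : secDiff (L / J) D j - (-fun j =>
        κ * half (fun i => v (node L J j) (t i)) n - ∫ s in a..b, v (node L J j) s) j
        = (b - a) * ((v (node L J j) b + v (node L J j) a) / 2)
          - ((∫ s in a..b, v (node L J j) s) - secDiff (L / J) D j) := by
      simp only [Pi.neg_apply, half, hκab]; ring
    rw [e]
    exact h1
  have key : ∀ j, 1 ≤ j → j < J → |convRes L J t u n j|
      ≤ C₁ * (κ ^ 3 * b ^ (σ - 3)) + C₂ * (κ * H) := by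
    intro j hj1 hj
    have hx := node_mem_Icc hL hJ hj.le
    set q := centDiff (L / J) w j with hq
    set p := mean3 w j with hp
    have hqc : |q| ≤ c := by
      have e1 := _root_.abs_le.1 (h.abs_centDiff_le hL hj1 hj ha)
      have e2 := _root_.abs_le.1 (h.abs_centDiff_le hL hj1 hj hb)
      have e : q = (centDiff (L / J) (fun i => u (node L J i) a) j
          + centDiff (L / J) (fun i => u (node L J i) b) j) / 2 := by
        simp only [hq, hw, centDiff]; ring
      rw [e, _root_.abs_le]
      constructor <;> linarith [e1.1, e1.2, e2.1, e2.2]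
    have hpc : |p| ≤ c := by
      have e1 := _root_.abs_le.1 (h.abs_mean3_le hL hj ha)
      have e2 := _root_.abs_le.1 (h.abs_mean3_le hL hj hb)
      have e : p = (mean3 (fun i => u (node L J i) a) j
          + mean3 (fun i => u (node L J i) b) j) / 2 := by
        simp only [hp, hw, mean3]; ring
      rw [e, _root_.abs_le]
      constructor <;> linarith [e1.1, e1.2, e2.1, e2.2]
    have i1 := ((h.bddMeas hx).mul (h.bddMeas_deriv (node_mem_Ioo hL hj1 hj))).intervalIntegrable
      ha.1.le hab hb.2
    have i2 : IntervalIntegrable (fun s => q * mean3 (d s) j) MeasureTheory.volume a b := by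
      unfold mean3
      exact ((((hint _ (by omega)).add (hint _ (by omega))).add
        (hint _ (by omega))).div_const _).const_mul _
    have i3 : IntervalIntegrable (fun s => p * centDiff (L / J) (d s) j)
        MeasureTheory.volume a b := by
      unfold centDiff
      exact (((hint _ (by omega)).sub (hint _ (by omega))).div_const _).const_mul _
    -- Once the two linear terms are moved into the integrand, only the quadratic term and the
    -- spatial error remain pointwise.
    have h1 := abs_mul_sub_integral_le (A := conv (L / J) w w j)
      (K := L * R * R * (C * (κ * P) + 4 * B * H * R) ^ 2
        + c * (thirdBound L c B + secondBound L c B) * H) hab ((i1.sub i2).sub i3) fun s hs => by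
        have hs' := Ioc_subset_Icc_self hs
        have e : conv (L / J) w w j - (u (node L J j) s * dxPart L 1 u (node L J j) s
            - q * mean3 (d s) j - p * centDiff (L / J) (d s) j)
            = -(mean3 (d s) j * centDiff (L / J) (d s) j)
              + (conv (L / J) (fun i => u (node L J i) s) (fun i => u (node L J i) s) j
                - u (node L J j) s * dxPart L 1 u (node L J j) s) := by
          simp only [conv, hq, hp, hd, mean3, centDiff]; ring
        rw [e]
        refine (abs_add_le _ _).trans
          (add_le_add ?_ (h.abs_conv_sub_le hL hT hj1 hj (hmem s hs')))
        obtain ⟨m1, m2⟩ := abs_mean3_centDiff_le_secDiff hL hj1 hj (hd0 s hs') (hdJ s hs')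
        have hX' := hX s hs'
        have hX0 := gridNorm_nonneg L J (secDiff (L / J) (d s))
        set X := gridNorm L J (secDiff (L / J) (d s))
        rw [abs_neg, abs_mul]
        calc _ ≤ L * (R * X) * (R * X) :=
              mul_le_mul m1 m2 (abs_nonneg _) (by positivity)
          _ = L * R * R * X ^ 2 := by ring
          _ ≤ _ := by gcongr
    rw [intervalIntegral.integral_sub (i1.sub i2) i3, intervalIntegral.integral_sub i1 i2,
      intervalIntegral.integral_const_mul, intervalIntegral.integral_const_mul,
      integral_mean3 fun i hi => hint i (by omega),
      integral_centDiff fun i hi => hint i (by omega)] at h1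
    obtain ⟨m1, m2⟩ := abs_mean3_centDiff_le_secDiff hL hj1 hj (hDz 0 hd0) (hDz J hdJ)
    set X := gridNorm L J (secDiff (L / J) D)
    have g1 : |q * mean3 D j| ≤ c * (L * (R * X)) := by
      rw [abs_mul]; exact mul_le_mul hqc m1 (abs_nonneg _) hc
    have g2 : |p * centDiff (L / J) D j| ≤ c * (R * X) := by
      rw [abs_mul]; exact mul_le_mul hpc m2 (abs_nonneg _) hc
    have e : convRes L J t u n j = (b - a) * conv (L / J) w w j
        - ∫ s in a..b, u (node L J j) s * dxPart L 1 u (node L J j) s := by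
      simp only [convRes, cellVal, if_neg (show n ≠ 1 by omega), half]
      rfl
    rw [e]
    have g3 : c * (L + 1) * R * X ≤ c * (L + 1) * R
        * (M * Γ ^ |σ - 3| * (κ ^ 3 * b ^ (σ - 3)) + 4 * B * H * κ * R) := by gcongr
    -- Here P² = b^(σ-3), and one factor of H² is bounded by L².
    have g4 : (C * (κ * P) + 4 * B * H * R) ^ 2
        ≤ 2 * C ^ 2 * (κ ^ 2 * b ^ (σ - 3)) + 2 * (4 * B * R) ^ 2 * L ^ 2 * H := by
      have s1 : (C * (κ * P) + 4 * B * H * R) ^ 2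
          ≤ 2 * (C * (κ * P)) ^ 2 + 2 * (4 * B * H * R) ^ 2 :=
        add_sq_le.trans_eq (mul_add _ _ _)
      have s2 : (4 * B * R) ^ 2 * (H * H) ≤ (4 * B * R) ^ 2 * (L ^ 2 * H) := by gcongr
      rw [← hP2]
      calc _ ≤ _ := s1
        _ = 2 * C ^ 2 * (κ ^ 2 * P ^ 2) + 2 * ((4 * B * R) ^ 2 * (H * H)) := by ring
        _ ≤ 2 * C ^ 2 * (κ ^ 2 * P ^ 2) + 2 * ((4 * B * R) ^ 2 * (L ^ 2 * H)) := by gcongr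
        _ = _ := by ring
    have g5 := mul_le_mul_of_nonneg_left g4 (by positivity : 0 ≤ L * R * R * κ)
    rw [← hκab] at h1 ⊢
    set A := κ * conv (L / J) w w j
    set I := ∫ s in a..b, u (node L J j) s * dxPart L 1 u (node L J j) s
    have h2 : |A - I| ≤ L * R * R * κ * (C * (κ * P) + 4 * B * H * R) ^ 2
        + c * (thirdBound L c B + secondBound L c B) * H * κ + c * (L + 1) * R * X := by
      have h1' := _root_.abs_le.1 h1
      have g1' := _root_.abs_le.1 g1
      have g2' := _root_.abs_le.1 g2
      generalize (C * (κ * P) + 4 * B * H * R) ^ 2 = Z at *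
      rw [_root_.abs_le]
      constructor <;> linarith only [h1'.1, h1'.2, g1'.1, g1'.2, g2'.1, g2'.2]
    calc |A - I| ≤ _ := h2
      _ ≤ L * R * R * κ * (2 * C ^ 2 * (κ ^ 2 * b ^ (σ - 3)) + 2 * (4 * B * R) ^ 2 * L ^ 2 * H)
          + c * (thirdBound L c B + secondBound L c B) * H * κ
          + c * (L + 1) * R * (M * Γ ^ |σ - 3| * (κ ^ 3 * b ^ (σ - 3)) + 4 * B * H * κ * R) :=
        add_le_add (add_le_add g5 le_rfl) g3
      _ = _ := by rw [hC₁, hC₂]; ring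
  have hq0 : 0 ≤ κ ^ 3 * b ^ (σ - 3) := by rw [← hP2]; positivity
  refine (gridNorm_le_of_abs_le hL (by positivity) key).trans ?_
  have p1 : C₁ * (κ ^ 3 * b ^ (σ - 3)) ≤ (C₁ + C₂) * (κ ^ 3 * b ^ (σ - 3)) := by
    gcongr; linarith
  have p2 : C₂ * (κ * H) ≤ (C₁ + C₂) * (κ * H) := by
    gcongr; linarith
  calc _ ≤ ((C₁ + C₂) * (κ ^ 3 * b ^ (σ - 3)) + (C₁ + C₂) * (κ * H)) * R := by gcongr
    _ = _ := by ring

end SmoothField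

/-! ### The residual of the exact solution in the scheme -/

lemma sum_Icc_one_eq {N : ℕ} (hN : 1 ≤ N) (F : ℕ → ℝ) :
    ∑ n ∈ Finset.Icc 1 N, F n = F 1 + ∑ n ∈ Finset.Icc 2 N, F n := by
  rw [← Finset.add_sum_Ioc_eq_sum_Icc hN]; rfl

lemma IsGradedMesh.sum_tstep {T γ Γ cγ k : ℝ} {N : ℕ} {t : ℕ → ℝ}
    (hm : IsGradedMesh T γ Γ cγ k N t) (n : ℕ) : ∑ m ∈ Finset.Icc 1 n, tstep t m = t n := by
  induction n with
  | zero => simp [hm.zero]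
  | succ n ih => rw [Finset.sum_Icc_succ_top (by omega), ih]; simp [tstep]

lemma IsGradedMesh.cube_mul_rpow_le {T γ Γ cγ k σ : ℝ} {N : ℕ} {t : ℕ → ℝ}
    (hm : IsGradedMesh T γ Γ cγ k N t) (hΓ : 1 ≤ Γ) (hk : 0 < k) {n : ℕ} (h1 : 1 ≤ n)
    (hn : n ≤ N) : tstep t n ^ 3 * t n ^ (σ - 3)
      ≤ Γ ^ 2 * k ^ 2 * (tstep t n * t n ^ (σ - 2 / γ - 1)) := by
  have h0 := hm.pos h1 hn
  have hκ := hm.tstep_pos h1 hn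
  have h2 := hm.tstep_sq_le hΓ hk h1 hn
  have hp := Real.rpow_nonneg h0.le (σ - 3)
  have e : t n ^ (σ - 2 / γ - 1) = t n ^ (2 - 2 / γ) * t n ^ (σ - 3) := by
    rw [← Real.rpow_add h0]; congr 1; ring
  rw [e]
  calc _ = tstep t n * t n ^ (σ - 3) * tstep t n ^ 2 := by ring
    _ ≤ tstep t n * t n ^ (σ - 3) * (Γ ^ 2 * k ^ 2 * t n ^ (2 - 2 / γ)) := by gcongr
    _ = _ := by ring

lemma exists_sum_cube_le_errK {T σ γ Γ cγ ρ : ℝ} (hT : 0 < T) (hσ : 0 < σ) (hγ : 1 ≤ γ)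
    (hΓ : 1 ≤ Γ) (hcγ : 0 < cγ) (hρ : 1 < ρ) :
    ∃ C : ℝ, 0 < C ∧ ∀ (N : ℕ) (k : ℝ) (t : ℕ → ℝ), 0 < k → 1 ≤ N →
      IsGradedMesh T γ Γ cγ k N t → (γ = 2 / σ → ρ * t 1 ≤ t N) →
      ∑ n ∈ Finset.Icc 2 N, tstep t n ^ 3 * t n ^ (σ - 3) ≤ C * errK σ γ k (t 1) (t N) := by
  obtain ⟨C, hC, h⟩ := exists_sum_step_le_errK hT hσ hγ hΓ hcγ hρ
  refine ⟨Γ ^ 2 * C, by positivity, fun N k t hk hN hm hend => ?_⟩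
  have h1 : ∑ n ∈ Finset.Icc 2 N, tstep t n ^ 3 * t n ^ (σ - 3)
      ≤ ∑ n ∈ Finset.Icc 2 N, Γ ^ 2 * k ^ 2 * (tstep t n * t n ^ (σ - 2 / γ - 1)) :=
    Finset.sum_le_sum fun n hn => by
      rw [Finset.mem_Icc] at hn
      exact hm.cube_mul_rpow_le hΓ hk (by omega) hn.2
  rw [← Finset.mul_sum, mul_assoc] at h1
  refine h1.trans ?_
  rw [mul_assoc]
  exact mul_le_mul_of_nonneg_left (h N k t hk hN hm hend) (by positivity)

/-- The grid values of `u` in the `n`-th cell of the scheme. -/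
noncomputable def cellField (L : ℝ) (J : ℕ) (t : ℕ → ℝ) (u : ℝ → ℝ → ℝ) (n j : ℕ) : ℝ :=
  cellVal (fun m => u (node L J j) (t m)) n

/-- The residual of the grid values of `u` in the `n`-th step of the scheme. -/
noncomputable def schemeRes (α L : ℝ) (J : ℕ) (t : ℕ → ℝ) (u : ℝ → ℝ → ℝ) (g : ℕ → ℕ → ℝ)
    (n j : ℕ) : ℝ :=
  u (node L J j) (t n) - u (node L J j) (t (n - 1))
    + tstep t n * conv (L / J) (cellField L J t u n) (cellField L J t u n) j
    - (∑ m ∈ Finset.Icc 1 n, cellDiff (tpow (α + 1)) t n m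
      * secDiff (L / J) (cellField L J t u m) j) - tstep t n * g n j

lemma SmoothField.abs_secDiff_cellField_sub_le {L T c B γ Γ cγ k : ℝ} {u : ℝ → ℝ → ℝ} {J N : ℕ}
    {t : ℕ → ℝ} (h : SmoothField L T c B u) (hL : 0 < L) (hm : IsGradedMesh T γ Γ cγ k N t)
    {m : ℕ} (h1 : 1 ≤ m) (hmN : m ≤ N) {j : ℕ} (hj1 : 1 ≤ j) (hj : j < J) :
    |secDiff (L / J) (cellField L J t u m) j
      - cellVal (fun i => dxPart L 2 u (node L J j) (t i)) m| ≤ 2 * B * (L / J) ^ 2 := by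
  have e1 := (h.node_estimates hL (hm.mem_Ioc h1 hmN) hj1 hj).1
  rcases eq_or_ne m 1 with rfl | hm1
  · have e : cellField L J t u 1 = fun i => u (node L J i) (t 1) := by
      funext i; simp [cellField, cellVal]
    rw [e, cellVal, if_pos rfl]
    exact e1
  · have e1 := _root_.abs_le.1 e1
    have e2 := _root_.abs_le.1
      (h.node_estimates hL (hm.mem_Ioc (by omega : 1 ≤ m - 1) (by omega)) hj1 hj).1
    have e : secDiff (L / J) (cellField L J t u m) j
        = (secDiff (L / J) (fun i => u (node L J i) (t m)) j
          + secDiff (L / J) (fun i => u (node L J i) (t (m - 1))) j) / 2 := by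
      simp only [secDiff, cellField, cellVal, if_neg hm1, half]; ring
    rw [e, cellVal, if_neg hm1, half, _root_.abs_le]
    constructor <;> linarith [e1.1, e1.2, e2.1, e2.2]

/-- Subtracting the equation integrated over the step leaves the quadrature errors of source,
convection and memory term, and the second difference error weighted by the row sum. -/
lemma gridNorm_schemeRes_le {α L T σ M c B γ Γ cγ k c₂ : ℝ} {u f : ℝ → ℝ → ℝ} {u₀ : ℝ → ℝ}
    {J N : ℕ} {t : ℕ → ℝ} {g : ℕ → ℕ → ℝ} (hα : 0 < α) (hL : 0 < L) (hT : 0 < T) (hσ : 0 < σ)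
    (hu : IsExactSolution α L T f u₀ u) (hs : SmoothField L T c B u)
    (hv : RegularField L T σ M c₂ (dxPart L 2 u)) (hf : HasTimeRegularity L T σ M f)
    (hm : IsGradedMesh T γ Γ cγ k N t) {n : ℕ} (h1 : 1 ≤ n) (hn : n ≤ N) :
    gridNorm L J (schemeRes α L J t u g n)
      ≤ gridNorm L J (fun j => g n j * tstep t n - ∫ s in t (n - 1)..t n, f (node L J j) s)
        + gridNorm L J (convRes L J t u n)
        + gridNorm L J (fun j => ruleErr α t (dxPart L 2 u (node L J j)) n)
        + (∑ m ∈ Finset.Icc 1 n, cellDiff (tpow (α + 1)) t n m * 1)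
          * (2 * B * (L / J) ^ 2 * √L) := by
  obtain ⟨-, hB, -, -⟩ := hs.const_nonneg hL hT
  have hcd : ∀ m ∈ Finset.Icc 1 n, 0 ≤ cellDiff (tpow (α + 1)) t n m := fun m hmem =>
    hm.cellDiff_nonneg hα hn ((Finset.mem_Icc.1 hmem).2.trans hn)
  set F : ℕ → ℝ := fun j => g n j * tstep t n - ∫ s in t (n - 1)..t n, f (node L J j) s
  set Q : ℕ → ℝ := convRes L J t u n
  set V : ℕ → ℝ := fun j => ruleErr α t (dxPart L 2 u (node L J j)) n
  set Z : ℕ → ℝ := fun j => ∑ m ∈ Finset.Icc 1 n, cellDiff (tpow (α + 1)) t n m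
    * (secDiff (L / J) (cellField L J t u m) j
      - cellVal (fun i => dxPart L 2 u (node L J j) (t i)) m)
  have e : gridNorm L J (schemeRes α L J t u g n) = gridNorm L J (-F + Q - V - Z) := by
    refine gridNorm_congr fun j hj1 hj => ?_
    have hx := node_mem_Ioo hL hj1 hj
    have ha := hm.nonneg (show n - 1 ≤ N by omega)
    have hab := hm.mono (show n - 1 ≤ n by omega) hn
    have := hu.integrated hs hα hx (hv.bddMeas hx) ha hab (hm.le_T hn)
      (hf.intervalIntegrable_node hL hT hσ hj1 hj ha hab (hm.le_T hn))
    simp only [F, Q, V, Z, Pi.add_apply, Pi.sub_apply, Pi.neg_apply, schemeRes, convRes, ruleErr,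
      mul_sub, Finset.sum_sub_distrib]
    rw [this]
    change _ + tstep t n * conv (L / J) (cellField L J t u n) (cellField L J t u n) j - _ - _ = _
      + (tstep t n * conv (L / J) (cellField L J t u n) (cellField L J t u n) j - _) - _ - _
    ring
  have hZ : gridNorm L J Z ≤ (∑ m ∈ Finset.Icc 1 n, cellDiff (tpow (α + 1)) t n m * 1)
      * (2 * B * (L / J) ^ 2 * √L) := by
    have h0 : 0 ≤ ∑ m ∈ Finset.Icc 1 n, cellDiff (tpow (α + 1)) t n m * 1 :=
      Finset.sum_nonneg fun m hmem => by rw [mul_one]; exact hcd m hmem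
    rw [← mul_assoc _ _ (√L)]
    refine gridNorm_le_of_abs_le hL (mul_nonneg h0 (by positivity)) fun j hj1 hj => ?_
    refine (Finset.abs_sum_le_sum_abs _ _).trans ?_
    rw [Finset.sum_mul]
    refine Finset.sum_le_sum fun m hmem => ?_
    rw [abs_mul, abs_of_nonneg (hcd m hmem), mul_one]
    rw [Finset.mem_Icc] at hmem
    exact mul_le_mul_of_nonneg_left
      (hs.abs_secDiff_cellField_sub_le hL hm hmem.1 (hmem.2.trans hn) hj1 hj)
      (hcd m (Finset.mem_Icc.2 hmem))
  rw [e]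
  have n1 := gridNorm_sub_le hL J (-F + Q - V) Z
  have n2 := gridNorm_sub_le hL J (-F + Q) V
  have n3 := gridNorm_add_le hL J (-F) Q
  rw [gridNorm_neg] at n3
  linarith

lemma IsSourceApprox.first_le {L T σ M γ Γ cγ k Cf : ℝ} {f : ℝ → ℝ → ℝ} {J N : ℕ} {t : ℕ → ℝ}
    {g : ℕ → ℕ → ℝ} (hg : IsSourceApprox L T Cf f J N t g) (hf : HasTimeRegularity L T σ M f)
    (hσ : 0 < σ) (hJ : 1 ≤ J) (hN : 1 ≤ N) (hm : IsGradedMesh T γ Γ cγ k N t) :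
    gridNorm L J (fun j => g 1 j * tstep t 1 - ∫ s in (t (1 - 1))..(t 1), f (node L J j) s)
      ≤ |Cf| * (M / σ) * t 1 ^ σ := by
  have ht := hm.mem_Ioc le_rfl hN
  have h1 := intervalIntegral.norm_integral_le_of_norm_le (a := 0) (b := t 1)
    (f := fun s => s * sliceNorm L J (dtPart T f) s) (g := fun s => M * s ^ (σ - 1)) ht.1.le
    (μ := MeasureTheory.volume)
    (Filter.Eventually.of_forall fun s hs => by
      have h2 := (hf.slice_bounds hJ (t := s) ⟨hs.1, hs.2.trans ht.2⟩).1
      have h3 : 0 ≤ sliceNorm L J (dtPart T f) s := gridNorm_nonneg _ _ _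
      rw [Real.norm_of_nonneg (mul_nonneg hs.1.le h3)]
      have e : s ^ (σ - 1) = s ^ (σ - 2) * s := by
        rw [← Real.rpow_add_one hs.1.ne']; congr 1; ring
      rw [e, ← mul_assoc, mul_comm s]
      exact mul_le_mul_of_nonneg_right h2 hs.1.le)
    ((intervalIntegral.intervalIntegrable_rpow' (by linarith)).const_mul _)
  rw [intervalIntegral.integral_const_mul, integral_rpow (Or.inl (by linarith)), sub_add_cancel,
    Real.zero_rpow hσ.ne', sub_zero, Real.norm_eq_abs] at h1
  -- Absolute values, because the sign of Cf is not prescribed.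
  refine (hg.first_step).trans ((le_abs_self _).trans ?_)
  rw [abs_mul, hm.zero, mul_assoc]
  refine mul_le_mul_of_nonneg_left (h1.trans (le_of_eq ?_)) (abs_nonneg _)
  ring

lemma IsSourceApprox.next_le {L T σ M γ Γ cγ k Cf : ℝ} {f : ℝ → ℝ → ℝ} {J N : ℕ} {t : ℕ → ℝ}
    {g : ℕ → ℕ → ℝ} (hg : IsSourceApprox L T Cf f J N t g) (hf : HasTimeRegularity L T σ M f)
    (hM : 0 ≤ M) (hΓ : 1 ≤ Γ) (hJ : 1 ≤ J) (hm : IsGradedMesh T γ Γ cγ k N t) {n : ℕ}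
    (h2 : 2 ≤ n) (hn : n ≤ N) :
    gridNorm L J (fun j => g n j * tstep t n - ∫ s in (t (n - 1))..(t n), f (node L J j) s)
      ≤ |Cf| * (M * Γ ^ |σ - 3|) * (tstep t n ^ 3 * t n ^ (σ - 3)) := by
  have ha := hm.pos (by omega : 1 ≤ n - 1) (by omega)
  have hab := (hm.lt n (by omega) hn).le
  have hκ := hm.tstep_pos (by omega : 1 ≤ n) hn
  have h1 := intervalIntegral.norm_integral_le_of_norm_le_const (a := t (n - 1)) (b := t n)
    (f := fun s => sliceNorm L J (dtPart T (dtPart T f)) s) (C := M * Γ ^ |σ - 3| * t n ^ (σ - 3))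
    fun s hs => by
      rw [uIoc_of_le hab] at hs
      have h3 : 0 ≤ sliceNorm L J (dtPart T (dtPart T f)) s := gridNorm_nonneg _ _ _
      rw [Real.norm_of_nonneg h3]
      exact ((hf.slice_bounds hJ ⟨ha.trans hs.1, hs.2.trans (hm.le_T hn)⟩).2).trans
        (RegularField.weight_le hm hΓ hM h2 hn _ s (Ioc_subset_Icc_self hs))
  rw [abs_of_nonneg (sub_nonneg.2 hab), Real.norm_eq_abs] at h1
  refine (hg.next_steps n h2 hn).trans ((le_abs_self _).trans ?_)
  rw [abs_mul, abs_mul, abs_of_nonneg (sq_nonneg (tstep t n))]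
  calc _ ≤ |Cf| * tstep t n ^ 2 * (M * Γ ^ |σ - 3| * t n ^ (σ - 3) * tstep t n) :=
        mul_le_mul_of_nonneg_left h1 (by positivity)
    _ = _ := by ring

/-- The spatial errors keep order h² after summation, since both the steps and the memory weights
have bounded total. -/
lemma exists_sum_schemeRes_le {α L T σ M c B γ Γ cγ c₂ ρ Cf : ℝ} {u f : ℝ → ℝ → ℝ} {u₀ : ℝ → ℝ}
    (hα : α ∈ Ioo (0 : ℝ) 1) (hL : 0 < L) (hT : 0 < T) (hσ : 0 < σ) (hγ : 1 ≤ γ) (hΓ : 1 ≤ Γ)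
    (hcγ : 0 < cγ) (hρ : 1 < ρ) (hM : 0 ≤ M) (hc₂ : 0 ≤ c₂)
    (hu : IsExactSolution α L T f u₀ u) (hs : SmoothField L T c B u)
    (hv : RegularField L T σ M c₂ (dxPart L 2 u)) (hf : HasTimeRegularity L T σ M f) :
    ∃ C : ℝ, 0 ≤ C ∧ ∀ (J N : ℕ) (k : ℝ) (t : ℕ → ℝ) (g : ℕ → ℕ → ℝ), 1 ≤ J → 1 ≤ N → 0 < k →
      IsGradedMesh T γ Γ cγ k N t → (γ = 2 / σ → ρ * t 1 ≤ t N) →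
      IsSourceApprox L T Cf f J N t g →
      ∑ n ∈ Finset.Icc 1 N, gridNorm L J (schemeRes α L J t u g n)
        ≤ C * ((L / J) ^ 2 + errK σ γ k (t 1) (t N)) := by
  obtain ⟨-, hB, -, -⟩ := hs.const_nonneg hL hT
  obtain ⟨C₁, hC₁, hrule⟩ := RegularField.exists_sum_ruleErr_le hα hL hT hσ hγ hΓ hcγ hρ hM hc₂
  obtain ⟨C₂, hC₂, hconv₁⟩ := hs.exists_gridNorm_convRes_first_le (γ := γ) (Γ := Γ) hv hL hT hM hc₂
  obtain ⟨C₃, hC₃, hconv⟩ := hs.exists_gridNorm_convRes_le (γ := γ) hv hL hT hM hc₂ hΓ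
  obtain ⟨K₁, hK₁, hfirst⟩ := exists_first_rpow_le_errK hT hσ hγ hΓ hcγ hρ
  obtain ⟨K₂, hK₂, hcube⟩ := exists_sum_cube_le_errK hT hσ hγ hΓ hcγ hρ
  set A₁ := |Cf| * (M / σ) + C₂ with hA₁
  set A₂ := |Cf| * (M * Γ ^ |σ - 3|) + C₃ with hA₂
  have htp := tpow_nonneg hα.1 T
  have hA₁0 : 0 ≤ A₁ := by positivity
  have hA₂0 : 0 ≤ A₂ := by positivity
  set D := (C₂ + C₃) * T + tpow α T * T * (2 * B * √L) with hD
  have hD0 : 0 ≤ D := by positivity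
  refine ⟨A₁ * K₁ + A₂ * K₂ + C₁ + D, by positivity, fun J N k t g hJ hN hk hm hend hg => ?_⟩
  set E := errK σ γ k (t 1) (t N)
  have hE0 : 0 ≤ E := errK_nonneg hk.le (hm.pos le_rfl hN) (hm.mono hN le_rfl)
  set H := (L / J) ^ 2
  have hH0 : 0 ≤ H := sq_nonneg _
  have hsrc : ∑ n ∈ Finset.Icc 1 N, (gridNorm L J (fun j => g n j * tstep t n
        - ∫ s in t (n - 1)..t n, f (node L J j) s) + gridNorm L J (convRes L J t u n))
      ≤ A₁ * (K₁ * E) + A₂ * (K₂ * E) + (C₂ + C₃) * T * H := by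
    have s1 := (hm.sum_tstep N).le.trans hm.le_end
    rw [sum_Icc_one_eq hN] at s1 ⊢
    have q1 := hg.first_le hf hσ hJ hN hm
    have q2 := hconv₁ J N k cγ t hJ hN hm
    change _ ≤ C₂ * (_ + _ * H) at q2
    have q3 : ∑ n ∈ Finset.Icc 2 N, (gridNorm L J (fun j => g n j * tstep t n
        - ∫ s in t (n - 1)..t n, f (node L J j) s) + gridNorm L J (convRes L J t u n))
        ≤ A₂ * ∑ n ∈ Finset.Icc 2 N, tstep t n ^ 3 * t n ^ (σ - 3)
          + C₃ * H * ∑ n ∈ Finset.Icc 2 N, tstep t n := by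
      rw [Finset.mul_sum, Finset.mul_sum, ← Finset.sum_add_distrib]
      refine Finset.sum_le_sum fun n hn => ?_
      rw [Finset.mem_Icc] at hn
      have r1 := hg.next_le hf hM hΓ hJ hm hn.1 hn.2
      have r2 := hconv J N k cγ t hJ hm n hn.1 hn.2
      change _ ≤ C₃ * (_ + _ * H) at r2
      rw [hA₂]
      linarith
    have q4 := mul_le_mul_of_nonneg_left (hcube N k t hk hN hm hend) hA₂0
    have q5 := mul_le_mul_of_nonneg_left (hfirst N k t hk hN hm hend) hA₁0
    have e1 : tstep t 1 = t 1 := by simp [tstep, hm.zero]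
    rw [e1] at s1
    have p1 : 0 ≤ ∑ n ∈ Finset.Icc 2 N, tstep t n := Finset.sum_nonneg fun n hn => by
      rw [Finset.mem_Icc] at hn
      exact (hm.tstep_pos (by omega) hn.2).le
    have p2 := (hm.pos le_rfl hN).le
    have q6 : C₂ * H * t 1 ≤ C₂ * H * T := by gcongr; linarith
    have q7 : C₃ * H * ∑ n ∈ Finset.Icc 2 N, tstep t n ≤ C₃ * H * T := by gcongr; linarith
    rw [hA₁] at q5 ⊢
    linarith
  have hcell : ∑ n ∈ Finset.Icc 1 N, ∑ m ∈ Finset.Icc 1 n, cellDiff (tpow (α + 1)) t n m * 1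
      ≤ tpow α T * T := by
    refine (hm.sum_sum_cellDiff_le hα.1 (κ := fun _ => 1) fun _ _ _ => zero_le_one).trans ?_
    simp only [mul_one]
    rw [hm.sum_tstep]
    exact mul_le_mul_of_nonneg_left hm.le_end htp
  have hall : ∑ n ∈ Finset.Icc 1 N, gridNorm L J (schemeRes α L J t u g n)
      ≤ ∑ n ∈ Finset.Icc 1 N, ((gridNorm L J (fun j => g n j * tstep t n
          - ∫ s in t (n - 1)..t n, f (node L J j) s) + gridNorm L J (convRes L J t u n))
        + gridNorm L J (fun j => ruleErr α t (dxPart L 2 u (node L J j)) n)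
        + (∑ m ∈ Finset.Icc 1 n, cellDiff (tpow (α + 1)) t n m * 1) * (2 * B * H * √L)) :=
    Finset.sum_le_sum fun n hn => by
      rw [Finset.mem_Icc] at hn
      exact gridNorm_schemeRes_le hα.1 hL hT hσ hu hs hv hf hm hn.1 hn.2
  rw [Finset.sum_add_distrib, Finset.sum_add_distrib, ← Finset.sum_mul] at hall
  have hr := hrule _ hv J N k t hJ hN hk hm hend
  have hc := mul_le_mul_of_nonneg_right hcell (by positivity : 0 ≤ 2 * B * H * √L)
  have f1 : 0 ≤ (A₁ * K₁ + A₂ * K₂ + C₁) * H := by positivity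
  have f2 : 0 ≤ D * E := by positivity
  calc _ ≤ _ := hall
    _ ≤ A₁ * (K₁ * E) + A₂ * (K₂ * E) + (C₂ + C₃) * T * H + C₁ * E
        + tpow α T * T * (2 * B * H * √L) := add_le_add (add_le_add hsrc hr) hc
    _ = (A₁ * K₁ + A₂ * K₂ + C₁) * E + D * H := by rw [hD]; ring
    _ ≤ _ := by linarith

/-! ### Stability -/

/-- A Gronwall inequality of Crank–Nicolson type, implicit in the last term. The majorant S, not a,
is propagated. -/
lemma le_mul_exp_of_le_half_sum {N : ℕ} {a y : ℕ → ℝ} {G : ℝ} (hG : 0 ≤ G) (ha : ∀ n, 0 ≤ a n)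
    (hy : ∀ n, 2 ≤ n → n ≤ N → 0 ≤ y n ∧ y n ≤ 1)
    (h : ∀ p, 1 ≤ p → p ≤ N → a p ≤ G + ∑ n ∈ Finset.Icc 2 p, y n * ((a n + a (n - 1)) / 2)) :
    ∀ p, 1 ≤ p → p ≤ N → a p ≤ G * Real.exp (2 * ∑ n ∈ Finset.Icc 2 p, y n) := by
  set S : ℕ → ℝ := fun p => G + ∑ n ∈ Finset.Icc 2 p, y n * ((a n + a (n - 1)) / 2) with hS
  have hS0 : ∀ p, p ≤ N → 0 ≤ S p := fun p hp => add_nonneg hG (Finset.sum_nonneg fun n hn => by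
    rw [Finset.mem_Icc] at hn
    have h1 := (hy n hn.1 (hn.2.trans hp)).1
    have h2 := ha n
    have h3 := ha (n - 1)
    positivity)
  suffices ∀ p, 1 ≤ p → p ≤ N → S p ≤ G * Real.exp (2 * ∑ n ∈ Finset.Icc 2 p, y n) from
    fun p h1 hp => (h p h1 hp).trans (this p h1 hp)
  intro p h1
  induction p, h1 using Nat.le_induction with
  | base => intro _; simp [hS]
  | succ p h1 ih =>
    intro hp
    have ih := ih (by omega)
    obtain ⟨y0, y1⟩ := hy (p + 1) (by omega) hp
    have hsum : S (p + 1) = S p + y (p + 1) * ((a (p + 1) + a p) / 2) := by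
      simp only [hS]
      rw [Finset.sum_Icc_succ_top (by omega), Nat.add_sub_cancel, add_assoc]
    have e1 := h (p + 1) (by omega) hp
    have e2 := h p h1 (by omega)
    change a (p + 1) ≤ S (p + 1) at e1
    change a p ≤ S p at e2
    have hp0 := hS0 p (by omega)
    generalize S (p + 1) = s' at *
    generalize S p = s at *
    rw [Finset.sum_Icc_succ_top (by omega), mul_add, Real.exp_add, ← mul_assoc]
    generalize y (p + 1) = z at *
    have g1 : z * ((a (p + 1) + a p) / 2) ≤ z * ((s' + s) / 2) := by gcongr
    -- One has (1 - z/2)(1 + 2z) - (1 + z/2) = z(1 - z) ≥ 0.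
    have g2 : (1 - z / 2) * s' ≤ (1 - z / 2) * ((1 + 2 * z) * s) := by
      have : 0 ≤ z * (1 - z) * s := mul_nonneg (mul_nonneg y0 (by linarith)) hp0
      linarith
    have g3 := le_of_mul_le_mul_left g2 (by linarith)
    have g4 : (1 + 2 * z) * s ≤ Real.exp (2 * z) * s :=
      mul_le_mul_of_nonneg_right (by linarith [Real.add_one_le_exp (2 * z)]) hp0
    calc s' ≤ Real.exp (2 * z) * s := g3.trans g4
      _ ≤ Real.exp (2 * z) * (G * Real.exp (2 * ∑ n ∈ Finset.Icc 2 p, y n)) := by gcongr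
      _ = _ := by ring

/-- The values in the cells of the scheme of a sequence of grid functions. -/
noncomputable def cellGrid (W : ℕ → ℕ → ℝ) (n j : ℕ) : ℝ := cellVal (fun m => W m j) n

lemma cellGrid_one (W : ℕ → ℕ → ℝ) : cellGrid W 1 = W 1 := by
  funext j; simp [cellGrid, cellVal]

lemma cellGrid_of_two_le (W : ℕ → ℕ → ℝ) {n : ℕ} (hn : 2 ≤ n) :
    cellGrid W n = (1 / 2 : ℝ) • (W n + W (n - 1)) := by
  funext j
  simp only [cellGrid, cellVal, if_neg (show n ≠ 1 by omega), half, Pi.smul_apply, Pi.add_apply,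
    smul_eq_mul]
  ring

lemma cellGrid_eq_zero {W : ℕ → ℕ → ℝ} {n j : ℕ} (h1 : 1 ≤ n)
    (h : ∀ m, 1 ≤ m → m ≤ n → W m j = 0) : cellGrid W n j = 0 := by
  rcases eq_or_ne n 1 with rfl | hn
  · rw [cellGrid_one]; exact h 1 le_rfl le_rfl
  · rw [cellGrid_of_two_le W (by omega)]
    simp [h n h1 le_rfl, h (n - 1) (by omega) (by omega)]

lemma secDiff_cellGrid (h : ℝ) (W : ℕ → ℕ → ℝ) (m j : ℕ) :
    secDiff h (cellGrid W m) j = cellVal (fun n => secDiff h (W n) j) m := by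
  unfold cellVal
  split_ifs with hm
  · rw [hm, cellGrid_one]
  · simp only [secDiff, cellGrid, cellVal, if_neg hm, half]; ring

/-- After summation by parts in space, every grid edge contributes one copy of the positive
semidefinite form in time. -/
lemma sum_gip_secDiff_nonpos {α L : ℝ} (hα : α ∈ Ioo (0 : ℝ) 1) (hL : 0 < L) {J N : ℕ}
    (hJ : 1 ≤ J) {t : ℕ → ℝ} (ht : ∀ i j, i ≤ j → j ≤ N → t i ≤ t j) {z : ℕ → ℕ → ℝ}
    (h0 : ∀ n, 1 ≤ n → n ≤ N → z n 0 = 0) (hzJ : ∀ n, 1 ≤ n → n ≤ N → z n J = 0) :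
    ∑ n ∈ Finset.Icc 1 N, ∑ m ∈ Finset.Icc 1 n, cellDiff (tpow (α + 1)) t n m
      * gip L J (secDiff (L / J) (z m)) (z n) ≤ 0 := by
  have e : ∑ n ∈ Finset.Icc 1 N, ∑ m ∈ Finset.Icc 1 n, cellDiff (tpow (α + 1)) t n m
      * gip L J (secDiff (L / J) (z m)) (z n)
      = -(L / J * ∑ j ∈ Finset.range J, ∑ n ∈ Finset.Icc 1 N, ∑ m ∈ Finset.Icc 1 n,
        cellDiff (tpow (α + 1)) t n m * ((z m (j + 1) - z m j) / (L / J))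
          * ((z n (j + 1) - z n j) / (L / J))) := by
    rw [Finset.sum_comm, Finset.mul_sum, ← Finset.sum_neg_distrib]
    refine Finset.sum_congr rfl fun n hn => ?_
    rw [Finset.mem_Icc] at hn
    rw [Finset.sum_comm, Finset.mul_sum, ← Finset.sum_neg_distrib]
    refine Finset.sum_congr rfl fun m _ => ?_
    rw [gip_secDiff hJ _ _ (h0 n hn.1 hn.2) (hzJ n hn.1 hn.2), Finset.mul_sum, Finset.mul_sum,
      mul_neg, Finset.mul_sum]
    congr 1
    exact Finset.sum_congr rfl fun j _ => by ring
  rw [e, Left.neg_nonpos_iff]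
  exact mul_nonneg (by positivity) (Finset.sum_nonneg fun j _ =>
    sum_cellDiff_tpow_nonneg hα ht fun m => (z m (j + 1) - z m j) / (L / J))

lemma gridNorm_cellGrid_sq_le {L : ℝ} (hL : 0 < L) (J : ℕ) (e : ℕ → ℕ → ℝ) {n : ℕ} (hn : 2 ≤ n) :
    gridNorm L J (cellGrid e n) ^ 2 ≤ (gridNorm L J (e n) ^ 2 + gridNorm L J (e (n - 1)) ^ 2) / 2 := by
  rw [cellGrid_of_two_le e hn, gridNorm_smul, abs_of_pos (by norm_num)]
  have h1 := gridNorm_add_le hL J (e n) (e (n - 1))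
  have h0 := gridNorm_nonneg L J (e n + e (n - 1))
  have h2 := pow_le_pow_left₀ h0 h1 2
  have h3 := add_sq_le (a := gridNorm L J (e n)) (b := gridNorm L J (e (n - 1)))
  nlinarith

lemma gridNorm_cellGrid_le {L X : ℝ} (hL : 0 < L) {J : ℕ} {e : ℕ → ℕ → ℝ} {n : ℕ} (h1 : 1 ≤ n)
    (hX : ∀ m, 1 ≤ m → m ≤ n → gridNorm L J (e m) ≤ X) : gridNorm L J (cellGrid e n) ≤ X := by
  rcases eq_or_ne n 1 with rfl | hn
  · rw [cellGrid_one]; exact hX 1 le_rfl le_rfl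
  · rw [cellGrid_of_two_le e (by omega), gridNorm_smul, abs_of_pos (by norm_num)]
    have h2 := gridNorm_add_le hL J (e n) (e (n - 1))
    linarith [hX n h1 le_rfl, hX (n - 1) (by omega) (by omega)]

lemma gip_sub_cellGrid {L : ℝ} (hL : 0 < L) (J : ℕ) (e : ℕ → ℕ → ℝ) {n : ℕ} (hn : 2 ≤ n) :
    gip L J (e n - e (n - 1)) (cellGrid e n)
      = (gridNorm L J (e n) ^ 2 - gridNorm L J (e (n - 1)) ^ 2) / 2 := by
  rw [cellGrid_of_two_le e hn, gip_smul_right, gip_sub_left, gip_add_right, gip_add_right,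
    gip_self hL, gip_self hL, gip_comm L J (e (n - 1)) (e n)]
  ring

/-- `e` solves the scheme linearized at `w`, up to the convective term in `e`, with source `-r`. -/
structure IsErrorEq (α L c : ℝ) (J N : ℕ) (t : ℕ → ℝ) (w e r : ℕ → ℕ → ℝ) : Prop where
  left : ∀ n, 1 ≤ n → n ≤ N → e n 0 = 0
  right : ∀ n, 1 ≤ n → n ≤ N → e n J = 0
  init : ∀ j, 1 ≤ j → j < J → e 0 j = 0
  quotient_le : ∀ n, 1 ≤ n → n ≤ N → ∀ j, j < J → |(w n (j + 1) - w n j) / (L / J)| ≤ c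
  eq : ∀ n, 1 ≤ n → n ≤ N → ∀ j, 1 ≤ j → j < J →
    e n j - e (n - 1) j + tstep t n * (conv (L / J) (w n + cellGrid e n) (w n + cellGrid e n) j
        - conv (L / J) (w n) (w n) j)
      = (∑ m ∈ Finset.Icc 1 n, cellDiff (tpow (α + 1)) t n m * secDiff (L / J) (cellGrid e m) j)
        - r n j

namespace IsErrorEq

variable {α L c T γ Γ cγ k : ℝ} {J N : ℕ} {t : ℕ → ℝ} {w e r : ℕ → ℕ → ℝ}

lemma tested (h : IsErrorEq α L c J N t w e r) (hL : 0 < L) (hc : 0 ≤ c) (hJ : 1 ≤ J)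
    (hm : IsGradedMesh T γ Γ cγ k N t) {n : ℕ} (h1 : 1 ≤ n) (hn : n ≤ N) :
    gip L J (e n - e (n - 1)) (cellGrid e n)
      ≤ tstep t n * (c / 2 * gridNorm L J (cellGrid e n) ^ 2)
        + (∑ m ∈ Finset.Icc 1 n, cellDiff (tpow (α + 1)) t n m
          * gip L J (secDiff (L / J) (cellGrid e m)) (cellGrid e n))
        + gridNorm L J (r n) * gridNorm L J (cellGrid e n) := by
  have hz0 : cellGrid e n 0 = 0 :=
    cellGrid_eq_zero h1 fun m hm1 hmn => h.left m hm1 (hmn.trans hn)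
  have hzJ : cellGrid e n J = 0 :=
    cellGrid_eq_zero h1 fun m hm1 hmn => h.right m hm1 (hmn.trans hn)
  have hcv := abs_gip_conv_sub_le hL hc hJ (w n) (cellGrid e n) hz0 hzJ (h.quotient_le n h1 hn)
  set Q := conv (L / J) (w n + cellGrid e n) (w n + cellGrid e n) - conv (L / J) (w n) (w n)
    with hQ
  have heq : gip L J (e n - e (n - 1)) (cellGrid e n)
      = gip L J ((∑ m ∈ Finset.Icc 1 n, cellDiff (tpow (α + 1)) t n m
          • secDiff (L / J) (cellGrid e m)) - r n - tstep t n • Q) (cellGrid e n) := by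
    refine gip_congr (fun j hj1 hj => ?_) fun _ _ _ => rfl
    have := h.eq n h1 hn j hj1 hj
    simp only [hQ, Pi.sub_apply, Pi.smul_apply, smul_eq_mul, Finset.sum_apply]
    linarith
  have hmem : gip L J (∑ m ∈ Finset.Icc 1 n, cellDiff (tpow (α + 1)) t n m
          • secDiff (L / J) (cellGrid e m)) (cellGrid e n)
      = ∑ m ∈ Finset.Icc 1 n, cellDiff (tpow (α + 1)) t n m
          * gip L J (secDiff (L / J) (cellGrid e m)) (cellGrid e n) := by
    rw [gip_comm, gip_sum_right]
    refine Finset.sum_congr rfl fun m _ => ?_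
    rw [gip_smul_right, gip_comm]
  rw [heq, gip_sub_left, gip_sub_left, gip_smul_left, hmem]
  have h2 := abs_gip_le hL J (r n) (cellGrid e n)
  have h3 := mul_le_mul_of_nonneg_left (neg_le_of_abs_le hcv) (hm.tstep_pos h1 hn).le
  linarith [neg_le_of_abs_le h2]

/-- The first step is tested with e¹ itself and gives the full ‖e¹‖²; the later ones telescope to
half of ‖e^p‖² - ‖e¹‖². The surplus ‖e¹‖² on the left later absorbs the convection term of the first
step. -/
lemma energy (h : IsErrorEq α L c J N t w e r) (hα : α ∈ Ioo (0 : ℝ) 1) (hL : 0 < L) (hc : 0 ≤ c)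
    (hJ : 1 ≤ J) (hm : IsGradedMesh T γ Γ cγ k N t) {p : ℕ} (h1 : 1 ≤ p) (hp : p ≤ N) :
    gridNorm L J (e 1) ^ 2 + gridNorm L J (e p) ^ 2
      ≤ c * t 1 * gridNorm L J (e 1) ^ 2
        + ∑ n ∈ Finset.Icc 2 p, c * tstep t n
          * ((gridNorm L J (e n) ^ 2 + gridNorm L J (e (n - 1)) ^ 2) / 2)
        + 2 * ∑ n ∈ Finset.Icc 1 p, gridNorm L J (r n) * gridNorm L J (cellGrid e n) := by
  have hs := Finset.sum_le_sum fun n (hn : n ∈ Finset.Icc 1 p) =>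
    h.tested hL hc hJ hm (Finset.mem_Icc.1 hn).1 ((Finset.mem_Icc.1 hn).2.trans hp)
  have hmem := sum_gip_secDiff_nonpos (z := cellGrid e) hα hL hJ (t := t) (N := p)
    (fun i j hij hj => hm.mono hij (hj.trans hp))
    (fun n hn1 hn => cellGrid_eq_zero hn1 fun m hm1 hmn => h.left m hm1 (by omega))
    (fun n hn1 hn => cellGrid_eq_zero hn1 fun m hm1 hmn => h.right m hm1 (by omega))
  rw [Finset.sum_add_distrib, Finset.sum_add_distrib, sum_Icc_one_eq h1,
    sum_Icc_one_eq h1 fun n => tstep t n * (c / 2 * gridNorm L J (cellGrid e n) ^ 2)] at hs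
  have ht1 : tstep t 1 = t 1 := by simp [tstep, hm.zero]
  have e1 : gip L J (e 1 - e (1 - 1)) (cellGrid e 1) = gridNorm L J (e 1) ^ 2 := by
    rw [← gip_self hL, cellGrid_one]
    exact gip_congr (fun j hj1 hj => by simp [h.init j hj1 hj]) fun _ _ _ => rfl
  have e2 : ∑ n ∈ Finset.Icc 2 p, gip L J (e n - e (n - 1)) (cellGrid e n)
      = (gridNorm L J (e p) ^ 2 - gridNorm L J (e 1) ^ 2) / 2 := by
    rw [← sum_Icc_two_telescope p h1 fun n => gridNorm L J (e n) ^ 2, Finset.sum_div]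
    exact Finset.sum_congr rfl fun n hn => gip_sub_cellGrid hL J e (Finset.mem_Icc.1 hn).1
  have e3 : ∑ n ∈ Finset.Icc 2 p, tstep t n * (c / 2 * gridNorm L J (cellGrid e n) ^ 2)
      ≤ 1 / 2 * ∑ n ∈ Finset.Icc 2 p, c * tstep t n
          * ((gridNorm L J (e n) ^ 2 + gridNorm L J (e (n - 1)) ^ 2) / 2) := by
    rw [Finset.mul_sum]
    refine Finset.sum_le_sum fun n hn => ?_
    rw [Finset.mem_Icc] at hn
    have hk := hm.tstep_pos (by omega : 1 ≤ n) (hn.2.trans hp)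
    have := mul_le_mul_of_nonneg_left (gridNorm_cellGrid_sq_le hL J e hn.1)
      (by positivity : 0 ≤ c / 2 * tstep t n)
    linarith
  rw [e1, e2, ht1, cellGrid_one] at hs
  linarith

/-- Stability of the scheme; the first step, which may be long, is controlled separately. -/
lemma gridNorm_le (h : IsErrorEq α L c J N t w e r) (hα : α ∈ Ioo (0 : ℝ) 1) (hL : 0 < L)
    (hT : 0 ≤ T) (hc : 0 ≤ c) (hJ : 1 ≤ J) (hm : IsGradedMesh T γ Γ cγ k N t)
    (hcN : c * tstep t N ≤ 1) {y : ℝ} (hy : 0 ≤ y)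
    (hfirst : 1 < c * t 1 → gridNorm L J (e 1) ≤ y) :
    ∀ n, 1 ≤ n → n ≤ N → gridNorm L J (e n)
      ≤ Real.exp (2 * c * T) * ((1 + c * T) * y
        + 2 * ∑ n ∈ Finset.Icc 1 N, gridNorm L J (r n)) := by
  intro n₀ hn₀1 hn₀
  have hN : 1 ≤ N := hn₀1.trans hn₀
  -- Working at the largest error makes the residual term at most 2RX, linear in the sought bound.
  obtain ⟨q, hq, hmax⟩ := Finset.exists_max_image (Finset.Icc 1 N) (fun n => gridNorm L J (e n))
    ⟨1, Finset.mem_Icc.2 ⟨le_rfl, hN⟩⟩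
  have hX : ∀ m, 1 ≤ m → m ≤ N → gridNorm L J (e m) ≤ gridNorm L J (e q) := fun m h1 hmN =>
    hmax m (Finset.mem_Icc.2 ⟨h1, hmN⟩)
  refine (hX n₀ hn₀1 hn₀).trans ?_
  rw [Finset.mem_Icc] at hq
  set X := gridNorm L J (e q) with hXd
  have hX0 : 0 ≤ X := gridNorm_nonneg _ _ _
  set R := ∑ n ∈ Finset.Icc 1 N, gridNorm L J (r n)
  have hR0 : 0 ≤ R := Finset.sum_nonneg fun _ _ => gridNorm_nonneg _ _ _
  have hG0 : 0 ≤ c * T * y ^ 2 + 2 * R * X := by positivity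
  -- If c t₁ ≤ 1 the term is absorbed by the surplus ‖e¹‖²; otherwise `hfirst` applies.
  have hstep : c * t 1 * gridNorm L J (e 1) ^ 2
      ≤ gridNorm L J (e 1) ^ 2 + c * T * y ^ 2 := by
    rcases le_or_gt (c * t 1) 1 with h1 | h1
    · have := mul_le_mul_of_nonneg_right h1 (sq_nonneg (gridNorm L J (e 1)))
      have h2 : 0 ≤ c * T * y ^ 2 := by positivity
      linarith
    · have h2 := pow_le_pow_left₀ (gridNorm_nonneg _ _ _) (hfirst h1) 2
      have h3 : c * t 1 ≤ c * T := mul_le_mul_of_nonneg_left (hm.le_T hN) hc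
      have h4 : c * t 1 * gridNorm L J (e 1) ^ 2 ≤ c * T * y ^ 2 := by gcongr
      linarith [sq_nonneg (gridNorm L J (e 1))]
  have key := le_mul_exp_of_le_half_sum (N := N) (a := fun n => gridNorm L J (e n) ^ 2)
    (y := fun n => c * tstep t n) hG0 (fun n => sq_nonneg _)
    (fun n h2 hn => ⟨mul_nonneg hc (hm.tstep_pos (by omega) hn).le,
      (mul_le_mul_of_nonneg_left (hm.tstep_mono h2 hn le_rfl) hc).trans hcN⟩)
    (fun p h1 hp => by
      have h2 := h.energy hα hL hc hJ hm h1 hp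
      have h3 : ∑ n ∈ Finset.Icc 1 p, gridNorm L J (r n) * gridNorm L J (cellGrid e n)
          ≤ R * X := by
        calc _ ≤ ∑ n ∈ Finset.Icc 1 p, gridNorm L J (r n) * X := by
              refine Finset.sum_le_sum fun n hn => mul_le_mul_of_nonneg_left ?_
                (gridNorm_nonneg _ _ _)
              rw [Finset.mem_Icc] at hn
              exact gridNorm_cellGrid_le hL hn.1 fun m hm1 hmn => hX m hm1 (by omega)
          _ = (∑ n ∈ Finset.Icc 1 p, gridNorm L J (r n)) * X := (Finset.sum_mul _ _ _).symm
          _ ≤ _ := mul_le_mul_of_nonneg_right (Finset.sum_le_sum_of_subset_of_nonneg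
              (Finset.Icc_subset_Icc_right hp) fun _ _ _ => gridNorm_nonneg _ _ _) hX0
      linarith) q hq.1 hq.2
  have hexp : Real.exp (2 * ∑ n ∈ Finset.Icc 2 q, c * tstep t n) ≤ Real.exp (2 * c * T) := by
    refine Real.exp_le_exp.2 ?_
    rw [← Finset.mul_sum, ← mul_assoc]
    refine mul_le_mul_of_nonneg_left ?_ (by positivity)
    have h1 := hm.sum_tstep q
    rw [sum_Icc_one_eq hq.1] at h1
    linarith [hm.tstep_pos le_rfl hN, hm.le_T hq.2]
  set Λ := Real.exp (2 * c * T)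
  have hΛ : 1 ≤ Λ := Real.one_le_exp (by positivity)
  have hfin : X ^ 2 ≤ Λ * (c * T * y ^ 2 + 2 * R * X) := by
    refine key.trans ?_
    rw [mul_comm]
    exact mul_le_mul_of_nonneg_right hexp hG0
  -- If X exceeded the bound, then y ≤ X, so the right side of `hfin` would be at most X times the
  -- bound, which is below X².
  by_contra hcon
  push Not at hcon
  have hcT : 0 ≤ c * T := mul_nonneg hc hT
  have a1 : Λ * y ≤ Λ * ((1 + c * T) * y + 2 * R) := by
    refine mul_le_mul_of_nonneg_left ?_ (by linarith)
    nlinarith [mul_nonneg hcT hy]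
  have a2 : y ≤ X := by nlinarith
  have hXpos : 0 < X := lt_of_le_of_lt (by positivity) hcon
  have a3 : c * T * y ^ 2 ≤ (1 + c * T) * y * X := by
    have b1 : c * T * (y * y) ≤ c * T * (y * X) := by gcongr
    have b2 : 0 ≤ y * X := by positivity
    nlinarith
  have a4 : Λ * (c * T * y ^ 2 + 2 * R * X) ≤ Λ * ((1 + c * T) * y + 2 * R) * X := by
    have := mul_le_mul_of_nonneg_left a3 (by linarith : 0 ≤ Λ)
    linarith
  have a5 := mul_lt_mul_of_pos_right hcon hXpos
  nlinarith

end IsErrorEq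

/-! ### The error equation and the error bound -/

lemma IsDiscreteSolution.step_eq {α L T γ Γ cγ k : ℝ} {J N : ℕ} {t : ℕ → ℝ} {u₀ : ℝ → ℝ}
    {g U : ℕ → ℕ → ℝ} (hU : IsDiscreteSolution α L J N t u₀ g U) (hα : 0 < α)
    (hm : IsGradedMesh T γ Γ cγ k N t) {n : ℕ} (h1 : 1 ≤ n) (hn : n ≤ N) {j : ℕ} (hj1 : 1 ≤ j)
    (hj : j < J) :
    U n j - U (n - 1) j + tstep t n * conv (L / J) (cellGrid U n) (cellGrid U n) j
      = (∑ m ∈ Finset.Icc 1 n, cellDiff (tpow (α + 1)) t n m * secDiff (L / J) (cellGrid U m) j)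
        + tstep t n * g n j := by
  have hk := (hm.tstep_pos h1 hn).ne'
  have hmem := hm.tstep_mul_discFracInt hα h1 hn fun m => secDiff (L / J) (U m) j
  simp only [secDiff_cellGrid]
  have hs : (U n j - U (n - 1) j) / tstep t n + conv (L / J) (cellGrid U n) (cellGrid U n) j
      = discFracInt α t (fun m => secDiff (L / J) (U m) j) n + g n j := by
    rcases eq_or_ne n 1 with rfl | hn1
    · rw [cellGrid_one]; exact hU.first_step j hj1 hj
    · have e : cellGrid U n = fun i => half (fun m => U m i) n := by
        funext i; simp only [cellGrid, cellVal, if_neg hn1]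
      rw [e]
      exact hU.next_steps n (by omega) hn j hj1 hj
  rw [← hmem, ← mul_add, ← hs, mul_add, mul_div_cancel₀ _ hk]

lemma cellGrid_sub (W V : ℕ → ℕ → ℝ) (n : ℕ) :
    cellGrid (fun m j => W m j - V m j) n = cellGrid W n - cellGrid V n := by
  funext j
  simp only [cellGrid, cellVal, half, Pi.sub_apply]
  split_ifs
  · rfl
  · ring

lemma secDiff_sub (h : ℝ) (a b : ℕ → ℝ) (j : ℕ) :
    secDiff h (a - b) j = secDiff h a j - secDiff h b j := by
  simp only [secDiff, Pi.sub_apply]; ring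

namespace SmoothField

variable {α L T c B γ Γ cγ k : ℝ} {u f : ℝ → ℝ → ℝ} {u₀ : ℝ → ℝ} {J N : ℕ} {t : ℕ → ℝ}
  {g U : ℕ → ℕ → ℝ}

lemma isErrorEq (h : SmoothField L T c B u) (hα : 0 < α) (hL : 0 < L) (hJ : 1 ≤ J)
    (hu : IsExactSolution α L T f u₀ u) (hm : IsGradedMesh T γ Γ cγ k N t)
    (hU : IsDiscreteSolution α L J N t u₀ g U) :
    IsErrorEq α L c J N t (cellField L J t u) (fun n j => U n j - u (node L J j) (t n))
      (schemeRes α L J t u g) where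
  left := fun n h1 hn => by
    rw [hU.boundary_left n h1 hn, h.node_zero (hm.mem_Ioc h1 hn), sub_zero]
  right := fun n h1 hn => by
    rw [hU.boundary_right n h1 hn, h.node_last hJ (hm.mem_Ioc h1 hn), sub_zero]
  init := fun j h1 hj => by
    rw [hU.init_value j h1 hj, hm.zero, hu.init_value _ (node_mem_Icc hL hJ hj.le), sub_self]
  quotient_le := fun n h1 hn j hj => by
    have e1 := h.abs_quotient_le hL (hm.mem_Ioc h1 hn) hj
    rcases eq_or_ne n 1 with rfl | hn1
    · simpa only [cellField, cellVal, if_true] using e1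
    · have e1 := _root_.abs_le.1 e1
      have e2 := _root_.abs_le.1
        (h.abs_quotient_le hL (hm.mem_Ioc (by omega : 1 ≤ n - 1) (by omega)) hj)
      have e : (cellField L J t u n (j + 1) - cellField L J t u n j) / (L / J)
          = ((u (node L J (j + 1)) (t n) - u (node L J j) (t n)) / (L / J)
            + (u (node L J (j + 1)) (t (n - 1)) - u (node L J j) (t (n - 1))) / (L / J)) / 2 := by
        simp only [cellField, cellVal, if_neg hn1, half]; ring
      rw [e, _root_.abs_le]
      constructor <;> linarith [e1.1, e1.2, e2.1, e2.2]
  eq := fun n h1 hn j hj1 hj => by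
    have e : ∀ m, cellGrid (fun n j => U n j - u (node L J j) (t n)) m
        = cellGrid U m - cellField L J t u m := cellGrid_sub U _
    simp only [e, add_sub_cancel, secDiff_sub, mul_sub, Finset.sum_sub_distrib]
    have := hU.step_eq hα hm h1 hn hj1 hj
    unfold schemeRes
    linarith

lemma abs_init_le (h : SmoothField L T c B u) (hT : 0 < T) {x : ℝ} (hx : x ∈ Icc 0 L) :
    |u x 0| ≤ c := by
  have hcl : closure (Ioc 0 T) = Icc 0 T := closure_Ioc hT.ne
  refine le_on_closure (s := Ioc 0 T) (f := fun s => |u x s|) (g := fun _ => c)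
    (fun s hs => h.abs_le hx hs) ?_ continuousOn_const ?_
  · rw [hcl]; exact (h.continuous_time x hx).abs
  · rw [hcl]; exact ⟨le_rfl, hT.le⟩

/-- A crude bound free of any step restriction: backward Euler is unconditionally stable for U¹,
because the convection term drops out when tested with U¹ itself. -/
lemma gridNorm_first_error_le (h : SmoothField L T c B u) (hα : 0 < α) (hL : 0 < L) (hT : 0 < T)
    (hJ : 1 ≤ J) (hN : 1 ≤ N) (hu : IsExactSolution α L T f u₀ u)
    (hm : IsGradedMesh T γ Γ cγ k N t) (hU : IsDiscreteSolution α L J N t u₀ g U) :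
    gridNorm L J (fun j => U 1 j - u (node L J j) (t 1))
      ≤ (4 * c + T * c ^ 2 + tpow (α + 1) T * (secondBound L c B + 2 * B * L ^ 2)) * √L
        + gridNorm L J (schemeRes α L J t u g 1) := by
  obtain ⟨hc, hB, h3, h2⟩ := h.const_nonneg hL hT
  have ht1 := hm.mem_Ioc le_rfl hN
  have hJ' : (1 : ℝ) ≤ J := by exact_mod_cast hJ
  have hk : tstep t 1 = t 1 := by simp [tstep, hm.zero]
  set a := cellDiff (tpow (α + 1)) t 1 1 with ha
  have ha0 : 0 ≤ a := hm.cellDiff_nonneg hα hN hN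
  have haT : a ≤ tpow (α + 1) T := by
    have e : a = tpow (α + 1) (t 1) := by
      simp only [ha, cellDiff, Nat.sub_self, hm.zero, sub_self, sub_zero, zero_sub]
      rw [tpow_of_nonpos (x := 0) (by linarith) le_rfl,
        tpow_of_nonpos (x := -t 1) (by linarith) (by linarith [ht1.1])]
      ring
    rw [e]
    exact tpow_mono (by linarith) ht1.2
  set u₁ : ℕ → ℝ := fun j => u (node L J j) (t 1)
  set G : ℕ → ℝ := fun j => tstep t 1 * g 1 j with hG
  have hcf : cellField L J t u 1 = u₁ := by
    funext j; simp [cellField, cellVal, u₁]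
  have hu₁ : gridNorm L J u₁ ≤ c * √L := gridNorm_le_of_abs_le hL hc fun j _ hj =>
    h.abs_le (node_mem_Icc hL hJ hj.le) ht1
  have hU₀ : gridNorm L J (U 0) ≤ c * √L := gridNorm_le_of_abs_le hL hc fun j hj1 hj => by
    rw [hU.init_value j hj1 hj, ← hu.init_value _ (node_mem_Icc hL hJ hj.le)]
    exact h.abs_init_le hT (node_mem_Icc hL hJ hj.le)
  have hGle : gridNorm L J G ≤ (2 * c + T * c ^ 2
      + tpow (α + 1) T * (secondBound L c B + 2 * B * L ^ 2)) * √L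
      + gridNorm L J (schemeRes α L J t u g 1) := by
    -- There is no direct bound on the source, but G plus the residual contains only values of u.
    have e1 := gridNorm_sub_le hL J (G + schemeRes α L J t u g 1) (schemeRes α L J t u g 1)
    rw [add_sub_cancel_right] at e1
    refine e1.trans (add_le_add ?_ le_rfl)
    have htp := tpow_nonneg (by linarith : 0 < α + 1) T
    refine gridNorm_le_of_abs_le hL (by positivity) fun j hj1 hj => ?_
    have hx := node_mem_Icc hL hJ hj.le
    have e2 : (G + schemeRes α L J t u g 1) j = u₁ j - u (node L J j) 0
        + t 1 * (mean3 u₁ j * centDiff (L / J) u₁ j) - a * secDiff (L / J) u₁ j := by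
      simp only [Pi.add_apply, schemeRes, hcf, hk, hG, Finset.Icc_self, Finset.sum_singleton,
        Nat.sub_self, hm.zero, conv, u₁, ← ha]
      ring
    have b1 := _root_.abs_le.1 (h.abs_le hx ht1)
    have b2 := _root_.abs_le.1 (h.abs_init_le hT hx)
    have b3 : |t 1 * (mean3 u₁ j * centDiff (L / J) u₁ j)| ≤ T * (c * c) := by
      rw [abs_mul, abs_mul, abs_of_pos ht1.1]
      exact mul_le_mul ht1.2 (mul_le_mul (h.abs_mean3_le hL hj ht1)
        (h.abs_centDiff_le hL hj1 hj ht1) (abs_nonneg _) hc) (by positivity) hT.le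
    have b4 : |secDiff (L / J) u₁ j| ≤ secondBound L c B + 2 * B * L ^ 2 := by
      have e3 := _root_.abs_le.1 (h.node_estimates hL ht1 hj1 hj).1
      have e4 := _root_.abs_le.1 (((h.chain _ ht1).bounds hL).2 _ hx)
      have e5 : 2 * B * (L / J) ^ 2 ≤ 2 * B * L ^ 2 := by
        gcongr; exact div_le_self hL.le hJ'
      rw [_root_.abs_le]
      constructor <;> linarith [e3.1, e3.2, e4.1, e4.2]
    have b5 : |a * secDiff (L / J) u₁ j|
        ≤ tpow (α + 1) T * (secondBound L c B + 2 * B * L ^ 2) := by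
      rw [abs_mul, abs_of_nonneg ha0]
      exact mul_le_mul haT b4 (abs_nonneg _) htp
    have b3 := _root_.abs_le.1 b3
    have b5 := _root_.abs_le.1 b5
    rw [e2, _root_.abs_le]
    constructor <;> linarith [b1.1, b1.2, b2.1, b2.2, b3.1, b3.2, b5.1, b5.2]
  have hU₁ : gridNorm L J (U 1) ≤ gridNorm L J (U 0) + gridNorm L J G := by
    have z0 := hU.boundary_left 1 le_rfl hN
    have zJ := hU.boundary_right 1 le_rfl hN
    have e1 : gip L J (U 1) (U 1) = gip L J (U 0 + G + a • secDiff (L / J) (U 1)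
        - tstep t 1 • conv (L / J) (U 1) (U 1)) (U 1) := by
      refine gip_congr (fun j hj1 hj => ?_) fun _ _ _ => rfl
      have := hU.step_eq hα hm le_rfl hN hj1 hj
      simp only [cellGrid_one, Finset.Icc_self, Finset.sum_singleton, Nat.sub_self] at this
      simp only [Pi.add_apply, Pi.sub_apply, Pi.smul_apply, smul_eq_mul, hG]
      linarith
    rw [gip_self hL, gip_sub_left, gip_add_left, gip_add_left, gip_smul_left, gip_smul_left,
      gip_conv_self hL hJ _ z0 zJ, gip_secDiff hJ _ _ z0 zJ] at e1
    have e2 : 0 ≤ a * (L / J * ∑ j ∈ Finset.range J, ((U 1 (j + 1) - U 1 j) / (L / J)) *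
        ((U 1 (j + 1) - U 1 j) / (L / J))) :=
      mul_nonneg ha0 (mul_nonneg (by positivity)
        (Finset.sum_nonneg fun _ _ => mul_self_nonneg _))
    have e3 := gip_le hL J (U 0) (U 1)
    have e4 := gip_le hL J G (U 1)
    have e5 := gridNorm_nonneg L J (U 1)
    have e6 : gridNorm L J (U 1) * gridNorm L J (U 1)
        ≤ (gridNorm L J (U 0) + gridNorm L J G) * gridNorm L J (U 1) := by linarith
    rcases e5.eq_or_lt with h0 | h0
    · rw [← h0]; exact add_nonneg (gridNorm_nonneg _ _ _) (gridNorm_nonneg _ _ _)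
    · exact le_of_mul_le_mul_right e6 h0
  have := gridNorm_sub_le hL J (U 1) u₁
  change gridNorm L J (U 1 - u₁) ≤ _
  linarith

end SmoothField

/-- Stability applied to U - u. The supremum c₀ serves both as the bound on u and u_x and as the
Gronwall rate. -/
theorem theorem4p3
    (α L T σ γ M Cγ cγ Cf ρ c₀ : ℝ)
    (hα : α ∈ Set.Ioo (0 : ℝ) 1) (hL : 0 < L) (hT : 0 < T) (hσ : 0 < σ) (hγ : 1 ≤ γ)
    (hcγ : 0 < cγ) (hρ : 1 < ρ)
    (u f : ℝ → ℝ → ℝ) (u₀ : ℝ → ℝ)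
    (hu : IsExactSolution α L T f u₀ u)
    (hu4 : IsC4InSpace L T u)
    (hc₀ : IsLUB {r : ℝ | ∃ x ∈ Set.Icc 0 L, ∃ t ∈ Set.Ioc 0 T,
      r = |u x t| ∨ r = |dxPart L 1 u x t|} c₀)
    (huxx : HasTimeRegularity L T σ M (dxPart L 2 u))
    (hf : HasTimeRegularity L T σ M f) :
    ∃ C : ℝ, 0 < C ∧
      ∀ (J N : ℕ) (k : ℝ) (t : ℕ → ℝ) (g U : ℕ → ℕ → ℝ),
        1 ≤ J → 1 ≤ N → 0 < k →
        IsGradedMesh T γ Cγ cγ k N t →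
        (γ = 2 / σ → ρ * t 1 ≤ t N) →
        c₀ * tstep t N ≤ 1 →
        IsSourceApprox L T Cf f J N t g →
        IsDiscreteSolution α L J N t u₀ g U →
        ∀ n, 1 ≤ n → n ≤ N →
          gridNorm L J (fun j => U n j - u (node L J j) (t n))
            ≤ C * ((L / J) ^ 2 + errK σ γ k (t 1) (t N)) := by
  obtain ⟨hC4, B, hB4⟩ := hu4
  have hs : SmoothField L T c₀ B u :=
    { chain := fun t ht => c4Chain_of_contDiffOn hL (hC4 t ht)
        (fun x hx => hc₀.1 ⟨x, hx, t, ht, Or.inl rfl⟩)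
        (fun x hx => hc₀.1 ⟨x, hx, t, ht, Or.inr rfl⟩) fun x hx => hB4 x hx t ht
      continuous_time := hu.continuous_time
      boundary_left := hu.boundary_left
      boundary_right := hu.boundary_right }
  obtain ⟨hc, hB, h3, h2⟩ := hs.const_nonneg hL hT
  have hv : RegularField L T σ M (secondBound L c₀ B) (dxPart L 2 u) :=
    ⟨huxx, fun x hx t ht => ((hs.chain t ht).bounds hL).2 x (Ioo_subset_Icc_self hx)⟩
  have hM := hf.nonneg hT
  -- The mesh constant may be enlarged, so that it is at least 1.
  have hΓ : 1 ≤ max Cγ 1 := le_max_right _ _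
  obtain ⟨C₁, hC₁, hres⟩ := exists_sum_schemeRes_le (Cf := Cf) hα hL hT hσ hγ hΓ hcγ hρ hM h2 hu hs
    hv hf
  obtain ⟨C₂, hC₂, hfirst⟩ := exists_first_rpow_le_errK hT hσ hγ hΓ hcγ hρ
  have htp := tpow_nonneg (by linarith [hα.1] : 0 < α + 1) T
  set K := (4 * c₀ + T * c₀ ^ 2 + tpow (α + 1) T * (secondBound L c₀ B + 2 * B * L ^ 2)) * √L
    with hK
  have hK0 : 0 ≤ K := by positivity
  set A := Real.exp (2 * c₀ * T) * ((1 + c₀ * T) * (K * c₀ ^ σ * C₂ + C₁) + 2 * C₁) with hA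
  have hA0 : 0 ≤ A := by positivity
  refine ⟨A + 1, by positivity, fun J N k t g U hJ hN hk hm hend hcN hg hU n h1 hn => ?_⟩
  have hm := hm.enlarge hk (le_max_left Cγ 1)
  have ht1 := hm.pos le_rfl hN
  have hE0 := errK_nonneg (σ := σ) (γ := γ) hk.le ht1 (hm.mono hN le_rfl)
  have hR := hres J N k t g hJ hN hk hm hend hg
  have ht1E := hfirst N k t hk hN hm hend
  set E := errK σ γ k (t 1) (t N)
  set R := ∑ n ∈ Finset.Icc 1 N, gridNorm L J (schemeRes α L J t u g n)
  have hR0 : 0 ≤ R := Finset.sum_nonneg fun _ _ => gridNorm_nonneg _ _ _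
  have hR1 : gridNorm L J (schemeRes α L J t u g 1) ≤ R :=
    Finset.single_le_sum (f := fun n => gridNorm L J (schemeRes α L J t u g n))
      (fun _ _ => gridNorm_nonneg _ _ _) (Finset.mem_Icc.2 ⟨le_rfl, hN⟩)
  have hH0 : 0 ≤ (L / J) ^ 2 := sq_nonneg _
  set H := (L / J) ^ 2
  -- If c₀ t₁ > 1, then K ≤ K (c₀ t₁)^σ, which turns the crude first-step bound into one of order
  -- t₁^σ = O(K_L).
  have hstab := (hs.isErrorEq hα.1 hL hJ hu hm hU).gridNorm_le hα hL hT.le hc hJ hm hcN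
    (y := K * (c₀ * t 1) ^ σ + R) (by positivity) (fun hlong => by
      refine (hs.gridNorm_first_error_le hα.1 hL hT hJ hN hu hm hU).trans (add_le_add ?_ hR1)
      exact le_mul_of_one_le_right hK0 (Real.one_le_rpow hlong.le hσ.le)) n h1 hn
  refine hstab.trans ?_
  have e1 : K * (c₀ * t 1) ^ σ ≤ K * c₀ ^ σ * C₂ * (H + E) := by
    rw [Real.mul_rpow hc ht1.le]
    have := mul_le_mul_of_nonneg_left ht1E (by positivity : 0 ≤ K * c₀ ^ σ)
    have h5 : 0 ≤ K * c₀ ^ σ * C₂ * H := by positivity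
    linarith
  calc _ ≤ Real.exp (2 * c₀ * T)
        * ((1 + c₀ * T) * (K * c₀ ^ σ * C₂ * (H + E) + C₁ * (H + E)) + 2 * (C₁ * (H + E))) := by
        gcongr
    _ = A * (H + E) := by rw [hA]; ring
    _ ≤ (A + 1) * (H + E) := by linarith
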